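/- **Definitions.** A *Grassmannian forest on $n\ge 0$ leaves* is a finite acyclic graph properly embedded in a closed disk, considered up to homeomorphism, with $n$ boundary vertices $b_1,\dots,b_n$ of degree one lying in clockwise order on the boundary circle; every other (internal) vertex $v$ lies in the interior of the disk, is joined by a path to some boundary vertex, has degree $\deg(v)\ne 2$, and carries an integer $h(v)$ (its helicity), where $h(v)\in\{0,1\}$ if $v$ is a degree-one vertex adjacent to a boundary vertex and $1\le h(v)\le \deg(v)-1$ otherwise. A connected Grassmannian forest is a *Grassmannian tree*. The forest $F$ is of *type* $(k,n)$ if $k=\sum_{v}\bigl(h(v)-\tfrac12\deg(v)\bigr)+\tfrac n2$, the sum being over internal vertices. An internal vertex $v$ is *white* if $h(v)=1$, *black* if $h(v)=\deg(v)-1$, and *generic* if it is neither. $F$ is *contracted* if no two adjacent internal vertices are both white or both black. Put $m(v)=2\deg(v)-4$ if $v$ is generic and $m(v)=\deg(v)-1$ otherwise. The *M-dimension* of a tree $T$ with $n$ leaves is $n-1$ if $n\le 2$ and $1+\sum_v (m(v)-1)$ otherwise; the M-dimension of a forest is the sum of the M-dimensions of its connected components. Let $$C(x,y,q)=\frac{x\left(1-x(1+y)q^2-x^2yq^2(1+q-q^2)-x^4y^2q^5(1+q)\right)}{(1+xq)(1+xyq)(1-xq^2)(1-xyq^2)},$$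 expanded as a power series in $x$ over $\mathbb{Q}[y,q]$, and let $\langle -1\rangle$ denote the compositional inverse with respect to $x$. Define $G_{\mathrm{tree}}$ and $G_{\mathrm{forest}}$ in $\mathbb{Q}[y,q][[x]]$ by $$G_{\mathrm{tree}}=x\left(1+y+yq\,C^{\langle -1\rangle}(x,y,q)\right),\qquad x\,G_{\mathrm{forest}}=\left(\frac{x}{1+G_{\mathrm{tree}}}\right)^{\langle -1\rangle}.$$ **Theorem.** 1. For all $n,k,r\ge 0$, the number of contracted Grassmannian trees of type $(k,n)$ with M-dimension $r$ is finite and equals $[x^ny^kq^r]\,G_{\mathrm{tree}}$. 2. For all $n,k,r\ge 0$, the number of contracted Grassmannian forests of type $(k,n)$ with M-dimension $r$ is finite and equals $[x^ny^kq^r]\,G_{\mathrm{forest}}$. Moreover, for all $n\ge 0$, $$[x^n]\,G_{\mathrm{forest}}=\frac1{n+1}\,[x^n]\left(1+G_{\mathrm{tree}}\right)^{n+1}.$$ 3. $G_{\mathrm{tree}}$ and $G_{\mathrm{forest}}$ are algebraic of degree exactly $5$ and $6$, respectively (these are the least degrees of nonzero polynomials in one unknown over $\mathbb{Q}[x,y,q]$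 that they annihilate). Explicitly, $G=G_{\mathrm{tree}}$ satisfies $$\begin{gathered} 0=q (q+1) G^5+q x (q^2 x y-5 q (y+1)-5 (y+1)) G^4+x^2 (q (-3 q^2 x y (y+1)+q (10-y ((x-10) y+x-19))+y\\ (10 y+21)+10)+y) G^3+x^3 (q^3 x y (y (3 y+7)+3)+q^2 (y+1) (y (2 (x-5) y+2 x-17)-10)-q (y (y (-x+10\\ y+32)+32)+10)-3 y (y+1)) G^2-x^4 (q^3 x y (y+1) (y (y+4)+1)+q^2 (y+1) (y ((x-5) y^2+3 (x-4)\\ y+x-12)-5)-q (y+1) (y (y (-x+5 y+16)+16)+5)-y (y (3 y+5)+3)) G+x^5 (q^3 x y^2 (y+1)^2-q^2 (y+1)^2 (y\\ (y (-x+y+2)+2)+1)-q (y (y (y (-x+y (y+5)+10)+10)+5)+1)-y (y+1) (y^2+y+1)) \end{gathered}$$ and $G=G_{\mathrm{forest}}$ satisfies $$\begin{gathered} 0=q (x-1) x^2 y (x y-1) (q (x y+x-1)+x) (q (x y+x-1)+x y) G^6+(q^3 x^2 y (x y+x-1) (x (x y (y+4)+x-5\\ (y+1))+4)+q^2 (x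 (x (-(x^3 (y+1) (y (y+2) (y^2+1)+1))+x^2 (y+1)^2 (y (5 y+3)+5)-2 x (y+1) (y (5\\ y+7)+5)+y (10 y+19)+10)-5 (y+1))+1)-q (x^2 (y^2+y+1)-2 x (y+1)+1) (x (x (x (y+1) (y (y+3)+1)-y (3\\ y+8)-3)+3 (y+1))-1)-x^2 y (x y+x-1) (x^2 (y^2+y+1)-2 x (y+1)+1)) G^5+(q^3 x^2 y (x^2 (y (3 y+7)+3)-9\\ x (y+1)+6)-q^2 (x (x (5 x^2 (y+1)^2 (y^2+y+1)-x (y+1) (y (20 y+31)+20)+30 y^2+57 y+30)-20\\ (y+1))+5)-q (x (x (x^2 (y (y (y (5 y+21)+31)+21)+5)-4 x (y+1) (y (5 y+11)+5)+30 y^2+63 y+30)-20\\ (y+1))+5)-x^2 y (x^2 (y (3 y+5)+3)-6 x (y+1)+3)) G^4+(-10 q (q+1) x^3 y^3+(q+1) x^2 y^2 ((q (3\\ q-29)-3) x+30 q)+x y ((q+1) (q (3 q-29)-3) x^2+(q (q (57-4 q)+63)+3) x-30 q (q+1))-10 q (q+1)\\ (x-1)^3) G^3+(q+1) (q^2 x^2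 y-10 q (x y+x-1)^2-x^2 y) G^2-5 q (q+1) (x y+x-1) G-q (q+1). \end{gathered}$$ 4. For all $n,k\ge 0$, the number of contracted Grassmannian forests of type $(k,n)$ with M-dimension $0$ is $[x^ny^kq^0]\,G_{\mathrm{forest}}=\binom nk$. 5. For all $0\le k\le n$, $[x^ny^k]\,G_{\mathrm{forest}}(x,y,-1)=1$; equivalently, $\sum_{F}(-1)^{d(F)}=1$, where the sum is over all contracted Grassmannian forests $F$ of type $(k,n)$ and $d(F)$ is the M-dimension of $F$. Consequently, any CW complex whose $r$-dimensional cells are, for every $r\ge 0$, in bijection with the contracted Grassmannian forests of type $(k,n)$ with M-dimension $r$ (as is conjectured of the momentum amplituhedron, for $2\le k\le n-2$) has Euler characteristic $1$. -/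

import Mathlib

open scoped PowerSeries

namespace MomAmp

/-! ### Grassmannian forests -/

/-- A Grassmannian forest on `n` leaves: an acyclic series-reduced planar graph in a disk, with
boundary vertices `Sum.inl 0, …, Sum.inl (n - 1)` of degree one in clockwise order on the boundary
circle and internal vertices `Sum.inr v`, each internal vertex carrying a helicity.
Since the graph is acyclic, has no internal vertices of degree two, and every vertex of degree one
is a boundary vertex or is joined to one, an embedding in the disk with the prescribed boundary is
unique up to homeomorphism, and it exists exactly when no two vertex-disjoint paths join interlaced
pairs of boundary vertices; this is the field `planar`. -/
structure GrassmannianForest (n : ℕ) where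
  /-- the number of internal vertices -/
  numInternal : ℕ
  /-- the underlying graph -/
  graph : SimpleGraph (Fin n ⊕ Fin numInternal)
  acyclic : graph.IsAcyclic
  boundary_degree : ∀ i : Fin n, (graph.neighborSet (Sum.inl i)).ncard = 1
  connected_to_boundary : ∀ v : Fin numInternal, ∃ i : Fin n,
    graph.Reachable (Sum.inr v) (Sum.inl i)
  series_reduced : ∀ v : Fin numInternal, (graph.neighborSet (Sum.inr v)).ncard ≠ 2
  planar : ∀ a b c d : Fin n, a < b → b < c → c < d →
    ∀ (p : graph.Walk (Sum.inl a) (Sum.inl c)) (p' : graph.Walk (Sum.inl b) (Sum.inl d)),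
      ∃ u, u ∈ p.support ∧ u ∈ p'.support
  /-- the helicity of an internal vertex -/
  helicity : Fin numInternal → ℕ
  /-- boundary leaves (internal vertices of degree one joined to a boundary vertex) have helicity
  `0` or `1` -/
  helicity_boundaryLeaf : ∀ v : Fin numInternal,
    ((graph.neighborSet (Sum.inr v)).ncard = 1 ∧ ∃ i : Fin n, graph.Adj (Sum.inr v) (Sum.inl i)) →
      helicity v = 0 ∨ helicity v = 1
  /-- all other internal vertices have helicity between `1` and the degree minus one -/
  helicity_of_not_boundaryLeaf : ∀ v : Fin numInternal,
    ¬ ((graph.neighborSet (Sum.inr v)).ncard = 1 ∧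
        ∃ i : Fin n, graph.Adj (Sum.inr v) (Sum.inl i)) →
      1 ≤ helicity v ∧ helicity v + 1 ≤ (graph.neighborSet (Sum.inr v)).ncard

namespace GrassmannianForest

variable {n : ℕ}

/-- The degree of an internal vertex. -/
noncomputable def deg (F : GrassmannianForest n) (v : Fin F.numInternal) : ℕ :=
  (F.graph.neighborSet (Sum.inr v)).ncard

/-- White vertices have helicity one. -/
def IsWhite (F : GrassmannianForest n) (v : Fin F.numInternal) : Prop :=
  F.helicity v = 1

/-- Black vertices have helicity equal to the degree minus one. -/
def IsBlack (F : GrassmannianForest n) (v : Fin F.numInternal) : Prop :=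
  F.helicity v + 1 = F.deg v

/-- A vertex is generic if it is neither white nor black. -/
def IsGeneric (F : GrassmannianForest n) (v : Fin F.numInternal) : Prop :=
  ¬ F.IsWhite v ∧ ¬ F.IsBlack v

/-- A forest is a tree if it is connected. -/
def IsTree (F : GrassmannianForest n) : Prop := F.graph.Connected

/-- A forest is contracted if no two adjacent internal vertices can be contracted into one, that
is, no two adjacent internal vertices are both white or both black. -/
def IsContracted (F : GrassmannianForest n) : Prop :=
  ∀ v w : Fin F.numInternal, F.graph.Adj (Sum.inr v) (Sum.inr w) →
    ¬ (F.IsWhite v ∧ F.IsWhite w) ∧ ¬ (F.IsBlack v ∧ F.IsBlack w)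

/-- The helicity `∑ᵥ (h(v) - deg(v) / 2) + n / 2` of a forest on `n` leaves. -/
noncomputable def totalHelicity (F : GrassmannianForest n) : ℚ :=
  ∑ v, ((F.helicity v : ℚ) - (F.deg v : ℚ) / 2) + (n : ℚ) / 2

/-- The forest is of type `(k, n)`. -/
def HasType (F : GrassmannianForest n) (k : ℕ) : Prop := F.totalHelicity = k

/-- The statistic `m(v)`: `2 deg(v) - 4` if `v` is generic, and `deg(v) - 1` otherwise. -/
noncomputable def vertexStat (F : GrassmannianForest n) (v : Fin F.numInternal) : ℤ :=
  open Classical in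
  if F.IsGeneric v then 2 * (F.deg v : ℤ) - 4 else (F.deg v : ℤ) - 1

/-- The number of boundary vertices of a tree (connected component) of the forest. -/
noncomputable def numLeaves (F : GrassmannianForest n) (T : F.graph.ConnectedComponent) : ℕ :=
  {i : Fin n | F.graph.connectedComponentMk (Sum.inl i) = T}.ncard

/-- The dimension of a tree (connected component) `T` of the forest: the number of leaves minus one
if there are at most two leaves, and `1 + ∑ (m(v) - 1)` over the internal vertices `v` of `T`
otherwise. -/
noncomputable def treeDim (F : GrassmannianForest n) (T : F.graph.ConnectedComponent) : ℤ :=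
  open Classical in
  if F.numLeaves T ≤ 2 then (F.numLeaves T : ℤ) - 1
  else 1 + ∑ v with F.graph.connectedComponentMk (Sum.inr v) = T, (F.vertexStat v - 1)

/-- The M-dimension of a forest: the sum of the dimensions of its trees. -/
noncomputable def momDim (F : GrassmannianForest n) : ℤ :=
  ∑ᶠ T : F.graph.ConnectedComponent, F.treeDim T

/-- Two forests are identified if a helicity-preserving graph isomorphism fixing every boundary
vertex carries one to the other. -/
def Equivalent (F F' : GrassmannianForest n) : Prop :=
  ∃ e : Fin F.numInternal ≃ Fin F'.numInternal,
    (∀ a b, F'.graph.Adj (Sum.map id e a) (Sum.map id e b) ↔ F.graph.Adj a b) ∧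
      ∀ v, F'.helicity (e v) = F.helicity v

theorem Equivalent.refl (F : GrassmannianForest n) : F.Equivalent F :=
  ⟨Equiv.refl _, by simp, by simp⟩

theorem Equivalent.symm {F F' : GrassmannianForest n} (h : F.Equivalent F') :
    F'.Equivalent F := by
  obtain ⟨e, h1, h2⟩ := h
  refine ⟨e.symm, fun a b => ?_, fun v => ?_⟩
  · rw [← h1]
    simp
  · rw [← h2]
    simp

theorem Equivalent.trans {F F' F'' : GrassmannianForest n} (h : F.Equivalent F')
    (h' : F'.Equivalent F'') : F.Equivalent F'' := by
  obtain ⟨e, h1, h2⟩ := h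
  obtain ⟨e', h1', h2'⟩ := h'
  refine ⟨e.trans e', fun a b => ?_, fun v => ?_⟩
  · rw [← h1, ← h1']
    simp
  · simp [h2, h2']

/-- Grassmannian forests on `n` leaves up to homeomorphism. -/
instance setoid (n : ℕ) : Setoid (GrassmannianForest n) where
  r := Equivalent
  iseqv := ⟨Equivalent.refl, Equivalent.symm, Equivalent.trans⟩

end GrassmannianForest

/-- The set of contracted Grassmannian forests of type `(k, n)` with M-dimension `r`, up to
homeomorphism. -/
def contractedForests (k n r : ℕ) : Set (Quotient (GrassmannianForest.setoid n)) :=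
  {c | ∃ F : GrassmannianForest n, Quotient.mk _ F = c ∧
    F.IsContracted ∧ F.HasType k ∧ F.momDim = r}

/-- The set of contracted Grassmannian trees of type `(k, n)` with M-dimension `r`, up to
homeomorphism. -/
def contractedTrees (k n r : ℕ) : Set (Quotient (GrassmannianForest.setoid n)) :=
  {c | ∃ F : GrassmannianForest n, Quotient.mk _ F = c ∧
    F.IsTree ∧ F.IsContracted ∧ F.HasType k ∧ F.momDim = r}

/-! ### Generating functions -/

/-- The ring `ℚ[y][q]`; generating functions are power series in `x` over it. -/
abbrev CoeffRing : Type := Polynomial (Polynomial ℚ)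

/-- The variable `x`. -/
noncomputable def x : CoeffRing⟦X⟧ := PowerSeries.X

/-- The variable `y`. -/
noncomputable def y : CoeffRing⟦X⟧ := PowerSeries.C (Polynomial.C Polynomial.X)

/-- The variable `q`. -/
noncomputable def q : CoeffRing⟦X⟧ := PowerSeries.C Polynomial.X

/-- The coefficient `[xⁿ yᵏ qʳ] G`. -/
noncomputable def coeffXYQ (G : CoeffRing⟦X⟧) (n k r : ℕ) : ℚ :=
  ((PowerSeries.coeff n G).coeff r).coeff k

theorem isUnit_coeff_one_x_mul {f : CoeffRing⟦X⟧} (hf : PowerSeries.constantCoeff f = 1) :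
    IsUnit (PowerSeries.coeff 1 (x * f)) := by
  have h : PowerSeries.coeff 1 (x * f) = PowerSeries.coeff 0 f := by
    rw [x]
    exact PowerSeries.coeff_succ_X_mul 0 f
  rw [h, PowerSeries.coeff_zero_eq_constantCoeff_apply, hf]
  exact isUnit_one

/-- The denominator of `C(x, y, q)`. -/
noncomputable def denC : CoeffRing⟦X⟧ :=
  (1 + x * q) * (1 + x * y * q) * (1 - x * q ^ 2) * (1 - x * y * q ^ 2)

/-- The numerator of `C(x, y, q)`, divided by `x`. -/
noncomputable def numC : CoeffRing⟦X⟧ :=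
  1 - x * (1 + y) * q ^ 2 - x ^ 2 * y * q ^ 2 * (1 + q - q ^ 2) - x ^ 4 * y ^ 2 * q ^ 5 * (1 + q)

/-- The expansion of the rational function `C(x, y, q)` as a power series in `x`. -/
noncomputable def seriesC : CoeffRing⟦X⟧ :=
  x * (numC * PowerSeries.invOfUnit denC 1)

theorem constantCoeff_denC : PowerSeries.constantCoeff denC = 1 := by
  simp [denC, x]

theorem seriesC_mul_denC : seriesC * denC = x * numC := by
  rw [seriesC, mul_assoc, mul_assoc, PowerSeries.invOfUnit_mul _ _ (by simp [constantCoeff_denC]),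
    mul_one]

theorem isUnit_coeff_one_seriesC : IsUnit (PowerSeries.coeff 1 seriesC) :=
  isUnit_coeff_one_x_mul (by simp [numC, x])

/-- The generating function `G_tree = x (1 + y + y q C⁻¹)`, where `C⁻¹` is the compositional inverse
with respect to `x`. -/
noncomputable def treeGF : CoeffRing⟦X⟧ :=
  x * (1 + y + y * q * seriesC.substInvOfIsUnit isUnit_coeff_one_seriesC)

/-- The power series `x / (1 + G_tree)`. -/
noncomputable def xDivOneAddTreeGF : CoeffRing⟦X⟧ :=
  x * PowerSeries.invOfUnit (1 + treeGF) 1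

theorem xDivOneAddTreeGF_mul : xDivOneAddTreeGF * (1 + treeGF) = x := by
  rw [xDivOneAddTreeGF, mul_assoc, PowerSeries.invOfUnit_mul _ _ (by simp [treeGF, x]), mul_one]

theorem isUnit_coeff_one_xDivOneAddTreeGF : IsUnit (PowerSeries.coeff 1 xDivOneAddTreeGF) :=
  isUnit_coeff_one_x_mul (by simp)

/-- The generating function `G_forest`, determined by `x G_forest = (x / (1 + G_tree))⁻¹`, where the
inverse is the compositional inverse with respect to `x`. -/
noncomputable def forestGF : CoeffRing⟦X⟧ :=
  PowerSeries.mk fun n => PowerSeries.coeff (n + 1)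
    (xDivOneAddTreeGF.substInvOfIsUnit isUnit_coeff_one_xDivOneAddTreeGF)

/-- A power series in `x` is algebraic of degree `d` over the field of rational functions in
`x, y, q` if `d` is the least degree of a nonzero polynomial with coefficients in `ℚ[x, y, q]` that
it annihilates. -/
def IsAlgebraicOfDegree (G : CoeffRing⟦X⟧) (d : ℕ) : Prop :=
  IsLeast {m : ℕ | ∃ P : Polynomial (Polynomial CoeffRing),
    P ≠ 0 ∧ P.natDegree = m ∧ P.eval₂ Polynomial.coeToPowerSeries.ringHom G = 0} d

/-- The left-hand side of the quintic equation for `G_tree`. -/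
def treeRelation {R : Type*} [CommRing R] (x y q G : R) : R :=
    q * (q + 1) * G^5 + q * x * (q^2 * x * y - 5 * q * (y + 1) - 5 * (y + 1)) * G^4 + x^2 * (q *
    (-3 * q^2 * x * y * (y + 1) + q * (10 - y * ((x - 10) * y + x - 19)) + y * (10 * y + 21) +
    10) + y) * G^3 + x^3 * (q^3 * x * y * (y * (3 * y + 7) + 3) + q^2 * (y + 1) * (y * (2 * (x -
    5) * y + 2 * x - 17) - 10) - q * (y * (y * (-x + 10 * y + 32) + 32) + 10) - 3 * y * (y + 1))
    * G^2 - x^4 * (q^3 * x * y * (y + 1) * (y * (y + 4) + 1) + q^2 * (y + 1) * (y * ((x - 5) *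
    y^2 + 3 * (x - 4) * y + x - 12) - 5) - q * (y + 1) * (y * (y * (-x + 5 * y + 16) + 16) + 5)
    - y * (y * (3 * y + 5) + 3)) * G + x^5 * (q^3 * x * y^2 * (y + 1)^2 - q^2 * (y + 1)^2 * (y *
    (y * (-x + y + 2) + 2) + 1) - q * (y * (y * (y * (-x + y * (y + 5) + 10) + 10) + 5) + 1) - y
    * (y + 1) * (y^2 + y + 1))

/-- The left-hand side of the sextic equation for `G_forest`. -/
def forestRelation {R : Type*} [CommRing R] (x y q G : R) : R :=
    q * (x - 1) * x^2 * y * (x * y - 1) * (q * (x * y + x - 1) + x) * (q * (x * y + x - 1) + x *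
    y) * G^6 + (q^3 * x^2 * y * (x * y + x - 1) * (x * (x * y * (y + 4) + x - 5 * (y + 1)) + 4)
    + q^2 * (x * (x * (-(x^3 * (y + 1) * (y * (y + 2) * (y^2 + 1) + 1)) + x^2 * (y + 1)^2 * (y *
    (5 * y + 3) + 5) - 2 * x * (y + 1) * (y * (5 * y + 7) + 5) + y * (10 * y + 19) + 10) - 5 *
    (y + 1)) + 1) - q * (x^2 * (y^2 + y + 1) - 2 * x * (y + 1) + 1) * (x * (x * (x * (y + 1) *
    (y * (y + 3) + 1) - y * (3 * y + 8) - 3) + 3 * (y + 1)) - 1) - x^2 * y * (x * y + x - 1) *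
    (x^2 * (y^2 + y + 1) - 2 * x * (y + 1) + 1)) * G^5 + (q^3 * x^2 * y * (x^2 * (y * (3 * y +
    7) + 3) - 9 * x * (y + 1) + 6) - q^2 * (x * (x * (5 * x^2 * (y + 1)^2 * (y^2 + y + 1) - x *
    (y + 1) * (y * (20 * y + 31) + 20) + 30 * y^2 + 57 * y + 30) - 20 * (y + 1)) + 5) - q * (x *
    (x * (x^2 * (y * (y * (y * (5 * y + 21) + 31) + 21) + 5) - 4 * x * (y + 1) * (y * (5 * y +
    11) + 5) + 30 * y^2 + 63 * y + 30) - 20 * (y + 1)) + 5) - x^2 * y * (x^2 * (y * (3 * y + 5)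
    + 3) - 6 * x * (y + 1) + 3)) * G^4 + (-10 * q * (q + 1) * x^3 * y^3 + (q + 1) * x^2 * y^2 *
    ((q * (3 * q - 29) - 3) * x + 30 * q) + x * y * ((q + 1) * (q * (3 * q - 29) - 3) * x^2 + (q
    * (q * (57 - 4 * q) + 63) + 3) * x - 30 * q * (q + 1)) - 10 * q * (q + 1) * (x - 1)^3) * G^3
    + (q + 1) * (q^2 * x^2 * y - 10 * q * (x * y + x - 1)^2 - x^2 * y) * G^2 - 5 * q * (q + 1) *
    (x * y + x - 1) * G - q * (q + 1)

end MomAmp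

/-! The proof is a bijection between homeomorphism classes and combinatorial codes, followed by a
weighted count of the codes and some algebra.

Codes. Root every component of a contracted forest at its smallest boundary vertex. What hangs from
the root is a plane tree (`Term`) whose leaves, read from left to right, are the remaining boundary
vertices in increasing order. A vertex with c children has degree c + 1, so it is white for h = 1
and black for h = c. A forest thus becomes a finite set of pairs (smallest leaf, plane tree) whose
leaf sets form a noncrossing partition of {0, …, n - 1} (`IsForest`). Planarity enters through one
principle: in a planar forest the leaves below any vertex form an interval among the leaves of its
component, and conversely this together with noncrossing components gives planarity
(`Orientation.convex_of_planar`, `Orientation.planar_of_convex`). Every code is realized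
(`exists_isCoding`), every contracted forest has a code (`exists_code`), the code is unique
(`IsCoding.unique`), and forests with equal codes are equivalent (`IsCoding.equivalent`).

Counting trees. Give a vertex the weight y^(h-1) q^(m(v)-1), and let P, U, V be the generating
functions of all, of non-white-rooted and of non-black-rooted plane trees. In a contracted tree the
children of a white vertex are not white, so P - U = Σ_{c≥2} q^(c-1) U^c, that is, U = P/(1 + qP);
likewise V = P/(1 + yqP). Generic roots contribute y q³ P³ / ((1 - q²P)(1 - yq²P)). Adding up, P = x
+ (P - U) + (P - V) + (generic part), which says exactly x = C(P) (`invC_eq`, `sumsUpTo`). A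
component is a root leaf carrying either a boundary leaf of helicity 0 or 1, or a plane tree with an
extra factor yq, whence G_tree = x(1 + y + yqP).

Counting forests. In a noncrossing partition, each leaf of the component of the first leaf is
followed by a gap filled with an arbitrary forest. Hence F = 1 + G_tree(xF)
(`sumForest_and_sumExtForest`), and xF is the inverse of x/(1 + G_tree); Lagrange inversion gives
the coefficient formula.

Algebra. Write C = N/D. Then N(P) = xD(P), and G_tree is affine in P; for forests, 1/F is affine in
p = P(xF) and N(p) = xF D(p). Elimination gives the stated polynomials. Their degrees are minimal
because x is a rational function of p in lowest terms, and its degree is that of the field extension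
(`natDegree_le_of_eval₂_eq_zero`). At q = 0 one gets F = 1/(1 - x(1 + y)), and at q = -1 one gets F
= 1/((1 - x)(1 - xy)); these give the binomial count and the alternating sum. -/

namespace MomAmp

/-! ### Substitution of power series -/

section substHom

variable {R : Type*} [CommRing R] {a : R⟦X⟧} (ha : PowerSeries.constantCoeff a = 0)

/-- Substitution of a power series without constant term, as a homomorphism. -/
noncomputable def substHom {R : Type*} [CommRing R] (a : R⟦X⟧)
    (ha : PowerSeries.constantCoeff a = 0) : R⟦X⟧ →+* R⟦X⟧ :=
  (PowerSeries.substAlgHom (R := R) (PowerSeries.HasSubst.of_constantCoeff_zero' ha)).toRingHom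

theorem substHom_apply (f : R⟦X⟧) : substHom a ha f = f.subst a := by
  rw [substHom, AlgHom.toRingHom_eq_coe, RingHom.coe_coe, PowerSeries.coe_substAlgHom]

@[simp]
theorem substHom_X : substHom a ha PowerSeries.X = a := by
  rw [substHom_apply, PowerSeries.subst_X (PowerSeries.HasSubst.of_constantCoeff_zero' ha)]

@[simp]
theorem substHom_C (r : R) : substHom a ha (PowerSeries.C r) = PowerSeries.C r := by
  rw [substHom_apply]
  exact PowerSeries.subst_C r

theorem constantCoeff_substHom (f : R⟦X⟧) :
    PowerSeries.constantCoeff (substHom a ha f) = PowerSeries.constantCoeff f := by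
  rw [PowerSeries.eq_X_mul_shift_add_const f, map_add, map_mul, substHom_X, substHom_C]
  simp [ha]

theorem substHom_substInvOfIsUnit_right {a : R⟦X⟧} (ha : PowerSeries.constantCoeff a = 0)
    (h : IsUnit (PowerSeries.coeff 1 a)) :
    substHom (a.substInvOfIsUnit h) (PowerSeries.constantCoeff_substInvOfIsUnit _ _) a =
      PowerSeries.X := by
  rw [substHom_apply]
  exact PowerSeries.subst_substInvOfIsUnit_right a ha h

theorem substHom_substInvOfIsUnit_left (h : IsUnit (PowerSeries.coeff 1 a)) :
    substHom a ha (a.substInvOfIsUnit h) = PowerSeries.X := by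
  rw [substHom_apply]
  exact PowerSeries.subst_substInvOfIsUnit_left a ha h

end substHom

section substHom

variable {a : CoeffRing⟦X⟧} (ha : PowerSeries.constantCoeff a = 0)

@[simp]
theorem substHom_x : substHom a ha x = a := substHom_X ha

@[simp]
theorem substHom_y : substHom a ha y = y := substHom_C ha _

@[simp]
theorem substHom_q : substHom a ha q = q := substHom_C ha _

end substHom

/-! ### The compositional inverses -/

/-- The compositional inverse of `C`. -/
noncomputable def invC : CoeffRing⟦X⟧ := seriesC.substInvOfIsUnit isUnit_coeff_one_seriesC

theorem constantCoeff_invC : PowerSeries.constantCoeff invC = 0 :=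
  PowerSeries.constantCoeff_substInvOfIsUnit _ _

theorem constantCoeff_seriesC : PowerSeries.constantCoeff seriesC = 0 := by
  simp [seriesC, x]

theorem substHom_invC_seriesC : substHom invC constantCoeff_invC seriesC = x :=
  substHom_substInvOfIsUnit_right constantCoeff_seriesC _

theorem treeGF_eq : treeGF = x * (1 + y + y * q * invC) := rfl

theorem constantCoeff_treeGF : PowerSeries.constantCoeff treeGF = 0 := by
  simp [treeGF, x]

/-- The numerator of `C` at an element of a ring. -/
def evalNum {R : Type*} [CommRing R] (y q p : R) : R :=
  p * (1 - p * (1 + y) * q ^ 2 - p ^ 2 * y * q ^ 2 * (1 + q - q ^ 2) -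
    p ^ 4 * y ^ 2 * q ^ 5 * (1 + q))

/-- The denominator of `C` at an element of a ring. -/
def evalDen {R : Type*} [CommRing R] (y q p : R) : R :=
  (1 + p * q) * (1 + p * y * q) * (1 - p * q ^ 2) * (1 - p * y * q ^ 2)

theorem map_evalNum {R S : Type*} [CommRing R] [CommRing S] (f : R →+* S) (y q p : R) :
    f (evalNum y q p) = evalNum (f y) (f q) (f p) := by
  simp [evalNum]

theorem map_evalDen {R S : Type*} [CommRing R] [CommRing S] (f : R →+* S) (y q p : R) :
    f (evalDen y q p) = evalDen (f y) (f q) (f p) := by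
  simp [evalDen]

theorem evalNum_invC : evalNum y q invC = x * evalDen y q invC := by
  have h := congrArg (substHom invC constantCoeff_invC) seriesC_mul_denC
  rw [map_mul, substHom_invC_seriesC, denC, numC] at h
  simp only [map_mul, map_add, map_sub, map_one, map_pow, substHom_x, substHom_y, substHom_q] at h
  rw [evalNum, evalDen, h]

/-- The quintic is nothing but N(p) - xD(p), rewritten in the unknown G = x(1 + y + yqp) and cleared
of denominators; this is a polynomial identity. -/
theorem treeRelation_mul_one_add {R : Type*} [CommRing R] (x y q p : R) :
    treeRelation x y q (x * (1 + y + y * q * p)) =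
      -(x ^ 5 * y ^ 3 * q) * (evalNum y q p - x * evalDen y q p) := by
  rw [treeRelation, evalNum, evalDen]
  ring

theorem treeRelation_treeGF : treeRelation x y q treeGF = 0 := by
  rw [treeGF_eq, treeRelation_mul_one_add, evalNum_invC, sub_self, mul_zero]

/-- The power series `x G_forest`. -/
noncomputable def forestArg : CoeffRing⟦X⟧ :=
  xDivOneAddTreeGF.substInvOfIsUnit isUnit_coeff_one_xDivOneAddTreeGF

theorem constantCoeff_forestArg : PowerSeries.constantCoeff forestArg = 0 :=
  PowerSeries.constantCoeff_substInvOfIsUnit _ _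

theorem x_mul_forestGF : x * forestGF = forestArg := by
  rw [x, forestGF]
  ext1 n
  rcases n with _ | n
  · simpa using constantCoeff_forestArg.symm
  · simp [PowerSeries.coeff_succ_X_mul, forestArg]

theorem constantCoeff_xDivOneAddTreeGF : PowerSeries.constantCoeff xDivOneAddTreeGF = 0 := by
  simp [xDivOneAddTreeGF, x]

theorem substHom_forestArg_xDivOneAddTreeGF :
    substHom forestArg constantCoeff_forestArg xDivOneAddTreeGF = x :=
  substHom_substInvOfIsUnit_right constantCoeff_xDivOneAddTreeGF _

theorem substHom_xDivOneAddTreeGF_forestArg :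
    substHom xDivOneAddTreeGF constantCoeff_xDivOneAddTreeGF forestArg = x :=
  substHom_substInvOfIsUnit_left constantCoeff_xDivOneAddTreeGF _

theorem x_ne_zero : x ≠ 0 := PowerSeries.X_ne_zero

/-- Substitute Z = xF into (x/(1 + G_tree))(1 + G_tree) = x: the first factor becomes x and the
right side becomes xF, so x cancels. -/
theorem forestGF_eq :
    forestGF = 1 + substHom forestArg constantCoeff_forestArg treeGF := by
  have h := congrArg (substHom forestArg constantCoeff_forestArg) xDivOneAddTreeGF_mul
  rw [map_mul, substHom_forestArg_xDivOneAddTreeGF, substHom_x] at h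
  nth_rw 2 [← x_mul_forestGF] at h
  simpa using (mul_left_cancel₀ x_ne_zero h).symm

/-- The inverse of `C` at `x G_forest`. -/
noncomputable def invCForest : CoeffRing⟦X⟧ := substHom forestArg constantCoeff_forestArg invC

theorem constantCoeff_invCForest : PowerSeries.constantCoeff invCForest = 0 :=
  (constantCoeff_substHom _ _).trans constantCoeff_invC

theorem evalNum_invCForest :
    evalNum y q invCForest = x * forestGF * evalDen y q invCForest := by
  have h := congrArg (substHom forestArg constantCoeff_forestArg) evalNum_invC
  rw [map_mul, substHom_x, map_evalNum, map_evalDen, substHom_y, substHom_q] at h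
  rw [invCForest, h, x_mul_forestGF]

theorem forestGF_mul : forestGF * (1 - x * (1 + y + y * q * invCForest)) = 1 := by
  have h := forestGF_eq
  rw [treeGF_eq] at h
  simp only [map_mul, map_add, map_one, substHom_x, substHom_y, substHom_q] at h
  change forestGF = 1 + forestArg * (1 + y + y * q * invCForest) at h
  rw [← x_mul_forestGF] at h
  linear_combination h

/-- With i = 1/F, which is affine in p, the second hypothesis reads iN(p) = xD(p). The reversal of
the sextic, evaluated at i, is a multiple of iN(p) - xD(p); multiplying by F⁶ returns to F. -/
theorem forestRelation_eq_zero {R : Type*} [CommRing R] (x y q p F : R)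
    (hF : F * (1 - x * (1 + y + y * q * p)) = 1)
    (hp : evalNum y q p = x * F * evalDen y q p) : forestRelation x y q F = 0 := by
  set i := 1 - x * (1 + y + y * q * p) with hi
  have h1 : i * evalNum y q p - x * evalDen y q p = 0 := by
    rw [hp]
    linear_combination x * evalDen y q p * hF
  obtain ⟨a₆, a₅, a₄, a₃, a₂, a₁, a₀, ha, hi'⟩ : ∃ a₆ a₅ a₄ a₃ a₂ a₁ a₀ : R,
      forestRelation x y q F =
        a₆ * F ^ 6 + a₅ * F ^ 5 + a₄ * F ^ 4 + a₃ * F ^ 3 + a₂ * F ^ 2 - a₁ * F - a₀ ∧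
      a₆ + a₅ * i + a₄ * i ^ 2 + a₃ * i ^ 3 + a₂ * i ^ 4 - a₁ * i ^ 5 - a₀ * i ^ 6 =
        -(x ^ 5 * y ^ 3 * q) * (i * evalNum y q p - x * evalDen y q p) := by
    -- The coefficients are found by unification with the unfolded sextic, which explains the minus
    -- signs before a₁ and a₀.
    refine ⟨_, _, _, _, _, _, _, rfl, ?_⟩
    rw [hi, evalNum, evalDen]
    ring
  rw [h1, mul_zero] at hi'
  have hpow (k : ℕ) : F ^ k * i ^ k = 1 := by rw [← mul_pow, hF, one_pow]
  rw [ha]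
  linear_combination F ^ 6 * hi' - a₅ * F ^ 5 * hpow 1 - a₄ * F ^ 4 * hpow 2 -
    a₃ * F ^ 3 * hpow 3 - a₂ * F ^ 2 * hpow 4 + a₁ * F * hpow 5 + a₀ * hpow 6

theorem forestRelation_forestGF : forestRelation x y q forestGF = 0 :=
  forestRelation_eq_zero x y q invCForest forestGF forestGF_mul evalNum_invCForest

end MomAmp

namespace MomAmp

/-! ### Lagrange inversion -/

section Lagrange

variable {R : Type*} [CommRing R]

/-- Since φ = x/f, this coefficient is the residue of f'/f^(j+1): the residue of a logarithmic
derivative for j = 0, and that of an exact derivative for j > 0. The proof avoids Laurent series by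
writing φ^(j+1) f' = φ^j - xφ^(j-1)φ' and recognizing the derivative of φ^j. -/
theorem coeff_pow_mul_derivative_of_mul_eq_X [IsDomain R] [CharZero R] {φ f : R⟦X⟧}
    (h : f * φ = PowerSeries.X) (hf : PowerSeries.constantCoeff f = 0) (j : ℕ) :
    PowerSeries.coeff j (φ ^ (j + 1) * PowerSeries.derivative R f) = if j = 0 then 1 else 0 := by
  have hd : PowerSeries.derivative R f * φ + f * PowerSeries.derivative R φ = 1 := by
    have := congrArg (PowerSeries.derivative R) h
    rw [Derivation.leibniz, PowerSeries.derivative_X, smul_eq_mul, smul_eq_mul] at this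
    linear_combination this
  rcases j with _ | j
  · rw [if_pos rfl, zero_add, pow_one, mul_comm φ, eq_sub_of_add_eq hd]
    simp [hf]
  · rw [if_neg j.succ_ne_zero]
    have h1 : φ ^ (j + 1 + 1) * PowerSeries.derivative R f =
        φ ^ (j + 1) - PowerSeries.X * (φ ^ j * PowerSeries.derivative R φ) := by
      rw [← h]
      linear_combination φ ^ (j + 1) * hd
    have h2 : PowerSeries.derivative R (φ ^ (j + 1)) =
        (j + 1) * (φ ^ j * PowerSeries.derivative R φ) := by
      rw [Derivation.leibniz_pow]
      simp
    have h3 : ((j : R) + 1) * PowerSeries.coeff j (φ ^ j * PowerSeries.derivative R φ) =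
        PowerSeries.coeff (j + 1) (φ ^ (j + 1)) * (j + 1) := by
      rw [← PowerSeries.coeff_derivative, h2]
      have : ((j : R⟦X⟧) + 1) = PowerSeries.C ((j : R) + 1) := by simp
      rw [this, PowerSeries.coeff_C_mul]
    have h4 : ((j : R) + 1) ≠ 0 := by exact_mod_cast j.succ_ne_zero
    rw [h1, map_sub, PowerSeries.coeff_succ_X_mul]
    apply mul_left_cancel₀ h4
    rw [mul_sub, h3]
    ring

theorem exists_eq_sum_add_X_pow_mul (g : R⟦X⟧) (m : ℕ) : ∃ e : R⟦X⟧,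
    g = ∑ k ∈ Finset.range m, PowerSeries.C (PowerSeries.coeff k g) * PowerSeries.X ^ k +
      PowerSeries.X ^ m * e := by
  have hdvd : (PowerSeries.X ^ m : R⟦X⟧) ∣ g - ∑ k ∈ Finset.range m,
      PowerSeries.C (PowerSeries.coeff k g) * PowerSeries.X ^ k := by
    rw [PowerSeries.X_pow_dvd_iff]
    intro l hl
    rw [map_sub, map_sum, sub_eq_zero, Finset.sum_eq_single l]
    · simp
    · intro b _ hb
      rw [PowerSeries.coeff_C_mul, PowerSeries.coeff_X_pow, if_neg hb.symm, mul_zero]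
    · intro hl'
      exact absurd (Finset.mem_range.2 hl) hl'
  obtain ⟨e, he⟩ := hdvd
  exact ⟨e, by rw [← he]; ring⟩

/-- **Lagrange inversion**: the coefficients of the compositional inverse of `x / φ`. -/
theorem succ_mul_coeff_of_substHom_eq_X [IsDomain R] [CharZero R] {φ f z : R⟦X⟧}
    (h : f * φ = PowerSeries.X)
    (hf : PowerSeries.constantCoeff f = 0) (hz : substHom f hf z = PowerSeries.X) (n : ℕ) :
    ((n : R) + 1) * PowerSeries.coeff (n + 1) z = PowerSeries.coeff n (φ ^ (n + 1)) := by
  have hchain : substHom f hf (PowerSeries.derivative R z) * PowerSeries.derivative R f = 1 := by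
    have := congrArg (PowerSeries.derivative R) hz
    rwa [substHom_apply, PowerSeries.derivative_subst
      (PowerSeries.HasSubst.of_constantCoeff_zero' hf), PowerSeries.derivative_X,
      ← substHom_apply hf] at this
  obtain ⟨e, he⟩ := exists_eq_sum_add_X_pow_mul (PowerSeries.derivative R z) (n + 1)
  have hpow (k : ℕ) : f ^ k * φ ^ k = PowerSeries.X ^ k := by rw [← mul_pow, h]
  -- Insert 1 = z'(f)f' and expand z' to order n. Since f^k φ^k = x^k, the k-th term becomes x^k
  -- φ^(n-k+1) f', whose n-th coefficient is the residue above and vanishes unless k = n.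
  have hmain : φ ^ (n + 1) = ∑ k ∈ Finset.range (n + 1),
      PowerSeries.C (PowerSeries.coeff k (PowerSeries.derivative R z)) *
        (PowerSeries.X ^ k * (φ ^ (n - k + 1) * PowerSeries.derivative R f)) +
      PowerSeries.X ^ (n + 1) * (substHom f hf e * PowerSeries.derivative R f) := by
    conv_lhs => rw [← mul_one (φ ^ (n + 1)), ← hchain, he]
    rw [map_add, map_sum, add_mul, mul_add, Finset.sum_mul, Finset.mul_sum]
    congr 1
    · refine Finset.sum_congr rfl fun k hk => ?_
      have hk' : n + 1 = k + (n - k + 1) := by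
        have := Finset.mem_range.1 hk
        omega
      rw [map_mul, map_pow, substHom_C, substHom_X, ← hpow k]
      conv_lhs => rw [hk', pow_add]
      ring
    · rw [map_mul, map_pow, substHom_X, ← hpow]
      ring
  rw [hmain, map_add, map_sum, PowerSeries.coeff_X_pow_mul', if_neg (by omega), add_zero,
    Finset.sum_eq_single n]
  · rw [PowerSeries.coeff_C_mul, PowerSeries.coeff_X_pow_mul', if_pos le_rfl, Nat.sub_self,
      coeff_pow_mul_derivative_of_mul_eq_X h hf, if_pos rfl, PowerSeries.coeff_derivative]
    ring
  · intro k hk hkn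
    have := Finset.mem_range.1 hk
    rw [PowerSeries.coeff_C_mul, PowerSeries.coeff_X_pow_mul', if_pos (by omega),
      coeff_pow_mul_derivative_of_mul_eq_X h hf, if_neg (by omega), mul_zero]
  · intro hn
    exact absurd (Finset.mem_range.2 n.lt_succ_self) hn

end Lagrange

theorem coeff_forestGF (n : ℕ) : PowerSeries.coeff n forestGF =
    (1 / ((n : ℚ) + 1)) • PowerSeries.coeff n ((1 + treeGF) ^ (n + 1)) := by
  have h := succ_mul_coeff_of_substHom_eq_X xDivOneAddTreeGF_mul
    constantCoeff_xDivOneAddTreeGF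
    substHom_xDivOneAddTreeGF_forestArg n
  have hn : ((n : ℚ) + 1) ≠ 0 := by positivity
  have h1 : PowerSeries.coeff n forestGF = PowerSeries.coeff (n + 1) forestArg := by
    rw [← x_mul_forestGF, x, PowerSeries.coeff_succ_X_mul]
  rw [← h, ← h1]
  have h2 : ((n : CoeffRing) + 1) * PowerSeries.coeff n forestGF =
      ((n : ℚ) + 1) • PowerSeries.coeff n forestGF := by
    rw [add_smul, one_smul, add_mul, one_mul, Nat.cast_smul_eq_nsmul, nsmul_eq_mul]
  rw [h2, smul_smul, one_div, inv_mul_cancel₀ hn, one_smul]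

/-! ### Specializations -/

section Specialization

/-- Specialization of the variable `q` of a power series. -/
noncomputable def specialize (c : Polynomial ℚ) : CoeffRing⟦X⟧ →+* (Polynomial ℚ)⟦X⟧ :=
  PowerSeries.map (Polynomial.evalRingHom c)

variable (c : Polynomial ℚ)

@[simp]
theorem specialize_x : specialize c x = PowerSeries.X := PowerSeries.map_X _

@[simp]
theorem specialize_y : specialize c y = PowerSeries.C Polynomial.X := by
  simp [specialize, y]

@[simp]
theorem specialize_q : specialize c q = PowerSeries.C c := by
  simp [specialize, q]

theorem specialize_forestGF_mul : specialize c forestGF * (1 - PowerSeries.X *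
    (1 + PowerSeries.C Polynomial.X + PowerSeries.C Polynomial.X * PowerSeries.C c *
      specialize c invCForest)) = 1 := by
  have h := congrArg (specialize c) forestGF_mul
  simpa only [map_mul, map_add, map_sub, map_one, specialize_x, specialize_y, specialize_q] using h

theorem coeff_eq_pow_of_mul_eq_one {R : Type*} [CommRing R] {F : R⟦X⟧} {c : R}
    (h : F * (1 - PowerSeries.X * PowerSeries.C c) = 1) (n : ℕ) :
    PowerSeries.coeff n F = c ^ n := by
  have h' : F = 1 + PowerSeries.X * (PowerSeries.C c * F) := by linear_combination h
  induction n with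
  | zero =>
    rw [h']
    simp
  | succ n ih =>
    rw [h', map_add, PowerSeries.coeff_succ_X_mul, PowerSeries.coeff_C_mul, ih,
      PowerSeries.coeff_one, if_neg n.succ_ne_zero]
    ring

theorem eval_zero_coeff_forestGF (n : ℕ) :
    (PowerSeries.coeff n forestGF).eval 0 = (1 + Polynomial.X) ^ n := by
  have h := specialize_forestGF_mul 0
  rw [map_zero, mul_zero, zero_mul, add_zero] at h
  have h1 := coeff_eq_pow_of_mul_eq_one (c := 1 + Polynomial.X) (F := specialize 0 forestGF)
    (by rw [map_add, map_one]; exact h) n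
  rwa [specialize, PowerSeries.coeff_map] at h1

theorem coeffXYQ_forestGF_zero (n k : ℕ) : coeffXYQ forestGF n k 0 = n.choose k := by
  rw [coeffXYQ, Polynomial.coeff_zero_eq_eval_zero, eval_zero_coeff_forestGF,
    Polynomial.coeff_one_add_X_pow]

/-- At q = -1 the numerator of C factors as p(1 - p)(1 - py) and cancels against half of the
denominator. The two equations for p and F then force p = x, so that F = 1/((1 - x)(1 - xy)). -/
theorem eval_neg_one_coeff_forestGF (n : ℕ) :
    (PowerSeries.coeff n forestGF).eval (-1) = ∑ k ∈ Finset.range (n + 1), Polynomial.X ^ k := by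
  have h := specialize_forestGF_mul (-1)
  have hp := congrArg (specialize (-1)) evalNum_invCForest
  rw [map_mul, map_mul, map_evalNum, map_evalDen, evalNum, evalDen] at hp
  simp only [specialize_x, specialize_y, specialize_q] at hp
  have hp0 : PowerSeries.constantCoeff (specialize (-1) invCForest) = 0 := by
    rw [specialize, ← PowerSeries.coeff_zero_eq_constantCoeff_apply, PowerSeries.coeff_map,
      PowerSeries.coeff_zero_eq_constantCoeff_apply, constantCoeff_invCForest, map_zero]
  set F := specialize (-1) forestGF with hF
  set p := specialize (-1) invCForest
  set Y : (Polynomial ℚ)⟦X⟧ := PowerSeries.C Polynomial.X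
  have hc : (PowerSeries.C (-1 : Polynomial ℚ)) = -1 := by rw [map_neg, map_one]
  rw [hc] at hp h
  have ha : (1 - p) * (1 - p * Y) ≠ 0 := by
    intro h0
    have := congrArg PowerSeries.constantCoeff h0
    simp [hp0] at this
  have h1 : p = PowerSeries.X * F * ((1 - p) * (1 - p * Y)) := by
    apply mul_left_cancel₀ ha
    linear_combination hp
  have h2 : ((1 - p) * (1 - p * Y)) * F = 1 := by
    linear_combination ((1 - p) * (1 - p * Y)) * h - (1 + Y - Y * p) * h1
  have h3 : p = PowerSeries.X := by
    linear_combination h1 + PowerSeries.X * h2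
  rw [h3] at h2
  have hcoeff (n : ℕ) : PowerSeries.coeff n (F * (1 - PowerSeries.X)) = Polynomial.X ^ n := by
    apply coeff_eq_pow_of_mul_eq_one
    linear_combination h2
  have h4 : PowerSeries.coeff n F = ∑ k ∈ Finset.range (n + 1), Polynomial.X ^ k := by
    have h5 : F = F * (1 - PowerSeries.X) + PowerSeries.X * F := by ring
    induction n with
    | zero =>
      rw [h5, map_add, hcoeff]
      simp
    | succ n ih =>
      rw [h5, map_add, hcoeff, PowerSeries.coeff_succ_X_mul, ih, Finset.sum_range_succ _ (n + 1),
        add_comm]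
  rwa [hF, specialize, PowerSeries.coeff_map] at h4

theorem coeff_eval_neg_one_coeff_forestGF {n k : ℕ} (hk : k ≤ n) :
    ((PowerSeries.coeff n forestGF).eval (-1)).coeff k = 1 := by
  rw [eval_neg_one_coeff_forestGF, Polynomial.finsetSum_coeff, Finset.sum_eq_single k]
  · simp
  · intro b _ hb
    rw [Polynomial.coeff_X_pow, if_neg hb.symm]
  · intro h
    exact absurd (Finset.mem_range.2 (Nat.lt_succ_of_le hk)) h

end Specialization

end MomAmp

namespace MomAmp

/-! ### Algebraic degree -/

section Degree

open Polynomial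

variable {R : Type*} [CommRing R]

/-- After dividing E by the highest power of its variable, its value at s has the nonzero constant
coefficient E(0). In other words, s is transcendental over R. -/
theorem eval₂_powerSeries_ne_zero [IsDomain R] {s : R⟦X⟧} (hs : s ≠ 0) (hs0 : PowerSeries.constantCoeff s = 0)
    {E : R[X]} (hE : E ≠ 0) : E.eval₂ PowerSeries.C s ≠ 0 := by
  intro h
  obtain ⟨E', hE', h0⟩ := Polynomial.exists_eq_pow_rootMultiplicity_mul_and_not_dvd E hE 0
  rw [hE', eval₂_mul, eval₂_pow, map_zero, sub_zero, eval₂_X] at h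
  have h1 := (mul_eq_zero.1 h).resolve_left (pow_ne_zero _ hs)
  apply h0
  rw [map_zero, sub_zero, X_dvd_iff]
  have h2 := congrArg PowerSeries.constantCoeff h1
  rw [hom_eval₂, hs0, map_zero] at h2
  have h3 : (PowerSeries.constantCoeff (R := R)).comp PowerSeries.C = RingHom.id R := by
    ext
    simp
  rw [h3] at h2
  rw [coeff_zero_eq_eval_zero]
  exact h2

/-- Coprimality is available only over the fraction field, so the divisibility is moved there;
degrees survive because the coefficient map is injective. -/
theorem dvd_of_dvd_mul_pow {K : Type*} [Field K] [Algebra R K] [IsFractionRing R K]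
    {N D β : R[X]} {e : ℕ} (hcop : IsCoprime (N.map (algebraMap R K)) (D.map (algebraMap R K)))
    (hβ : β ≠ 0) (h : N ∣ β * D ^ e) : N.natDegree ≤ β.natDegree := by
  have hinj : Function.Injective (algebraMap R K) := IsFractionRing.injective R K
  have h1 := Polynomial.map_dvd (algebraMap R K) h
  rw [Polynomial.map_mul, Polynomial.map_pow] at h1
  have h2 := Polynomial.natDegree_le_of_dvd (hcop.pow_right.dvd_of_dvd_mul_right h1)
    ((Polynomial.map_ne_zero_iff hinj).2 hβ)
  rwa [natDegree_map_eq_of_injective hinj, natDegree_map_eq_of_injective hinj] at h2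

/-- If `N(s) = x D(s)` with `N`, `D` coprime, then the degree of `s` over the field of rational
functions in `x` is at least that of `N` and of `D`. -/
theorem natDegree_le_of_eval₂_eq_zero [IsDomain R] (K : Type*) [Field K] [Algebra R K] [IsFractionRing R K]
    {N D : R[X]} (hcop : IsCoprime (N.map (algebraMap R K)) (D.map (algebraMap R K)))
    {s : R⟦X⟧} (hs : s ≠ 0) (hs0 : PowerSeries.constantCoeff s = 0)
    (h : N.eval₂ PowerSeries.C s = PowerSeries.X * D.eval₂ PowerSeries.C s)
    {B : R[X][X]} (hB : B ≠ 0) (h0 : B.eval₂ coeToPowerSeries.ringHom s = 0) :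
    N.natDegree ≤ B.natDegree ∧ D.natDegree ≤ B.natDegree := by
  classical
  let m := B.natDegree
  -- Exchange the roles of the variables: e bounds the degree of B in x, and β j is the coefficient
  -- of x^j, a polynomial of degree at most m in the unknown.
  let e := (Finset.range (m + 1)).sup fun i => (B.coeff i).natDegree
  let β : ℕ → R[X] := fun j => ∑ i ∈ Finset.range (m + 1), C ((B.coeff i).coeff j) * X ^ i
  have hβcoeff (i j : ℕ) : (β j).coeff i = (B.coeff i).coeff j := by
    simp only [β, finsetSum_coeff, coeff_C_mul_X_pow]
    rw [Finset.sum_ite_eq]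
    split_ifs with hi
    · rfl
    · rw [B.coeff_eq_zero_of_natDegree_lt (by simpa [m] using hi), coeff_zero]
  have hβdeg (j : ℕ) : (β j).natDegree ≤ m := by
    rw [natDegree_le_iff_coeff_eq_zero]
    intro i hi
    rw [hβcoeff, B.coeff_eq_zero_of_natDegree_lt hi, coeff_zero]
  have hβe (j : ℕ) (hj : e < j) : β j = 0 := by
    ext i
    rw [hβcoeff, coeff_zero]
    by_cases hi : i < m + 1
    · exact coeff_eq_zero_of_natDegree_lt (lt_of_le_of_lt
        (Finset.le_sup (f := fun i => (B.coeff i).natDegree) (Finset.mem_range.2 hi)) hj)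
    · rw [B.coeff_eq_zero_of_natDegree_lt (by omega), coeff_zero]
  have hne : ∃ j, β j ≠ 0 := by
    by_contra! hall
    apply hB
    ext i j
    rw [← hβcoeff, hall j]
    simp
  have hsum : ∑ j ∈ Finset.range (e + 1),
      (β j).eval₂ PowerSeries.C s * PowerSeries.X ^ j = 0 := by
    rw [← h0, eval₂_eq_sum_range]
    simp only [β, eval₂_finsetSum, eval₂_mul, eval₂_C, eval₂_pow, eval₂_X, Finset.sum_mul]
    rw [Finset.sum_comm]
    refine Finset.sum_congr rfl fun i hi => ?_
    have : coeToPowerSeries.ringHom (B.coeff i) = ∑ j ∈ Finset.range (e + 1),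
        (PowerSeries.C ((B.coeff i).coeff j) * PowerSeries.X ^ j : R⟦X⟧) := by
      conv_lhs => rw [(B.coeff i).as_sum_range_C_mul_X_pow' (n := e + 1)
        (Nat.lt_succ_of_le (Finset.le_sup (f := fun i => (B.coeff i).natDegree) hi))]
      simp [coeToPowerSeries.ringHom_apply]
    rw [this, Finset.sum_mul]
    refine Finset.sum_congr rfl fun j _ => ?_
    ring
  -- Substituting x = N(s)/D(s) and multiplying by D(s)^e gives this relation at s; by transcendence
  -- of s it holds identically.
  have hE : ∑ j ∈ Finset.range (e + 1), β j * N ^ j * D ^ (e - j) = 0 := by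
    by_contra hE
    apply eval₂_powerSeries_ne_zero hs hs0 hE
    rw [eval₂_finsetSum]
    calc _ = ∑ j ∈ Finset.range (e + 1), (β j).eval₂ PowerSeries.C s * PowerSeries.X ^ j *
          (D.eval₂ PowerSeries.C s) ^ e := by
          refine Finset.sum_congr rfl fun j hj => ?_
          have hj' : e = j + (e - j) := by
            have := Finset.mem_range.1 hj
            omega
          rw [eval₂_mul, eval₂_mul, eval₂_pow, eval₂_pow, h]
          conv_rhs => rw [hj', pow_add]
          ring
      _ = 0 := by rw [← Finset.sum_mul, hsum, zero_mul]
  constructor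
  · by_cases hN : N = 0
    · simp [hN]
    -- For the least index with β l ≠ 0 all other terms are divisible by N^(l+1), so N divides β l
    -- D^(e-l), and hence β l over the fraction field.
    let l := Nat.find hne
    have hl : β l ≠ 0 := Nat.find_spec hne
    have hle : l ≤ e := by
      by_contra! hlt
      exact hl (hβe l hlt)
    have hdvd : N ∣ β l * D ^ (e - l) := by
      have h1 : N ^ (l + 1) ∣ β l * N ^ l * D ^ (e - l) := by
        rw [← Finset.add_sum_erase _ _ (Finset.mem_range.2 (Nat.lt_succ_of_le hle))] at hE
        rw [eq_neg_of_add_eq_zero_left hE, dvd_neg]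
        refine Finset.dvd_sum fun j hj => ?_
        rcases lt_or_ge j l with hjl | hjl
        · have : β j = 0 := not_not.1 (Nat.find_min hne hjl)
          simp [this]
        · have hj' : l + 1 ≤ j := lt_of_le_of_ne hjl (Finset.ne_of_mem_erase hj).symm
          exact ((pow_dvd_pow N hj').mul_left _).mul_right _
      rw [pow_succ, mul_right_comm, mul_comm (N ^ l)] at h1
      exact (mul_dvd_mul_iff_right (pow_ne_zero l hN)).1 h1
    exact (dvd_of_dvd_mul_pow hcop hl hdvd).trans (hβdeg l)
  · by_cases hD : D = 0
    · simp [hD]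
    -- Symmetrically, for the greatest index all other terms are divisible by D^(e-l+1).
    let l := Nat.findGreatest (fun j => β j ≠ 0) e
    obtain ⟨j₀, hj₀⟩ := hne
    have hj₀e : j₀ ≤ e := by
      by_contra! hlt
      exact hj₀ (hβe j₀ hlt)
    have hl : β l ≠ 0 := Nat.findGreatest_spec (P := fun j => β j ≠ 0) hj₀e hj₀
    have hle : l ≤ e := Nat.findGreatest_le e
    have hdvd : D ∣ β l * N ^ l := by
      have h1 : D ^ (e - l + 1) ∣ β l * N ^ l * D ^ (e - l) := by
        rw [← Finset.add_sum_erase _ _ (Finset.mem_range.2 (Nat.lt_succ_of_le hle))] at hE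
        rw [eq_neg_of_add_eq_zero_left hE, dvd_neg]
        refine Finset.dvd_sum fun j hj => ?_
        have hje := Finset.mem_range.1 (Finset.mem_of_mem_erase hj)
        rcases lt_or_ge l j with hjl | hjl
        · have : β j = 0 := not_not.1 (Nat.findGreatest_is_greatest hjl (by omega))
          simp [this]
        · have hj' : j < l := lt_of_le_of_ne hjl (Finset.ne_of_mem_erase hj)
          exact (pow_dvd_pow D (by omega)).mul_left _
      rw [pow_succ, mul_comm (D ^ _)] at h1
      exact (mul_dvd_mul_iff_right (pow_ne_zero _ hD)).1 h1
    exact (dvd_of_dvd_mul_pow hcop.symm hl hdvd).trans (hβdeg l)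

theorem isCoprime_one_add_C_mul_X {K : Type*} [Field K] {a : K} (ha : a ≠ 0) {N : K[X]}
    (h : N.eval (-a⁻¹) ≠ 0) : IsCoprime N (1 + C a * X) := by
  have h1 : (1 + C a * X : K[X]) = C a * (X - C (-a⁻¹)) := by
    rw [mul_sub, ← C_mul, mul_neg, mul_inv_cancel₀ ha, C_neg, C_1]
    ring
  rw [h1]
  refine IsCoprime.mul_right ?_ ?_
  · exact (isCoprime_one_right (x := N)).of_isCoprime_of_dvd_right
      (isUnit_iff_dvd_one.1 (isUnit_C.2 (isUnit_iff_ne_zero.2 ha)))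
  · rw [isCoprime_comm, (irreducible_X_sub_C _).coprime_iff_not_dvd, dvd_iff_isRoot]
    exact h

/-- It suffices that N does not vanish at the four roots -1/q, -1/(yq), 1/q², 1/(yq²) of D. At each
of them N splits into the factors that the hypotheses declare nonzero. -/
theorem isCoprime_evalNum_evalDen {K : Type*} [Field K] {y q : K} (hy : y ≠ 0) (hq : q ≠ 0)
    (hq1 : q + 1 ≠ 0) (hy1 : y - 1 ≠ 0) (hyq : y + q ≠ 0) (hyq1 : 1 + y * q ≠ 0) :
    IsCoprime (evalNum (C y) (C q) (X : K[X])) (evalDen (C y) (C q) X) := by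
  have heval (r : K) : (evalNum (C y) (C q) (X : K[X])).eval r = evalNum y q r := by
    rw [← coe_evalRingHom, map_evalNum]
    simp
  have h1 : evalDen (C y) (C q) (X : K[X]) = (1 + C q * X) * (1 + C (y * q) * X) *
      (1 + C (-q ^ 2) * X) * (1 + C (-(y * q ^ 2)) * X) := by
    rw [evalDen]
    simp only [C_neg, C_mul, C_pow]
    ring
  rw [h1]
  refine IsCoprime.mul_right (IsCoprime.mul_right (IsCoprime.mul_right ?_ ?_) ?_) ?_
  · refine isCoprime_one_add_C_mul_X hq ?_
    rw [heval]
    have : evalNum y q (-q⁻¹) = (y - 1) * (q + 1) * (1 + y * q) / q := by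
      rw [evalNum]
      field_simp
      ring
    rw [this]
    exact div_ne_zero (mul_ne_zero (mul_ne_zero hy1 hq1) hyq1) hq
  · refine isCoprime_one_add_C_mul_X (mul_ne_zero hy hq) ?_
    rw [heval]
    have : evalNum y q (-(y * q)⁻¹) = -((y - 1) * (q + 1) * (y + q)) / (y ^ 3 * q) := by
      rw [evalNum]
      field_simp
      ring
    rw [this]
    exact div_ne_zero (neg_ne_zero.2 (mul_ne_zero (mul_ne_zero hy1 hq1) hyq))
      (mul_ne_zero (pow_ne_zero 3 hy) hq)
  · refine isCoprime_one_add_C_mul_X (neg_ne_zero.2 (pow_ne_zero 2 hq)) ?_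
    rw [heval]
    have : evalNum y q (-(-q ^ 2)⁻¹) = -(y * (q + 1) * (y + q)) / q ^ 5 := by
      rw [evalNum]
      field_simp
      ring
    rw [this]
    exact div_ne_zero (neg_ne_zero.2 (mul_ne_zero (mul_ne_zero hy hq1) hyq)) (pow_ne_zero 5 hq)
  · refine isCoprime_one_add_C_mul_X (neg_ne_zero.2 (mul_ne_zero hy (pow_ne_zero 2 hq))) ?_
    rw [heval]
    have : evalNum y q (-(-(y * q ^ 2))⁻¹) = -((q + 1) * (1 + y * q)) / (y ^ 3 * q ^ 5) := by
      rw [evalNum]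
      field_simp
      ring
    rw [this]
    exact div_ne_zero (neg_ne_zero.2 (mul_ne_zero hq1 hyq1))
      (mul_ne_zero (pow_ne_zero 3 hy) (pow_ne_zero 5 hq))

theorem eval₂_evalNum (a b : R) (s : R⟦X⟧) :
    (evalNum (C a) (C b) X).eval₂ PowerSeries.C s =
      evalNum (PowerSeries.C a) (PowerSeries.C b) s := by
  rw [← coe_eval₂RingHom, map_evalNum]
  simp

theorem eval₂_evalDen (a b : R) (s : R⟦X⟧) :
    (evalDen (C a) (C b) X).eval₂ PowerSeries.C s =
      evalDen (PowerSeries.C a) (PowerSeries.C b) s := by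
  rw [← coe_eval₂RingHom, map_evalDen]
  simp

theorem map_evalNum_C {S : Type*} [CommRing S] (f : R →+* S) (a b : R) :
    (evalNum (C a) (C b) (X : R[X])).map f = evalNum (C (f a)) (C (f b)) X := by
  rw [← coe_mapRingHom, map_evalNum]
  simp

theorem map_evalDen_C {S : Type*} [CommRing S] (f : R →+* S) (a b : R) :
    (evalDen (C a) (C b) (X : R[X])).map f = evalDen (C (f a)) (C (f b)) X := by
  rw [← coe_mapRingHom, map_evalDen]
  simp

theorem map_treeRelation {S : Type*} [CommRing S] (f : R →+* S) (a b c d : R) :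
    f (treeRelation a b c d) = treeRelation (f a) (f b) (f c) (f d) := by
  simp only [treeRelation, map_add, map_sub, map_mul, map_pow, map_neg, map_ofNat, map_one]

theorem map_forestRelation {S : Type*} [CommRing S] (f : R →+* S) (a b c d : R) :
    f (forestRelation a b c d) = forestRelation (f a) (f b) (f c) (f d) := by
  simp only [forestRelation, map_add, map_sub, map_mul, map_pow, map_neg, map_ofNat, map_one]

theorem coeff_treeRelation (x y q : R) :
    (treeRelation (C x) (C y) (C q) X : R[X]).coeff 5 = q * (q + 1) := by
  have h : (treeRelation (C x) (C y) (C q) X - C q * (C q + 1) * X ^ 5).natDegree ≤ 4 := by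
    rw [treeRelation]
    ring_nf
    compute_degree
  have h1 := coeff_eq_zero_of_natDegree_lt (lt_of_le_of_lt h (by norm_num : 4 < 5))
  have h2 : C q * (C q + 1) * X ^ 5 = C (q * (q + 1)) * X ^ 5 := by simp
  rw [coeff_sub, h2, coeff_C_mul_X_pow, if_pos rfl, sub_eq_zero] at h1
  exact h1

theorem natDegree_treeRelation_le (x y q : R) :
    (treeRelation (C x) (C y) (C q) X : R[X]).natDegree ≤ 5 := by
  rw [treeRelation]
  compute_degree

theorem coeff_forestRelation (x y q : R) :
    (forestRelation (C x) (C y) (C q) X : R[X]).coeff 6 = q * (x - 1) * x ^ 2 * y * (x * y - 1) *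
      (q * (x * y + x - 1) + x) * (q * (x * y + x - 1) + x * y) := by
  have h : (forestRelation (C x) (C y) (C q) X - C q * (C x - 1) * C x ^ 2 * C y *
      (C x * C y - 1) * (C q * (C x * C y + C x - 1) + C x) *
      (C q * (C x * C y + C x - 1) + C x * C y) * X ^ 6).natDegree ≤ 5 := by
    rw [forestRelation]
    rw [sub_right_comm _ _ (_ * X ^ 6), sub_right_comm _ _ (_ * X ^ 6)]
    simp only [add_sub_right_comm, sub_self, zero_add]
    compute_degree
  have h1 := coeff_eq_zero_of_natDegree_lt (lt_of_le_of_lt h (by norm_num : 5 < 6))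
  rw [coeff_sub, sub_eq_zero] at h1
  rw [h1, coeff_mul_X_pow' _ 6 6, if_pos le_rfl, Nat.sub_self, coeff_zero_eq_eval_zero]
  simp

theorem natDegree_forestRelation_le (x y q : R) :
    (forestRelation (C x) (C y) (C q) X : R[X]).natDegree ≤ 6 := by
  rw [forestRelation]
  compute_degree

/-- The quintic relation as a polynomial over `R[x]`. -/
theorem exists_eval₂_eq_treeRelation {a b : R} (h : b * (b + 1) ≠ 0) : ∃ P : R[X][X], P ≠ 0 ∧
    P.natDegree = 5 ∧ ∀ G : R⟦X⟧, P.eval₂ coeToPowerSeries.ringHom G =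
      treeRelation PowerSeries.X (PowerSeries.C a) (PowerSeries.C b) G := by
  have hc : (treeRelation (C X) (C (C a)) (C (C b)) X : R[X][X]).coeff 5 ≠ 0 := by
    rw [coeff_treeRelation, ← C_1, ← C_add, ← C_mul]
    exact C_ne_zero.2 h
  refine ⟨treeRelation (C X) (C (C a)) (C (C b)) X, fun h0 => hc (by rw [h0, coeff_zero]),
    le_antisymm (natDegree_treeRelation_le _ _ _) (le_natDegree_of_ne_zero hc), fun G => ?_⟩
  rw [← coe_eval₂RingHom, map_treeRelation]
  simp [coeToPowerSeries.ringHom_apply]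

/-- The sextic relation as a polynomial over `R[x]`. -/
theorem exists_eval₂_eq_forestRelation [IsDomain R] {a b : R} (ha : a ≠ 0) (hb : b ≠ 0) :
    ∃ P : R[X][X], P ≠ 0 ∧ P.natDegree = 6 ∧ ∀ G : R⟦X⟧, P.eval₂ coeToPowerSeries.ringHom G =
      forestRelation PowerSeries.X (PowerSeries.C a) (PowerSeries.C b) G := by
  -- At x = 0 the factors of the leading coefficient that involve x, apart from x² itself, take the
  -- values -1, -1, -b, -b.
  have hne {P : R[X]} (hP : P.eval 0 ≠ 0) : P ≠ 0 := fun h0 => hP (by rw [h0, eval_zero])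
  have hc : (forestRelation (C X) (C (C a)) (C (C b)) X : R[X][X]).coeff 6 ≠ 0 := by
    rw [coeff_forestRelation]
    refine mul_ne_zero (mul_ne_zero (mul_ne_zero (mul_ne_zero (mul_ne_zero (mul_ne_zero
      (C_ne_zero.2 hb) (hne ?_)) (pow_ne_zero 2 X_ne_zero)) (C_ne_zero.2 ha)) (hne ?_))
      (hne ?_)) (hne ?_) <;> simp [hb]
  refine ⟨forestRelation (C X) (C (C a)) (C (C b)) X, fun h0 => hc (by rw [h0, coeff_zero]),
    le_antisymm (natDegree_forestRelation_le _ _ _) (le_natDegree_of_ne_zero hc), fun G => ?_⟩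
  rw [← coe_eval₂RingHom, map_forestRelation]
  simp [coeToPowerSeries.ringHom_apply]

/-- The numerator of `C` as a polynomial in `x`. -/
noncomputable def polyNum : CoeffRing[X] := evalNum (C (C X)) (C X) X

/-- The denominator of `C` as a polynomial in `x`. -/
noncomputable def polyDen : CoeffRing[X] := evalDen (C (C X)) (C X) X

theorem eval₂_polyNum (s : CoeffRing⟦X⟧) : polyNum.eval₂ PowerSeries.C s = evalNum y q s :=
  eval₂_evalNum _ _ s

theorem eval₂_polyDen (s : CoeffRing⟦X⟧) : polyDen.eval₂ PowerSeries.C s = evalDen y q s :=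
  eval₂_evalDen _ _ s

theorem coeffRing_add_ne_zero : ((C X : CoeffRing) + X) ≠ 0 ∧ (X + 1 : CoeffRing) ≠ 0 ∧
    ((C X : CoeffRing) - 1) ≠ 0 ∧ (1 + C X * X : CoeffRing) ≠ 0 := by
  refine ⟨fun h => ?_, fun h => ?_, fun h => ?_, fun h => ?_⟩
  · have := congrArg (fun P => P.coeff 1) h
    simp at this
  · have := congrArg (fun P => P.coeff 1) h
    simp [coeff_one] at this
  · have := congrArg (fun P : CoeffRing => (P.coeff 0).coeff 1) h
    simp [coeff_one] at this
  · have := congrArg (fun P => P.coeff 0) h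
    simp at this

theorem isCoprime_polyNum_polyDen : IsCoprime
    (polyNum.map (algebraMap CoeffRing (FractionRing CoeffRing)))
    (polyDen.map (algebraMap CoeffRing (FractionRing CoeffRing))) := by
  set f := algebraMap CoeffRing (FractionRing CoeffRing)
  have hinj : Function.Injective f := IsFractionRing.injective _ _
  have hne {a : CoeffRing} (ha : a ≠ 0) : f a ≠ 0 := (map_ne_zero_iff f hinj).2 ha
  obtain ⟨h1, h2, h3, h4⟩ := coeffRing_add_ne_zero
  rw [polyNum, polyDen, map_evalNum_C, map_evalDen_C]
  apply isCoprime_evalNum_evalDen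
  · exact hne (C_ne_zero.2 X_ne_zero)
  · exact hne X_ne_zero
  · simpa using hne h2
  · simpa using hne h3
  · simpa using hne h1
  · simpa using hne h4

theorem coeff_polyNum : polyNum.coeff 5 ≠ 0 ∧ polyNum.natDegree ≤ 5 := by
  have h : polyNum = X - C ((1 + C X) * X ^ 2) * X ^ 2 -
      C (C X * X ^ 2 * (1 + X - X ^ 2)) * X ^ 3 - C (C X ^ 2 * X ^ 5 * (1 + X)) * X ^ 5 := by
    rw [polyNum, evalNum]
    simp only [C_mul, C_add, C_sub, C_pow, C_1]
    ring
  rw [h]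
  constructor
  · simp only [coeff_sub, coeff_C_mul_X_pow, coeff_X]
    norm_num
    rw [add_comm]
    exact coeffRing_add_ne_zero.2.1
  · compute_degree

theorem natDegree_polyDen_le : polyDen.natDegree ≤ 4 := by
  rw [polyDen, evalDen]
  compute_degree

theorem invC_ne_zero : invC ≠ 0 := by
  intro h
  have := evalNum_invC
  rw [h, evalNum, evalDen] at this
  apply x_ne_zero
  linear_combination -this

theorem invCForest_ne_zero : invCForest ≠ 0 := by
  intro h
  have h1 := evalNum_invCForest
  have h2 := forestGF_mul
  rw [h, evalNum, evalDen] at h1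
  rw [h] at h2
  have h3 : x * forestGF = 0 := by linear_combination -h1
  apply x_ne_zero
  linear_combination -x * h2 + (1 - x * (1 + y)) * h3

theorem coeToPowerSeries_X :
    (coeToPowerSeries.ringHom (X : CoeffRing[X]) : CoeffRing⟦X⟧) = x := by
  simp [coeToPowerSeries.ringHom_apply, x]

theorem coeToPowerSeries_C (c : CoeffRing) :
    (coeToPowerSeries.ringHom (C c) : CoeffRing⟦X⟧) = PowerSeries.C c := by
  simp [coeToPowerSeries.ringHom_apply]

/-- Composition of a polynomial over `ℚ[y, q][x]` with a linear polynomial. -/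
theorem comp_linear {B : CoeffRing[X][X]} (hB : B ≠ 0) {a b : CoeffRing[X]} (ha : a ≠ 0)
    (s : CoeffRing⟦X⟧) (h : B.eval₂ coeToPowerSeries.ringHom
      (coeToPowerSeries.ringHom a * s + coeToPowerSeries.ringHom b) = 0) :
    B.comp (C a * X + C b) ≠ 0 ∧ (B.comp (C a * X + C b)).natDegree = B.natDegree ∧
      (B.comp (C a * X + C b)).eval₂ coeToPowerSeries.ringHom s = 0 := by
  have hdeg : (C a * X + C b).natDegree = 1 := natDegree_linear ha
  refine ⟨fun h0 => ?_, ?_, ?_⟩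
  · rcases comp_eq_zero_iff.1 h0 with h1 | ⟨_, h1⟩
    · exact hB h1
    · rw [h1, natDegree_C] at hdeg
      exact zero_ne_one hdeg
  · rw [natDegree_comp, hdeg, mul_one]
  · rw [eval₂_comp]
    simpa using h

/-- Minimality: G_tree is affine in P with nonzero slope xyq, so a relation for G_tree gives one of
the same degree for P. There x = N(P)/D(P) in lowest terms, with N of degree 5. -/
theorem isAlgebraicOfDegree_treeGF : IsAlgebraicOfDegree treeGF 5 := by
  constructor
  · obtain ⟨P, hP, hdeg, h⟩ := exists_eval₂_eq_treeRelation (a := (C X : CoeffRing)) (b := X)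
      (mul_ne_zero X_ne_zero coeffRing_add_ne_zero.2.1)
    exact ⟨P, hP, hdeg, (h treeGF).trans treeRelation_treeGF⟩
  · rintro m ⟨B, hB, rfl, h⟩
    have hlin : treeGF = coeToPowerSeries.ringHom (X * C (C X * X)) * invC +
        coeToPowerSeries.ringHom (X * (1 + C (C X))) := by
      rw [treeGF_eq]
      simp only [map_mul, map_add, map_one, coeToPowerSeries_X, coeToPowerSeries_C, y, q]
      ring
    rw [hlin] at h
    have ha : (X * C (C X * X) : CoeffRing[X]) ≠ 0 :=
      mul_ne_zero X_ne_zero (C_ne_zero.2 (mul_ne_zero (C_ne_zero.2 X_ne_zero) X_ne_zero))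
    obtain ⟨h1, h2, h3⟩ := comp_linear hB ha _ h
    have h4 := (natDegree_le_of_eval₂_eq_zero (FractionRing CoeffRing) isCoprime_polyNum_polyDen
      invC_ne_zero constantCoeff_invC (by
        rw [eval₂_polyNum, eval₂_polyDen]
        exact evalNum_invC) h1 h3).1
    rw [h2] at h4
    exact (le_natDegree_of_ne_zero coeff_polyNum.1).trans h4

/-- The denominator of `x` as a rational function of the inverse of `C` at `x G_forest`. -/
noncomputable def polyDenForest : CoeffRing[X] :=
  polyDen + (1 + C (C X) + C (C X * X) * X) * polyNum

theorem six_le_natDegree_polyDenForest : 6 ≤ polyDenForest.natDegree := by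
  apply le_natDegree_of_ne_zero
  -- The coefficient in degree 6 comes only from yqX · N, because N has degree 5 and D has degree at
  -- most 4.
  have h : polyDenForest =
      polyDen + C (1 + C X) * polyNum + C (C X * X) * (polyNum * X) := by
    rw [polyDenForest, C_add, C_1]
    ring
  rw [h, coeff_add, coeff_add, coeff_C_mul, coeff_C_mul, coeff_mul_X,
    coeff_eq_zero_of_natDegree_lt (lt_of_le_of_lt natDegree_polyDen_le (by norm_num)),
    coeff_eq_zero_of_natDegree_lt (lt_of_le_of_lt coeff_polyNum.2 (by norm_num)),
    mul_zero, add_zero, zero_add]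
  exact mul_ne_zero (mul_ne_zero (C_ne_zero.2 X_ne_zero) X_ne_zero) coeff_polyNum.1

/-- Minimality: reversing a relation for F gives one of no larger degree for 1/F, which is affine in
p. Eliminating F from the two defining equations yields x = N(p)/(D(p) + (1 + y + yqp)N(p)); this is
still in lowest terms, with denominator of degree at least 6. -/
theorem isAlgebraicOfDegree_forestGF : IsAlgebraicOfDegree forestGF 6 := by
  constructor
  · obtain ⟨P, hP, hdeg, h⟩ := exists_eval₂_eq_forestRelation (a := (C X : CoeffRing)) (b := X)
      (C_ne_zero.2 X_ne_zero) X_ne_zero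
    exact ⟨P, hP, hdeg, (h forestGF).trans forestRelation_forestGF⟩
  · rintro m ⟨B, hB, rfl, h⟩
    have hlin : 1 - x * (1 + y + y * q * invCForest) =
        coeToPowerSeries.ringHom (X * C (-(C X * X) : CoeffRing)) * invCForest +
        coeToPowerSeries.ringHom (1 + X * C (-(1 + C X) : CoeffRing)) := by
      rw [map_mul, map_add, map_mul, map_one, coeToPowerSeries_X, coeToPowerSeries_C,
        coeToPowerSeries_C]
      simp only [map_mul, map_add, map_neg, map_one, y, q]
      ring
    let _ : Invertible forestGF := ⟨1 - x * (1 + y + y * q * invCForest),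
      by rw [mul_comm, forestGF_mul], forestGF_mul⟩
    have hinv : ⅟forestGF = 1 - x * (1 + y + y * q * invCForest) := rfl
    rw [← eval₂_reverse_eq_zero_iff, hinv, hlin] at h
    have ha : (X * C (-(C X * X) : CoeffRing) : CoeffRing[X]) ≠ 0 := mul_ne_zero X_ne_zero
      (C_ne_zero.2 (neg_ne_zero.2 (mul_ne_zero (C_ne_zero.2 X_ne_zero) X_ne_zero)))
    obtain ⟨h1, h2, h3⟩ := comp_linear (mt reverse_eq_zero.1 hB) ha _ h
    have hcop : IsCoprime (polyNum.map (algebraMap CoeffRing (FractionRing CoeffRing)))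
        (polyDenForest.map (algebraMap CoeffRing (FractionRing CoeffRing))) := by
      rw [polyDenForest, Polynomial.map_add, Polynomial.map_mul]
      exact isCoprime_polyNum_polyDen.add_mul_right_right _
    have h4 := (natDegree_le_of_eval₂_eq_zero (FractionRing CoeffRing) hcop
      invCForest_ne_zero constantCoeff_invCForest (by
        rw [polyDenForest, eval₂_add, eval₂_mul, eval₂_polyNum, eval₂_polyDen]
        have h5 := evalNum_invCForest
        have h6 := forestGF_mul
        have h7 : (1 + C (C X) + C (C X * X) * X : CoeffRing[X]).eval₂ PowerSeries.C
            invCForest = 1 + y + y * q * invCForest := by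
          simp [y, q]
        rw [h7]
        change _ = x * _
        linear_combination (1 - x * (1 + y + y * q * invCForest)) * h5 +
          x * evalDen y q invCForest * h6) h1 h3).2
    rw [h2] at h4
    exact six_le_natDegree_polyDenForest.trans (h4.trans (reverse_natDegree_le B))

end Degree

end MomAmp

namespace MomAmp

/-! ### Plane trees with labelled leaves -/

/-- Plane trees with natural numbers at the leaves and helicities at the other vertices. -/
inductive Term : Type
  | leaf (i : ℕ) : Term
  | node (h : ℕ) (cs : List Term) : Term

namespace Term

theorem induction {P : Term → Prop} (hleaf : ∀ i, P (leaf i))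
    (hnode : ∀ h cs, (∀ t ∈ cs, P t) → P (node h cs)) (t : Term) : P t :=
  Term.rec (motive_1 := P) (motive_2 := fun cs => ∀ t ∈ cs, P t) hleaf
    (fun h cs ih => hnode h cs ih) (by simp)
    (fun t cs ht hcs => by simpa using ⟨ht, hcs⟩) t

/-- The labels of the leaves, from left to right. -/
def leaves : Term → List ℕ
  | leaf i => [i]
  | node _ cs => (cs.map leaves).flatten

/-- The list of all subtrees that are not leaves. -/
def nodes : Term → List Term
  | leaf _ => []
  | node h cs => node h cs :: (cs.map nodes).flatten

@[simp]
theorem leaves_leaf (i : ℕ) : leaves (leaf i) = [i] := by rw [leaves]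

theorem leaves_node (h : ℕ) (cs : List Term) : leaves (node h cs) = (cs.map leaves).flatten := by
  rw [leaves]

@[simp]
theorem nodes_leaf (i : ℕ) : nodes (leaf i) = [] := by rw [nodes]

theorem nodes_node (h : ℕ) (cs : List Term) :
    nodes (node h cs) = node h cs :: (cs.map nodes).flatten := by
  rw [nodes]

/-- A subtree whose root is white. -/
def IsWhite : Term → Prop
  | leaf _ => False
  | node h _ => h = 1

/-- A subtree whose root is black. -/
def IsBlack : Term → Prop
  | leaf _ => False
  | node h cs => h = cs.length

/-- A subtree that may be attached to a vertex of helicity `h` with `c` children. -/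
def Attachable (h c : ℕ) (t : Term) : Prop :=
  (h = 1 → ¬ t.IsWhite) ∧ (h = c → ¬ t.IsBlack)

/-- The plane trees that occur in contracted Grassmannian trees. -/
inductive Good : Term → Prop
  | leaf (i : ℕ) : Good (leaf i)
  | node (h : ℕ) (cs : List Term) (hc : 2 ≤ cs.length) (h1 : 1 ≤ h) (h2 : h ≤ cs.length)
      (hgood : ∀ t ∈ cs, Good t) (hatt : ∀ t ∈ cs, Attachable h cs.length t) : Good (node h cs)

theorem Good.leaves_ne_nil {t : Term} (ht : Good t) : t.leaves ≠ [] := by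
  induction ht with
  | leaf i => simp
  | node h cs hc _ _ _ _ ih =>
    rw [leaves_node]
    obtain ⟨t, ht⟩ := List.exists_mem_of_length_pos (by omega : 0 < cs.length)
    intro h0
    rw [List.flatten_eq_nil_iff] at h0
    exact ih t ht (h0 _ (List.mem_map_of_mem ht))

/-- The exponent of `q` contributed by a vertex of helicity `h` with `c` children. -/
def qExp (h c : ℕ) : ℕ := if h = 1 ∨ h = c then c - 1 else 2 * c - 3

/-- The weight of a vertex of helicity `h` with `c` children. -/
noncomputable def vertexWeight (h c : ℕ) : CoeffRing :=
  Polynomial.C Polynomial.X ^ (h - 1) * Polynomial.X ^ qExp h c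

/-- The weight of the root. -/
noncomputable def rootWeight : Term → CoeffRing
  | leaf _ => 1
  | node h cs => vertexWeight h cs.length

/-- The weight of a plane tree. -/
noncomputable def weight (t : Term) : CoeffRing := (t.nodes.map rootWeight).prod

@[simp]
theorem weight_leaf (i : ℕ) : weight (leaf i) = 1 := by simp [weight]

theorem weight_node (h : ℕ) (cs : List Term) :
    weight (node h cs) = vertexWeight h cs.length * (cs.map weight).prod := by
  rw [weight, nodes_node, List.map_cons, List.prod_cons, rootWeight, List.map_flatten,
    List.prod_flatten, List.map_map, List.map_map]
  rfl

noncomputable instance : DecidableEq Term := Classical.decEq _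

noncomputable instance : DecidablePred IsWhite := Classical.decPred _

noncomputable instance : DecidablePred IsBlack := Classical.decPred _

noncomputable instance (h c : ℕ) : DecidablePred (Attachable h c) := Classical.decPred _

end Term

/-! ### Enumeration of plane trees -/

open Term

section Enumeration

/-- The lists of `c` plane trees with given leaves, the trees being taken from a given family. -/
noncomputable def termLists (A : List ℕ → Finset Term) : ℕ → List ℕ → Finset (List Term)
  | 0, l => if l = [] then {[]} else ∅
  | c + 1, l => (Finset.range (l.length + 1)).biUnion fun i =>
      (A (l.take i) ×ˢ termLists A c (l.drop i)).image fun p => p.1 :: p.2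

/-- The good plane trees with given leaves, if there are at most `f` of them. -/
noncomputable def terms : ℕ → List ℕ → Finset Term
  | 0, _ => ∅
  -- The default 0 is never reached, since the list has length one.
  | f + 1, l => (if l.length = 1 then {leaf (l.headD 0)} else ∅) ∪
      (Finset.Icc 2 l.length).biUnion fun c => (Finset.Icc 1 c).biUnion fun h =>
        (termLists (fun l' => {t ∈ terms f l' | Attachable h c t}) c l).image (node h)

/-- Under `hA` the cut points of l are forced: the first tree uses exactly the prefix given by its
own leaves. -/
theorem mem_termLists {A : List ℕ → Finset Term} (hA : ∀ l, ∀ t ∈ A l, t.leaves = l) (c : ℕ)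
    (l : List ℕ) (cs : List Term) : cs ∈ termLists A c l ↔
      cs.length = c ∧ (cs.map leaves).flatten = l ∧ ∀ t ∈ cs, t ∈ A t.leaves := by
  induction c generalizing l cs with
  | zero =>
    rw [termLists]
    split_ifs with h
    · rw [Finset.mem_singleton, List.length_eq_zero_iff]
      constructor
      · rintro rfl
        simp [h]
      · exact fun h => h.1
    · simp only [Finset.notMem_empty, false_iff, List.length_eq_zero_iff]
      rintro ⟨rfl, h', _⟩
      exact h h'.symm
  | succ c ih =>
    simp only [termLists, Finset.mem_biUnion, Finset.mem_image, Finset.mem_product,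
      Finset.mem_range, Prod.exists]
    constructor
    · rintro ⟨i, hi, t, ts, ⟨ht, hts⟩, rfl⟩
      obtain ⟨h1, h2, h3⟩ := (ih _ _).1 hts
      have h4 := hA _ _ ht
      refine ⟨by simp [h1], ?_, ?_⟩
      · rw [List.map_cons, List.flatten_cons, h4, h2, List.take_append_drop]
      · intro t' ht'
        rcases List.mem_cons.1 ht' with rfl | ht'
        · rwa [h4]
        · exact h3 t' ht'
    · rintro ⟨h1, h2, h3⟩
      rcases cs with _ | ⟨t, ts⟩
      · simp at h1
      · subst h2
        refine ⟨t.leaves.length, ?_, t, ts, ⟨?_, ?_⟩, rfl⟩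
        · simp
        · simpa using h3 t (by simp)
        · rw [ih]
          refine ⟨by simpa using h1, by simp, fun t' ht' => h3 t' (by simp [ht'])⟩

theorem leaves_of_mem_terms {f : ℕ} {l : List ℕ} {t : Term} (ht : t ∈ terms f l) :
    Good t ∧ t.leaves = l := by
  induction f generalizing l t with
  | zero => simp [terms] at ht
  | succ f ih =>
    rw [terms, Finset.mem_union] at ht
    rcases ht with ht | ht
    · split_ifs at ht with hl
      · obtain ⟨i, rfl⟩ := List.length_eq_one_iff.1 hl
        rw [Finset.mem_singleton] at ht
        subst ht
        exact ⟨Good.leaf _, by simp⟩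
      · simp at ht
    · simp only [Finset.mem_biUnion, Finset.mem_image, Finset.mem_Icc] at ht
      obtain ⟨c, hc, h, hh, cs, hcs, rfl⟩ := ht
      rw [mem_termLists (fun l t ht => (ih (Finset.mem_filter.1 ht).1).2)] at hcs
      obtain ⟨rfl, h2, h3⟩ := hcs
      refine ⟨Good.node h cs hc.1 hh.1 hh.2 (fun t ht => (ih (Finset.mem_filter.1 (h3 t ht)).1).1)
        fun t ht => (Finset.mem_filter.1 (h3 t ht)).2, ?_⟩
      rw [leaves_node, h2]

/-- A child has a sibling, and the sibling has a leaf. This strict decrease lets the number of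
leaves serve as the recursion depth in `terms`. -/
theorem length_leaves_lt_of_mem {h : ℕ} {cs : List Term} (hc : 2 ≤ cs.length)
    (hcs : ∀ t ∈ cs, Good t) {t : Term} (ht : t ∈ cs) :
    t.leaves.length < (node h cs).leaves.length := by
  obtain ⟨as, bs, rfl⟩ := List.append_of_mem ht
  have h1 : as ++ bs ≠ [] := by
    intro h0
    rw [List.append_eq_nil_iff] at h0
    simp [h0.1, h0.2] at hc
  obtain ⟨t', ht'⟩ := List.exists_mem_of_ne_nil _ h1
  have h2 := List.length_pos_iff.2 (hcs t' (by
    rcases List.mem_append.1 ht' with h | h <;> simp [h])).leaves_ne_nil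
  rw [leaves_node, List.length_flatten, List.map_map]
  rcases List.mem_append.1 ht' with h | h
  · have := List.single_le_sum (l := (as.map (List.length ∘ leaves))) (by simp) _
      (List.mem_map_of_mem h)
    simp at this ⊢
    omega
  · have := List.single_le_sum (l := (bs.map (List.length ∘ leaves))) (by simp) _
      (List.mem_map_of_mem h)
    simp at this ⊢
    omega

theorem length_le_length_leaves {cs : List Term} (hcs : ∀ t ∈ cs, Good t) (h : ℕ) :
    cs.length ≤ (node h cs).leaves.length := by
  rw [leaves_node, List.length_flatten, List.map_map]
  induction cs with
  | nil => simp
  | cons t ts ih =>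
    have h1 := List.length_pos_iff.2 (hcs t (by simp)).leaves_ne_nil
    have h2 := ih fun t ht => hcs t (by simp [ht])
    simp at h2 ⊢
    omega

theorem mem_terms_of_good {t : Term} (ht : Good t) {f : ℕ} (hf : t.leaves.length ≤ f) :
    t ∈ terms f t.leaves := by
  induction ht generalizing f with
  | leaf i =>
    rcases f with _ | f
    · simp at hf
    · simp [terms]
  | node h cs hc h1 h2 hgood hatt ih =>
    rcases f with _ | f
    · have := List.length_pos_iff.2 (Good.node h cs hc h1 h2 hgood hatt).leaves_ne_nil
      omega
    · rw [terms, Finset.mem_union]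
      right
      simp only [Finset.mem_biUnion, Finset.mem_image, Finset.mem_Icc]
      refine ⟨cs.length, ⟨hc, length_le_length_leaves hgood h⟩, h, ⟨h1, h2⟩, cs, ?_, rfl⟩
      rw [mem_termLists (fun l t ht => (leaves_of_mem_terms (Finset.mem_filter.1 ht).1).2)]
      refine ⟨rfl, by rw [leaves_node], fun t ht => ?_⟩
      have := length_leaves_lt_of_mem (h := h) hc hgood ht
      exact Finset.mem_filter.2 ⟨ih t ht (by omega), hatt t ht⟩

theorem mem_terms {f : ℕ} {l : List ℕ} (hf : l.length ≤ f) {t : Term} :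
    t ∈ terms f l ↔ Good t ∧ t.leaves = l := by
  refine ⟨leaves_of_mem_terms, ?_⟩
  rintro ⟨ht, rfl⟩
  exact mem_terms_of_good ht hf

end Enumeration

end MomAmp

namespace MomAmp

open Term

/-! ### The generating function of plane trees -/

section Sums

theorem sum_termLists_succ {A : List ℕ → Finset Term} (hA : ∀ l, ∀ t ∈ A l, t.leaves = l)
    (c : ℕ) (l : List ℕ) :
    ∑ cs ∈ termLists A (c + 1) l, (cs.map weight).prod = ∑ i ∈ Finset.range (l.length + 1),
      (∑ t ∈ A (l.take i), t.weight) * ∑ cs ∈ termLists A c (l.drop i), (cs.map weight).prod := by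
  rw [termLists, Finset.sum_biUnion]
  · refine Finset.sum_congr rfl fun i _ => ?_
    rw [Finset.sum_image, Finset.sum_mul_sum, ← Finset.sum_product']
    · simp
    · rintro ⟨t, ts⟩ _ ⟨t', ts'⟩ _ h
      simpa using h
  · intro i hi j hj hij
    rw [Function.onFun, Finset.disjoint_left]
    simp only [Finset.mem_image, Finset.mem_product, Prod.exists]
    rintro _ ⟨t, ts, ⟨ht, _⟩, rfl⟩ ⟨t', ts', ⟨ht', _⟩, h⟩
    obtain ⟨rfl, rfl⟩ := List.cons.inj h
    have h1 := congrArg List.length ((hA _ _ ht).symm.trans (hA _ _ ht'))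
    have hi' := Finset.mem_range.1 hi
    have hj' := Finset.mem_range.1 hj
    rw [List.length_take, List.length_take] at h1
    omega

/-- Cutting the leaf list is a Cauchy product. The hypothesis on A is restricted to lists shorter
than N because it is supplied by induction on the number of leaves. -/
theorem sum_termLists {A : List ℕ → Finset Term} (hA : ∀ l, ∀ t ∈ A l, t.leaves = l)
    {S : CoeffRing⟦X⟧} {N : ℕ}
    (hS : ∀ l : List ℕ, l.length < N → ∑ t ∈ A l, t.weight = PowerSeries.coeff l.length S)
    (c : ℕ) {l : List ℕ} (hl : l.length < N) :
    ∑ cs ∈ termLists A c l, (cs.map weight).prod = PowerSeries.coeff l.length (S ^ c) := by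
  induction c generalizing l with
  | zero =>
    rw [termLists, pow_zero, PowerSeries.coeff_one]
    split_ifs with h1 h2 h2
    · simp
    · simp [h1] at h2
    · exact absurd (List.length_eq_zero_iff.1 h2) h1
    · simp
  | succ c ih =>
    rw [sum_termLists_succ hA, pow_succ', PowerSeries.coeff_mul,
      Finset.Nat.sum_antidiagonal_eq_sum_range_succ_mk]
    refine Finset.sum_congr rfl fun i hi => ?_
    have hi' := Finset.mem_range.1 hi
    have h1 : (l.take i).length = i := by
      rw [List.length_take]
      omega
    have h2 : (l.drop i).length = l.length - i := List.length_drop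
    rw [hS _ (by omega), ih (by omega), h1, h2]

/-- The induction gains one leaf here: with at least two trees and no empty tree, every member of a
list with N leaves has fewer than N leaves. Both extreme cuts contribute zero. -/
theorem sum_termLists_of_two_le {A : List ℕ → Finset Term}
    (hA : ∀ l, ∀ t ∈ A l, t.leaves = l) (hA0 : A [] = ∅)
    {S : CoeffRing⟦X⟧} (hS0 : PowerSeries.constantCoeff S = 0) {N : ℕ}
    (hS : ∀ l : List ℕ, l.length < N → ∑ t ∈ A l, t.weight = PowerSeries.coeff l.length S)
    {c : ℕ} (hc : 2 ≤ c) {l : List ℕ} (hl : l.length ≤ N) :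
    ∑ cs ∈ termLists A c l, (cs.map weight).prod = PowerSeries.coeff l.length (S ^ c) := by
  rcases Nat.lt_or_eq_of_le hl with hl | hl
  · exact sum_termLists hA hS c hl
  rcases N with _ | N
  · rw [List.length_eq_zero_iff] at hl
    subst hl
    rcases c with _ | c
    · omega
    · rw [sum_termLists_succ hA, List.length_nil, PowerSeries.coeff_zero_eq_constantCoeff_apply,
        map_pow, hS0]
      simp [hA0]
  obtain ⟨c, rfl⟩ : ∃ c', c = c' + 1 + 1 := ⟨c - 2, by omega⟩
  rw [sum_termLists_succ hA, pow_succ', PowerSeries.coeff_mul,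
    Finset.Nat.sum_antidiagonal_eq_sum_range_succ_mk]
  refine Finset.sum_congr rfl fun i hi => ?_
  have hi' := Finset.mem_range.1 hi
  have h1 : (l.take i).length = i := by
    rw [List.length_take]
    omega
  have h2 : (l.drop i).length = l.length - i := List.length_drop
  rcases Nat.eq_zero_or_pos i with rfl | hpos
  · rw [List.take_zero, hA0, PowerSeries.coeff_zero_eq_constantCoeff_apply, hS0]
    simp
  rw [sum_termLists hA hS (c + 1) (by omega), h2]
  rcases Nat.lt_or_eq_of_le (Nat.le_of_lt_succ hi') with hlt | heq
  · rw [hS _ (by omega), h1]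
  · rw [← heq, Nat.sub_self, PowerSeries.coeff_zero_eq_constantCoeff_apply, map_pow, hS0]
    simp

/-- The contribution of the plane trees whose root has helicity `h` and `c` children. -/
noncomputable def rootSum (f : ℕ) (l : List ℕ) (h c : ℕ) : CoeffRing :=
  vertexWeight h c * ∑ cs ∈ termLists (fun l' => {t ∈ terms f l' | Attachable h c t}) c l,
    (cs.map weight).prod

theorem mem_filter_attachable {f h c : ℕ} (l : List ℕ) :
    ∀ t ∈ {t ∈ terms f l | Attachable h c t}, t.leaves = l :=
  fun _ ht => (leaves_of_mem_terms (Finset.mem_filter.1 ht).1).2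

/-- The factor χ marks the colour of the root. It depends only on the helicity and the number of
children, so it comes out of the sum over lists of children. -/
theorem sum_terms_succ (f : ℕ) (l : List ℕ) (χ : Term → CoeffRing) (χ' : ℕ → ℕ → CoeffRing)
    (hleaf : ∀ i, χ (leaf i) = 1) (hnode : ∀ h cs, χ (node h cs) = χ' h cs.length) :
    ∑ t ∈ terms (f + 1) l, χ t * t.weight = (if l.length = 1 then 1 else 0) +
      ∑ c ∈ Finset.Icc 2 l.length, ∑ h ∈ Finset.Icc 1 c, χ' h c * rootSum f l h c := by
  rw [terms, Finset.sum_union, Finset.sum_biUnion]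
  · congr 1
    · split_ifs <;> simp [hleaf]
    · refine Finset.sum_congr rfl fun c _ => ?_
      rw [Finset.sum_biUnion]
      · refine Finset.sum_congr rfl fun h _ => ?_
        rw [Finset.sum_image (fun _ _ _ _ hcs => (node.inj hcs).2), rootSum, Finset.mul_sum,
          Finset.mul_sum]
        refine Finset.sum_congr rfl fun cs hcs => ?_
        rw [mem_termLists mem_filter_attachable] at hcs
        rw [hnode, weight_node, hcs.1]
      · intro h _ h' _ hne
        rw [Function.onFun, Finset.disjoint_left]
        simp only [Finset.mem_image]
        rintro _ ⟨cs, _, rfl⟩ ⟨cs', _, h1⟩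
        exact hne (node.inj h1).1.symm
  · intro c _ c' _ hne
    rw [Function.onFun, Finset.disjoint_left]
    simp only [Finset.mem_biUnion, Finset.mem_image]
    rintro _ ⟨h, _, cs, hcs, rfl⟩ ⟨h', _, cs', hcs', h1⟩
    rw [mem_termLists mem_filter_attachable] at hcs hcs'
    rw [(node.inj h1).2] at hcs'
    exact hne (hcs.1.symm.trans hcs'.1)
  · rw [Finset.disjoint_left]
    intro t ht
    split_ifs at ht
    · rw [Finset.mem_singleton] at ht
      subst ht
      simp
    · simp at ht

/-- The generating function `P / (1 + a P)` of the plane trees whose root is not white (`a = q`)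
or not black (`a = y q`). -/
noncomputable def colouredGF (a : CoeffRing) : CoeffRing⟦X⟧ :=
  invC * PowerSeries.invOfUnit (1 + PowerSeries.C a * invC) 1

theorem colouredGF_mul (a : CoeffRing) : colouredGF a * (1 + PowerSeries.C a * invC) = invC := by
  rw [colouredGF, mul_assoc, PowerSeries.invOfUnit_mul _ _ (by simp [constantCoeff_invC]),
    mul_one]

theorem constantCoeff_colouredGF (a : CoeffRing) :
    PowerSeries.constantCoeff (colouredGF a) = 0 := by
  simp [colouredGF, constantCoeff_invC]

theorem coeff_substHom {R : Type*} [CommRing R] {a : R⟦X⟧} (ha : PowerSeries.constantCoeff a = 0)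
    (g : R⟦X⟧) (n : ℕ) : PowerSeries.coeff n (substHom a ha g) =
      ∑ c ∈ Finset.range (n + 1), PowerSeries.coeff c g * PowerSeries.coeff n (a ^ c) := by
  obtain ⟨e, he⟩ := exists_eq_sum_add_X_pow_mul g (n + 1)
  have ha' : PowerSeries.X ∣ a := PowerSeries.X_dvd_iff.2 ha
  have h0 : PowerSeries.coeff n (a ^ (n + 1) * substHom a ha e) = 0 :=
    PowerSeries.X_pow_dvd_iff.1 ((pow_dvd_pow_of_dvd ha' (n + 1)).mul_right _) n n.lt_succ_self
  conv_lhs => rw [he]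
  rw [map_add, map_sum, map_mul, map_pow, substHom_X, map_add, h0, add_zero, map_sum]
  refine Finset.sum_congr rfl fun c _ => ?_
  rw [map_mul, map_pow, substHom_X, substHom_C, PowerSeries.coeff_C_mul]

/-- The series `a x² / (1 - a x)`. -/
noncomputable def monoSeries (a : CoeffRing) : CoeffRing⟦X⟧ :=
  PowerSeries.mk fun c => if 2 ≤ c then a ^ (c - 1) else 0

theorem monoSeries_mul (a : CoeffRing) :
    monoSeries a * (1 - PowerSeries.C a * PowerSeries.X) =
      PowerSeries.C a * PowerSeries.X ^ 2 := by
  have h : monoSeries a = PowerSeries.C a * PowerSeries.X ^ 2 +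
      PowerSeries.X * (PowerSeries.C a * monoSeries a) := by
    ext1 c
    rcases c with _ | c
    · simp [monoSeries]
    · rw [map_add, PowerSeries.coeff_succ_X_mul, PowerSeries.coeff_C_mul, PowerSeries.coeff_C_mul,
        PowerSeries.coeff_X_pow, monoSeries, PowerSeries.coeff_mk, PowerSeries.coeff_mk]
      rcases c with _ | _ | c
      · simp
      · simp
      · simp [pow_succ']
  linear_combination h

/-- The series counting generic vertices by their number of children. -/
noncomputable def genericSeries {R : Type*} [CommRing R] (v w : R) : R⟦X⟧ :=
  PowerSeries.mk fun c => ∑ h ∈ Finset.Icc 2 (c - 1), v ^ (h - 1) * w ^ (2 * c - 3)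

theorem genericSeries_mul {R : Type*} [CommRing R] (v w : R) : genericSeries v w *
    ((1 - PowerSeries.C w ^ 2 * PowerSeries.X) *
      (1 - PowerSeries.C v * PowerSeries.C w ^ 2 * PowerSeries.X)) =
        PowerSeries.C v * PowerSeries.C w ^ 3 * PowerSeries.X ^ 3 := by
  -- g collects the top terms h = c - 1. Raising c by one multiplies the terms with fixed h by w²
  -- and those of g by vw², which gives the two geometric factors.
  let g : R⟦X⟧ := PowerSeries.mk fun c => if 3 ≤ c then v ^ (c - 2) * w ^ (2 * c - 3) else 0
  have h1 : genericSeries v w =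
      g + PowerSeries.X * (PowerSeries.C (w ^ 2) * genericSeries v w) := by
    ext1 c
    rcases c with _ | c
    · simp [genericSeries, g]
    · rw [map_add, PowerSeries.coeff_succ_X_mul, PowerSeries.coeff_C_mul]
      simp only [genericSeries, g, PowerSeries.coeff_mk]
      rcases c with _ | _ | c
      · simp
      · simp
      · rw [show c + 1 + 1 + 1 - 1 = c + 1 + 1 by omega, Finset.sum_Icc_succ_top (by omega),
          show c + 1 + 1 - 1 = c + 1 by omega, if_pos (by omega), Finset.mul_sum, add_comm]
        congr 1
        refine Finset.sum_congr rfl fun h _ => ?_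
        rw [show 2 * (c + 1 + 1 + 1) - 3 = 2 + (2 * (c + 1 + 1) - 3) by omega, pow_add]
        ring
  have h2 : g = PowerSeries.C (v * w ^ 3) * PowerSeries.X ^ 3 +
      PowerSeries.X * (PowerSeries.C (v * w ^ 2) * g) := by
    ext1 c
    rcases c with _ | c
    · simp [g]
    · rw [map_add, PowerSeries.coeff_succ_X_mul, PowerSeries.coeff_C_mul, PowerSeries.coeff_C_mul,
        PowerSeries.coeff_X_pow]
      simp only [g, PowerSeries.coeff_mk]
      rcases c with _ | _ | _ | c
      · simp
      · simp
      · simp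
      · rw [if_pos (by omega), if_neg (by omega), if_pos (by omega),
          show c + 1 + 1 + 1 + 1 - 2 = 1 + (c + 1 + 1 + 1 - 2) by omega,
          show 2 * (c + 1 + 1 + 1 + 1) - 3 = 2 + (2 * (c + 1 + 1 + 1) - 3) by omega, pow_add,
          pow_add]
        ring
  simp only [map_mul, map_pow] at h1 h2
  linear_combination (1 - PowerSeries.C v * PowerSeries.C w ^ 2 * PowerSeries.X) * h1 + h2

/-- With U = P/(1 + aP) one has P = U/(1 - aU), hence aU²/(1 - aU) = P - U. Combinatorially, a root
of the given colour has at least two children, none of that colour. -/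
theorem substHom_monoSeries (a : CoeffRing) :
    substHom (colouredGF a) (constantCoeff_colouredGF a) (monoSeries a) =
      invC - colouredGF a := by
  have h := congrArg (substHom (colouredGF a) (constantCoeff_colouredGF a)) (monoSeries_mul a)
  simp only [map_mul, map_sub, map_one, map_pow, substHom_C, substHom_X] at h
  have hne : (1 - PowerSeries.C a * colouredGF a) ≠ 0 := by
    intro h0
    have := congrArg PowerSeries.constantCoeff h0
    simp [constantCoeff_colouredGF] at this
  apply mul_right_cancel₀ hne
  rw [h]
  linear_combination colouredGF_mul a

/-- The equation C(P) = x in partial fractions: the four summands are the single leaf, the white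
roots, the black roots and the generic roots. This is the origin of the rational function C. -/
theorem invC_eq : invC = x + (invC - colouredGF Polynomial.X) +
    (invC - colouredGF (Polynomial.C Polynomial.X * Polynomial.X)) +
    substHom invC constantCoeff_invC (genericSeries (Polynomial.C Polynomial.X) Polynomial.X) := by
  have hG := congrArg (substHom invC constantCoeff_invC)
    (genericSeries_mul (Polynomial.C Polynomial.X : CoeffRing) Polynomial.X)
  simp only [map_mul, map_sub, map_one, map_pow, substHom_C, substHom_X] at hG
  change _ * ((1 - q ^ 2 * _) * (1 - y * q ^ 2 * _)) = y * q ^ 3 * _ at hG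
  have hU := colouredGF_mul Polynomial.X
  have hV := colouredGF_mul (Polynomial.C Polynomial.X * Polynomial.X)
  have hP := evalNum_invC
  rw [map_mul] at hV
  change _ * (1 + q * _) = _ at hU
  change _ * (1 + y * q * _) = _ at hV
  set P := invC
  set U := colouredGF Polynomial.X
  set V := colouredGF (Polynomial.C Polynomial.X * Polynomial.X)
  set Gn := substHom invC constantCoeff_invC
    (genericSeries (Polynomial.C Polynomial.X) Polynomial.X)
  have hne : evalDen y q P ≠ 0 := by
    intro h0
    have := congrArg PowerSeries.constantCoeff h0
    rw [map_evalDen, constantCoeff_invC, evalDen] at this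
    simp at this
  apply mul_right_cancel₀ hne
  rw [evalNum] at hP
  rw [evalDen] at hP ⊢
  linear_combination hP - (1 + P * q) * (1 + P * y * q) * hG +
    (1 + P * y * q) * (1 - P * q ^ 2) * (1 - P * y * q ^ 2) * hU +
    (1 + P * q) * (1 - P * q ^ 2) * (1 - P * y * q ^ 2) * hV

end Sums

end MomAmp

/-! ### Counting plane trees by the functional equation. -/

namespace MomAmp

open Term

section TreeCount

local notation "qv" => (Polynomial.X : CoeffRing)

local notation "yv" => (Polynomial.C Polynomial.X : CoeffRing)

theorem sum_Icc_monoSeries (a : CoeffRing) (n : ℕ) :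
    ∑ c ∈ Finset.Icc 2 n, a ^ (c - 1) * PowerSeries.coeff n (colouredGF a ^ c) =
      PowerSeries.coeff n (invC - colouredGF a) := by
  rw [← substHom_monoSeries, coeff_substHom]
  apply Finset.sum_subset_zero_on_sdiff
  · intro c hc
    rw [Finset.mem_Icc] at hc
    exact Finset.mem_range.2 (by omega)
  · intro c hc
    rw [Finset.mem_sdiff, Finset.mem_range, Finset.mem_Icc] at hc
    rw [monoSeries, PowerSeries.coeff_mk, if_neg (by omega), zero_mul]
  · intro c hc
    rw [monoSeries, PowerSeries.coeff_mk, if_pos (Finset.mem_Icc.1 hc).1]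

theorem sum_Icc_genericSeries (n : ℕ) :
    ∑ c ∈ Finset.Icc 2 n, ∑ h ∈ Finset.Icc 2 (c - 1),
      yv ^ (h - 1) * qv ^ (2 * c - 3) * PowerSeries.coeff n (invC ^ c) =
      PowerSeries.coeff n (substHom invC constantCoeff_invC (genericSeries yv qv)) := by
  rw [coeff_substHom]
  simp only [genericSeries, PowerSeries.coeff_mk, Finset.sum_mul]
  apply Finset.sum_subset
  · intro c hc
    rw [Finset.mem_Icc] at hc
    exact Finset.mem_range.2 (by omega)
  · intro c hc hc'
    rw [Finset.mem_range] at hc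
    rw [Finset.mem_Icc] at hc'
    rw [Finset.Icc_eq_empty (by omega), Finset.sum_empty]

theorem vertexWeight_one (c : ℕ) : vertexWeight 1 c = qv ^ (c - 1) := by
  simp [vertexWeight, qExp]

theorem vertexWeight_self (c : ℕ) : vertexWeight c c = (yv * qv) ^ (c - 1) := by
  simp [vertexWeight, qExp, mul_pow]

theorem vertexWeight_of_ne {h c : ℕ} (h1 : h ≠ 1) (h2 : h ≠ c) :
    vertexWeight h c = yv ^ (h - 1) * qv ^ (2 * c - 3) := by
  simp [vertexWeight, qExp, h1, h2]

/-- The weight sums of good plane trees with at most `f` leaves. -/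
def SumsUpTo (f : ℕ) : Prop := ∀ l : List ℕ, l.length ≤ f →
  ∑ t ∈ terms f l, t.weight = PowerSeries.coeff l.length invC ∧
  ∑ t ∈ terms f l with ¬ t.IsWhite, t.weight = PowerSeries.coeff l.length (colouredGF qv) ∧
  ∑ t ∈ terms f l with ¬ t.IsBlack, t.weight = PowerSeries.coeff l.length (colouredGF (yv * qv))

theorem terms_nil (f : ℕ) : terms f [] = ∅ := by
  rw [Finset.eq_empty_iff_forall_notMem]
  intro t ht
  obtain ⟨h1, h2⟩ := leaves_of_mem_terms ht
  exact h1.leaves_ne_nil h2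

/-- The colour of the root decides which trees may be its children: non-white, non-black or
arbitrary. Since c ≥ 2, the conditions h = 1 and h = c exclude each other. -/
theorem rootSum_eq {f : ℕ} (hf : SumsUpTo f) {l : List ℕ} (hl : l.length ≤ f + 1) {h c : ℕ}
    (hc : 2 ≤ c) : rootSum f l h c = vertexWeight h c * PowerSeries.coeff l.length
      ((if h = 1 then colouredGF qv else if h = c then colouredGF (yv * qv) else invC) ^ c) := by
  rw [rootSum]
  congr 1
  apply sum_termLists_of_two_le mem_filter_attachable
  · rw [terms_nil, Finset.filter_empty]
  · split_ifs
    · exact constantCoeff_colouredGF _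
    · exact constantCoeff_colouredGF _
    · exact constantCoeff_invC
  · intro l' hl'
    obtain ⟨h1, h2, h3⟩ := hf l' (Nat.le_of_lt_succ hl')
    split_ifs with hh hh'
    · rw [← h2]
      refine Finset.sum_congr (Finset.filter_congr fun t _ => ?_) fun _ _ => rfl
      rw [Attachable]
      constructor
      · exact fun ht => ht.1 hh
      · exact fun ht => ⟨fun _ => ht, fun h' => by omega⟩
    · rw [← h3]
      refine Finset.sum_congr (Finset.filter_congr fun t _ => ?_) fun _ _ => rfl
      rw [Attachable]
      constructor
      · exact fun ht => ht.2 hh'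
      · exact fun ht => ⟨fun h' => by omega, fun _ => ht⟩
    · rw [← h1, Finset.filter_true_of_mem]
      exact fun t _ => ⟨fun h' => absurd h' hh, fun h' => absurd h' hh'⟩
  · exact hc
  · exact hl

/-- The markers α for white roots and β for black roots allow all three sums of `SumsUpTo` to be
treated at once; the sum over h splits into its two ends and the generic middle. -/
theorem sum_rootSum {f : ℕ} (hf : SumsUpTo f) {l : List ℕ} (hl : l.length ≤ f + 1)
    (α β : CoeffRing) :
    ∑ c ∈ Finset.Icc 2 l.length, ∑ h ∈ Finset.Icc 1 c,
      (if h = 1 then α else if h = c then β else 1) * rootSum f l h c =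
    α * PowerSeries.coeff l.length (invC - colouredGF qv) +
      β * PowerSeries.coeff l.length (invC - colouredGF (yv * qv)) +
      PowerSeries.coeff l.length (substHom invC constantCoeff_invC (genericSeries yv qv)) := by
  rw [← sum_Icc_monoSeries, ← sum_Icc_monoSeries, ← sum_Icc_genericSeries, Finset.mul_sum,
    Finset.mul_sum, ← Finset.sum_add_distrib, ← Finset.sum_add_distrib]
  refine Finset.sum_congr rfl fun c hc => ?_
  have hc' := (Finset.mem_Icc.1 hc).1
  obtain ⟨d, rfl⟩ : ∃ d, c = d + 1 + 1 := ⟨c - 2, by omega⟩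
  rw [Finset.sum_Icc_succ_top (by omega), ← Finset.add_sum_Ioc_eq_sum_Icc (by omega)]
  rw [rootSum_eq hf hl hc', rootSum_eq hf hl hc', if_pos rfl, if_pos rfl, if_neg (by omega),
    if_pos rfl, if_neg (by omega), if_pos rfl, vertexWeight_one, vertexWeight_self]
  have : ∑ h ∈ Finset.Ioc 1 (d + 1), (if h = 1 then α else if h = d + 1 + 1 then β else 1) *
      rootSum f l h (d + 1 + 1) = ∑ h ∈ Finset.Icc 2 (d + 1 + 1 - 1), yv ^ (h - 1) *
        qv ^ (2 * (d + 1 + 1) - 3) * PowerSeries.coeff l.length (invC ^ (d + 1 + 1)) := by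
    refine Finset.sum_congr (by ext; simp; omega) fun h hh => ?_
    have hh' : 2 ≤ h ∧ h ≤ d + 1 := Finset.mem_Icc.1 hh
    rw [rootSum_eq hf hl hc', if_neg (by omega), if_neg (by omega), if_neg (by omega),
      if_neg (by omega), vertexWeight_of_ne (by omega) (by omega), one_mul]
  rw [this]
  ring

theorem coeff_x (n : ℕ) : PowerSeries.coeff n x = if n = 1 then 1 else 0 := by
  rw [x, PowerSeries.coeff_X]

open scoped Classical in
theorem sum_terms_ite {f : ℕ} (hf : SumsUpTo f) {l : List ℕ} (hl : l.length ≤ f + 1)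
    (α β : CoeffRing) :
    ∑ t ∈ terms (f + 1) l, (if t.IsWhite then α else if t.IsBlack then β else 1) * t.weight =
    PowerSeries.coeff l.length (x + PowerSeries.C α * (invC - colouredGF qv) +
      PowerSeries.C β * (invC - colouredGF (yv * qv)) +
      substHom invC constantCoeff_invC (genericSeries yv qv)) := by
  rw [sum_terms_succ f l _ (fun h c => if h = 1 then α else if h = c then β else 1),
    sum_rootSum hf hl]
  · simp only [map_add, PowerSeries.coeff_C_mul, coeff_x]
    ring
  · simp [Term.IsWhite, Term.IsBlack]
  · intro h cs
    simp only [Term.IsWhite, Term.IsBlack]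
    congr

/-- Taking (α, β) = (1, 1), (0, 1), (1, 0) selects all trees, the non-white ones and the non-black
ones; `invC_eq` identifies the right-hand sides with P, U and V. -/
theorem sumsUpTo (f : ℕ) : SumsUpTo f := by
  classical
  induction f with
  | zero =>
    intro l hl
    have hl' : l = [] := List.length_eq_zero_iff.1 (by omega)
    subst hl'
    simp [terms_nil, constantCoeff_invC, constantCoeff_colouredGF]
  | succ f ih =>
    intro l hl
    have h (α β : CoeffRing) := sum_terms_ite ih hl α β
    refine ⟨?_, ?_, ?_⟩
    · have h1 := h 1 1
      simp only [ite_self, one_mul, map_one] at h1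
      rw [h1, ← invC_eq]
    · have h1 := h 0 1
      simp only [ite_self, map_one, map_zero] at h1
      have h2 : colouredGF qv = x + 0 * (invC - colouredGF qv) +
          1 * (invC - colouredGF (yv * qv)) +
          substHom invC constantCoeff_invC (genericSeries yv qv) := by
        linear_combination invC_eq
      rw [h2, ← h1, Finset.sum_filter]
      refine Finset.sum_congr rfl fun t _ => ?_
      split_ifs <;> simp
    · have h1 := h 1 0
      simp only [map_one, map_zero] at h1
      have h2 : colouredGF (yv * qv) = x + 1 * (invC - colouredGF qv) +
          0 * (invC - colouredGF (yv * qv)) +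
          substHom invC constantCoeff_invC (genericSeries yv qv) := by
        linear_combination invC_eq
      rw [h2, ← h1, Finset.sum_filter]
      refine Finset.sum_congr rfl fun t ht => ?_
      -- The marker tests whiteness first, so setting β = 0 removes all black trees only if no tree
      -- is both white and black; this is where at least two children matter.
      have h3 : t.IsWhite → ¬ t.IsBlack := by
        have hg := (leaves_of_mem_terms ht).1
        cases hg with
        | leaf => exact fun h => h.elim
        | node h cs hc =>
          intro (hw : h = 1) (hb : h = cs.length)
          omega
      by_cases hw : t.IsWhite
      · rw [if_pos (h3 hw), if_pos hw, one_mul]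
      · by_cases hb : t.IsBlack
        · rw [if_neg (not_not.2 hb), if_neg hw, if_pos hb, zero_mul]
        · rw [if_pos hb, if_neg hw, if_neg hb, one_mul]

theorem sum_weight_terms {f : ℕ} {l : List ℕ} (hl : l.length ≤ f) :
    ∑ t ∈ terms f l, t.weight = PowerSeries.coeff l.length invC :=
  (sumsUpTo f l hl).1

end TreeCount

end MomAmp

namespace MomAmp

open Term

/-! ### Encoded components and forests -/

/-- The leaves of a component, encoded by its smallest leaf together with the plane tree attached
to it. -/
def block (K : ℕ × Term) : List ℕ := K.1 :: K.2.leaves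

/-- The plane trees that are attached to the smallest leaf of a component: a boundary leaf with
helicity `0` or `1`, or a good plane tree. -/
def GoodComp (K : ℕ × Term) : Prop := (K.2 = node 0 [] ∨ K.2 = node 1 []) ∨ Good K.2

/-- The weight of a component. -/
noncomputable def compWeight (K : ℕ × Term) : CoeffRing :=
  match K.2 with
  | node h [] => Polynomial.C Polynomial.X ^ h
  | t => Polynomial.C Polynomial.X * Polynomial.X * t.weight

theorem compWeight_of_good {K : ℕ × Term} (h : Good K.2) :
    compWeight K = Polynomial.C Polynomial.X * Polynomial.X * K.2.weight := by
  obtain ⟨r, t⟩ := K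
  cases h with
  | leaf i => rfl
  | node h cs hc =>
    rcases cs with _ | ⟨t, ts⟩
    · simp at hc
    · rfl

theorem not_good_node_nil (h : ℕ) : ¬ Good (node h []) := by
  intro hg
  cases hg with
  | node h cs hc => simp at hc

/-- The components with given leaves. -/
noncomputable def compsOf : List ℕ → Finset (ℕ × Term)
  | [] => ∅
  | r :: l => ((if l = [] then {node 0 [], node 1 []} else ∅) ∪ terms l.length l).image fun t => (r, t)

theorem mem_compsOf {l : List ℕ} {K : ℕ × Term} : K ∈ compsOf l ↔ GoodComp K ∧ block K = l := by
  obtain ⟨r, t⟩ := K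
  rcases l with _ | ⟨r', l⟩
  · simp [compsOf, block]
  · simp only [compsOf, block, GoodComp, Finset.mem_image, Finset.mem_union,
      mem_terms (le_refl l.length), Prod.mk.injEq, List.cons.injEq]
    constructor
    · rintro ⟨t', h, rfl, rfl⟩
      rcases h with h | h
      · split_ifs at h with hl
        · subst hl
          simp only [Finset.mem_insert, Finset.mem_singleton] at h
          refine ⟨Or.inl h, rfl, ?_⟩
          rcases h with rfl | rfl <;> simp [leaves_node]
        · simp at h
      · exact ⟨Or.inr h.1, rfl, h.2⟩
    · rintro ⟨h, rfl, rfl⟩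
      refine ⟨t, ?_, rfl, rfl⟩
      rcases h with h | h
      · left
        rcases h with rfl | rfl <;> simp [leaves_node]
      · exact Or.inr ⟨h, rfl⟩

/-- In G_tree = x(1 + y + yqP) the factor x is the smallest leaf, 1 and y are the boundary leaves of
helicity 0 and 1, and yqP accounts for the good trees. -/
theorem sum_compWeight (l : List ℕ) :
    ∑ K ∈ compsOf l, compWeight K = PowerSeries.coeff l.length treeGF := by
  rcases l with _ | ⟨r, l⟩
  · simp [compsOf, constantCoeff_treeGF]
  · have h1 : PowerSeries.coeff (r :: l).length treeGF =
        PowerSeries.coeff l.length (1 + PowerSeries.C (Polynomial.C Polynomial.X) +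
          PowerSeries.C (Polynomial.C Polynomial.X * Polynomial.X) * invC) := by
      rw [treeGF_eq, x, List.length_cons, PowerSeries.coeff_succ_X_mul, map_mul]
      rfl
    rw [h1, map_add, map_add, PowerSeries.coeff_C_mul, ← sum_weight_terms le_rfl, compsOf,
      Finset.sum_image (fun _ _ _ _ h => (Prod.mk.inj h).2), Finset.sum_union]
    · congr 1
      · split_ifs with hl
        · subst hl
          rw [Finset.sum_pair (by simp)]
          simp [compWeight]
        · rw [PowerSeries.coeff_one, PowerSeries.coeff_C,
            if_neg (by simpa using hl), if_neg (by simpa using hl)]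
          simp
      · rw [Finset.mul_sum]
        exact Finset.sum_congr rfl fun t ht => compWeight_of_good (leaves_of_mem_terms ht).1
    · rw [Finset.disjoint_left]
      intro t ht ht'
      have hg := (leaves_of_mem_terms ht').1
      split_ifs at ht
      · simp only [Finset.mem_insert, Finset.mem_singleton] at ht
        rcases ht with rfl | rfl <;> exact not_good_node_nil _ hg
      · simp at ht

/-- The encoded contracted Grassmannian forests whose leaves are labelled by a set `S`. -/
structure IsForest (S : Set ℕ) (Φ : Finset (ℕ × Term)) : Prop where
  good : ∀ K ∈ Φ, GoodComp K
  sorted : ∀ K ∈ Φ, (block K).Pairwise (· < ·)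
  cover : ∀ i, i ∈ S ↔ ∃ K ∈ Φ, i ∈ block K
  disjoint : ∀ K ∈ Φ, ∀ K' ∈ Φ, ∀ i, i ∈ block K → i ∈ block K' → K = K'
  noncrossing : ∀ K ∈ Φ, ∀ K' ∈ Φ, ∀ a b c d, a < b → b < c → c < d → a ∈ block K →
    c ∈ block K → b ∈ block K' → d ∈ block K' → K = K'

theorem fst_mem_block (K : ℕ × Term) : K.1 ∈ block K := by simp [block]

namespace IsForest

variable {S S' : Set ℕ} {Φ Φ' : Finset (ℕ × Term)}

theorem mem_of_mem (h : IsForest S Φ) {K : ℕ × Term} (hK : K ∈ Φ) {i : ℕ} (hi : i ∈ block K) :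
    i ∈ S := (h.cover i).2 ⟨K, hK, hi⟩

theorem fst_mem (h : IsForest S Φ) {K : ℕ × Term} (hK : K ∈ Φ) : K.1 ∈ S :=
  h.mem_of_mem hK (fst_mem_block K)

theorem fst_le (h : IsForest S Φ) {K : ℕ × Term} (hK : K ∈ Φ) {i : ℕ} (hi : i ∈ block K) :
    K.1 ≤ i := by
  have h1 := h.sorted K hK
  rw [block, List.pairwise_cons] at h1
  rcases List.mem_cons.1 hi with rfl | hi
  · exact le_rfl
  · exact (h1.1 i hi).le

theorem empty : IsForest ∅ ∅ := ⟨by simp, by simp, by simp, by simp, by simp⟩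

theorem eq_empty (h : IsForest ∅ Φ) : Φ = ∅ :=
  Finset.eq_empty_of_forall_notMem fun _ hK => h.fst_mem hK

theorem union (h : IsForest S Φ) (h' : IsForest S' Φ') (hdisj : ∀ i ∈ S, i ∉ S')
    (h1 : ∀ K ∈ Φ, ∀ K' ∈ Φ', ∀ a b c d, a < b → b < c → c < d → a ∈ block K →
      c ∈ block K → b ∈ block K' → d ∈ block K' → False)
    (h2 : ∀ K ∈ Φ, ∀ K' ∈ Φ', ∀ a b c d, a < b → b < c → c < d → a ∈ block K' →
      c ∈ block K' → b ∈ block K → d ∈ block K → False) : IsForest (S ∪ S') (Φ ∪ Φ') where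
  good K hK := (Finset.mem_union.1 hK).elim (h.good K) (h'.good K)
  sorted K hK := (Finset.mem_union.1 hK).elim (h.sorted K) (h'.sorted K)
  cover i := by
    rw [Set.mem_union, h.cover, h'.cover]
    simp only [Finset.mem_union, or_and_right, exists_or]
  disjoint K hK K' hK' i hi hi' := by
    rcases Finset.mem_union.1 hK with hK | hK <;> rcases Finset.mem_union.1 hK' with hK' | hK'
    · exact h.disjoint K hK K' hK' i hi hi'
    · exact absurd (h'.mem_of_mem hK' hi') (hdisj i (h.mem_of_mem hK hi))
    · exact absurd (h'.mem_of_mem hK hi) (hdisj i (h.mem_of_mem hK' hi'))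
    · exact h'.disjoint K hK K' hK' i hi hi'
  noncrossing K hK K' hK' a b c d hab hbc hcd ha hc hb hd := by
    rcases Finset.mem_union.1 hK with hK | hK <;> rcases Finset.mem_union.1 hK' with hK' | hK'
    · exact h.noncrossing K hK K' hK' a b c d hab hbc hcd ha hc hb hd
    · exact (h1 K hK K' hK' a b c d hab hbc hcd ha hc hb hd).elim
    · exact (h2 K' hK' K hK a b c d hab hbc hcd ha hc hb hd).elim
    · exact h'.noncrossing K hK K' hK' a b c d hab hbc hcd ha hc hb hd

theorem subset (h : IsForest S Φ) (hΦ : Φ' ⊆ Φ)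
    (hS : ∀ i, i ∈ S' ↔ ∃ K ∈ Φ', i ∈ block K) : IsForest S' Φ' where
  good K hK := h.good K (hΦ hK)
  sorted K hK := h.sorted K (hΦ hK)
  cover := hS
  disjoint K hK K' hK' := h.disjoint K (hΦ hK) K' (hΦ hK')
  noncrossing K hK K' hK' := h.noncrossing K (hΦ hK) K' (hΦ hK')

theorem disjoint_of_disjoint (h : IsForest S Φ) (h' : IsForest S' Φ')
    (hdisj : ∀ i ∈ S, i ∉ S') : Disjoint Φ Φ' := by
  rw [Finset.disjoint_left]
  exact fun K hK hK' => hdisj _ (h.fst_mem hK) (h'.fst_mem hK')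

theorem singleton {K : ℕ × Term} (hK : GoodComp K) (hs : (block K).Pairwise (· < ·)) :
    IsForest {i | i ∈ block K} {K} where
  good := by simpa using hK
  sorted := by simpa using hs
  cover := by simp
  disjoint := by simp
  noncrossing := by simp

end IsForest

/-- The encoded forests in which the component of the leaf `a` contains the leaves `pre`, all other
leaves being those in `[a, b)`. -/
def IsExtForest (pre : List ℕ) (a b : ℕ) (Φ : Finset (ℕ × Term)) : Prop :=
  IsForest {i | i ∈ pre ∨ a ≤ i ∧ i < b} Φ ∧ ∃ K ∈ Φ, (pre ++ [a]) <+: block K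

/-- The leaf a is the smallest of all, so it comes first in the block of its component. -/
theorem isForest_Ico_iff {a b : ℕ} (hab : a < b) (Φ : Finset (ℕ × Term)) :
    IsForest {i | a ≤ i ∧ i < b} Φ ↔ IsExtForest [] a b Φ := by
  have hset : {i | i ∈ ([] : List ℕ) ∨ a ≤ i ∧ i < b} = {i | a ≤ i ∧ i < b} := by simp
  rw [IsExtForest, hset]
  refine ⟨fun h => ⟨h, ?_⟩, fun h => h.1⟩
  obtain ⟨K, hK, ha⟩ := (h.cover a).1 ⟨le_rfl, hab⟩
  refine ⟨K, hK, ?_⟩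
  have h1 : K.1 = a := le_antisymm (h.fst_le hK ha) (h.fst_mem hK).1
  rw [block, h1, List.nil_append]
  exact List.prefix_append [a] _

/-- Either the component of a ends at a, and the later leaves carry an arbitrary forest, or it has a
next leaf j; by noncrossing, the leaves strictly between a and j then carry an independent forest.
-/
theorem isExtForest_iff {pre : List ℕ} {a b : ℕ} (hab : a < b)
    (hpre : (pre ++ [a]).Pairwise (· < ·)) (Φ : Finset (ℕ × Term)) :
    IsExtForest pre a b Φ ↔
      (∃ K Φ', K ∈ compsOf (pre ++ [a]) ∧ IsForest {i | a + 1 ≤ i ∧ i < b} Φ' ∧ Φ = {K} ∪ Φ') ∨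
      ∃ j, (a < j ∧ j < b) ∧ ∃ Φ₁ Φ₂, IsForest {i | a + 1 ≤ i ∧ i < j} Φ₁ ∧
        IsExtForest (pre ++ [a]) j b Φ₂ ∧ Φ = Φ₁ ∪ Φ₂ := by
  have hpre' : ∀ i ∈ pre, i < a := fun i hi => (List.pairwise_append.1 hpre).2.2 i hi a (by simp)
  constructor
  · rintro ⟨hΦ, K, hK, rest, hrest⟩
    have hmem (i : ℕ) (hi : i ∈ pre ∨ i = a) : i ∈ block K := by
      rw [← hrest]
      simp only [List.append_assoc, List.mem_append, List.mem_singleton]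
      tauto
    rcases rest with _ | ⟨j, rest⟩
    · left
      rw [List.append_nil] at hrest
      refine ⟨K, Φ.erase K, mem_compsOf.2 ⟨hΦ.good K hK, hrest.symm⟩, ?_, ?_⟩
      · refine hΦ.subset (Finset.erase_subset _ _) fun i => ?_
        constructor
        · rintro ⟨h1, h2⟩
          obtain ⟨K', hK', hi⟩ := (hΦ.cover i).1 (Or.inr ⟨by omega, h2⟩)
          refine ⟨K', Finset.mem_erase.2 ⟨?_, hK'⟩, hi⟩
          rintro rfl
          rw [← hrest, List.mem_append, List.mem_singleton] at hi
          rcases hi with hi | hi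
          · have := hpre' i hi
            omega
          · omega
        · rintro ⟨K', hK', hi⟩
          rw [Finset.mem_erase] at hK'
          have hnot : ¬ (i ∈ pre ∨ i = a) := fun h0 =>
            hK'.1 (hΦ.disjoint _ hK'.2 _ hK i hi (hmem i h0))
          rcases hΦ.mem_of_mem hK'.2 hi with h0 | h0
          · exact absurd (Or.inl h0) hnot
          · have : i ≠ a := fun h1 => hnot (Or.inr h1)
            exact ⟨by omega, h0.2⟩
      · rw [← Finset.insert_eq, Finset.insert_erase hK]
    · right
      have hsort := hΦ.sorted K hK
      rw [← hrest] at hsort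
      have haj : a < j := (List.pairwise_append.1 hsort).2.2 a (by simp) j (by simp)
      have hjK : j ∈ block K := by
        rw [← hrest]
        simp
      have hjb : j < b := by
        rcases hΦ.mem_of_mem hK hjK with h0 | h0
        · have := hpre' j h0
          omega
        · exact h0.2
      have hgap (i : ℕ) (h1 : a < i) (h2 : i < j) : i ∉ block K := by
        intro hi
        rw [← hrest, List.append_assoc, List.mem_append, List.mem_append, List.mem_singleton] at hi
        rcases hi with hi | hi | hi
        · have := hpre' i hi
          omega
        · omega
        · have h3 := (List.pairwise_cons.1 (List.pairwise_append.1 hsort).2.1).1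
          rcases List.mem_cons.1 hi with hi | hi
          · omega
          · have := h3 i hi
            omega
      have hK1 : K.1 ≤ a := hΦ.fst_le hK (hmem a (Or.inr rfl))
      have hroot (K' : ℕ × Term) (hK' : K' ∈ Φ) (h0 : K' ≠ K) : a < K'.1 := by
        rcases hΦ.fst_mem hK' with h1 | h1
        · exact absurd (hΦ.disjoint _ hK' _ hK _ (fst_mem_block K') (hmem _ (Or.inl h1))) h0
        · refine lt_of_le_of_ne h1.1 fun h2 => h0 ?_
          exact hΦ.disjoint _ hK' _ hK _ (fst_mem_block K') (hmem _ (Or.inr h2.symm))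
      -- A component that starts in the gap cannot leave it: a leaf i > j would give a < K'.1 < j <
      -- i, a crossing with the component K of a and j.
      have hinner (K' : ℕ × Term) (hK' : K' ∈ Φ) (h1 : a < K'.1) (h2 : K'.1 < j) (i : ℕ)
          (hi : i ∈ block K') : a < i ∧ i < j := by
        have hne : K' ≠ K := by
          rintro rfl
          omega
        refine ⟨lt_of_lt_of_le h1 (hΦ.fst_le hK' hi), ?_⟩
        by_contra! h3
        rcases Nat.lt_or_eq_of_le h3 with h3 | h3
        · exact hne (hΦ.noncrossing K hK K' hK' a K'.1 j i h1 h2 h3 (hmem a (Or.inr rfl)) hjK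
            (fst_mem_block K') hi).symm
        · subst h3
          exact hne (hΦ.disjoint _ hK' _ hK _ hi hjK)
      have hinner' (i : ℕ) (h1 : a < i) (h2 : i < j) (K' : ℕ × Term) (hK' : K' ∈ Φ)
          (hi : i ∈ block K') : a < K'.1 ∧ K'.1 < j := by
        refine ⟨hroot K' hK' ?_, lt_of_le_of_lt (hΦ.fst_le hK' hi) h2⟩
        rintro rfl
        exact hgap i h1 h2 hi
      -- The smallest leaf alone decides whether a component lies in the gap.
      refine ⟨j, ⟨haj, hjb⟩, {K ∈ Φ | a < K.1 ∧ K.1 < j}, {K ∈ Φ | ¬ (a < K.1 ∧ K.1 < j)},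
        ?_, ⟨?_, K, ?_, ?_⟩, ?_⟩
      · refine hΦ.subset (Finset.filter_subset _ _) fun i => ?_
        simp only [Finset.mem_filter]
        constructor
        · rintro ⟨h1, h2⟩
          obtain ⟨K', hK', hi⟩ := (hΦ.cover i).1 (Or.inr ⟨by omega, by omega⟩)
          exact ⟨K', ⟨hK', hinner' i (by omega) h2 K' hK' hi⟩, hi⟩
        · rintro ⟨K', ⟨hK', h1⟩, hi⟩
          have := hinner K' hK' h1.1 h1.2 i hi
          exact ⟨by omega, this.2⟩
      · refine hΦ.subset (Finset.filter_subset _ _) fun i => ?_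
        simp only [Finset.mem_filter]
        constructor
        · intro hi
          have h1 : i ∈ pre ∨ i = a ∨ j ≤ i ∧ i < b := by simpa [or_assoc] using hi
          have h2 : i ∈ pre ∨ a ≤ i ∧ i < b := by
            rcases h1 with h1 | h1 | h1
            · exact Or.inl h1
            · exact Or.inr ⟨by omega, by omega⟩
            · exact Or.inr ⟨by omega, by omega⟩
          obtain ⟨K', hK', hi'⟩ := (hΦ.cover i).1 h2
          refine ⟨K', ⟨hK', fun h3 => ?_⟩, hi'⟩
          have h4 := hinner K' hK' h3.1 h3.2 i hi'
          rcases h1 with h1 | h1 | h1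
          · have := hpre' i h1
            omega
          · omega
          · omega
        · rintro ⟨K', ⟨hK', h1⟩, hi⟩
          have h2 := hΦ.mem_of_mem hK' hi
          have h3 : ¬ (a < i ∧ i < j) := fun h3 => h1 (hinner' i h3.1 h3.2 K' hK' hi)
          simp only [Set.mem_ofPred_eq, List.mem_append, List.mem_singleton]
          rcases h2 with h2 | h2
          · exact Or.inl (Or.inl h2)
          · by_cases h4 : i = a
            · exact Or.inl (Or.inr h4)
            · exact Or.inr ⟨by omega, h2.2⟩
      · exact Finset.mem_filter.2 ⟨hK, by omega⟩
      · refine ⟨rest, ?_⟩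
        rw [← hrest]
        simp
      · exact (Finset.filter_union_filter_not_eq _ _).symm
  · rintro (⟨K, Φ', hK, hΦ', rfl⟩ | ⟨j, ⟨haj, hjb⟩, Φ₁, Φ₂, h1, ⟨h2, K, hK, rest, hrest⟩, rfl⟩)
    · obtain ⟨hgood, hblock⟩ := mem_compsOf.1 hK
      have hle (i : ℕ) (hi : i ∈ block K) : i ≤ a := by
        rw [hblock, List.mem_append, List.mem_singleton] at hi
        rcases hi with hi | hi
        · exact (hpre' i hi).le
        · exact hi.le
      refine ⟨?_, K, by simp, by rw [hblock]⟩
      have hset : {i | i ∈ pre ∨ a ≤ i ∧ i < b} =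
          {i | i ∈ block K} ∪ {i | a + 1 ≤ i ∧ i < b} := by
        ext i
        simp only [hblock, Set.mem_ofPred_eq, Set.mem_union, List.mem_append, List.mem_singleton]
        constructor
        · rintro (h | h)
          · exact Or.inl (Or.inl h)
          · by_cases h4 : i = a
            · exact Or.inl (Or.inr h4)
            · exact Or.inr ⟨by omega, h.2⟩
        · rintro ((h | h) | h)
          · exact Or.inl h
          · exact Or.inr ⟨by omega, by omega⟩
          · exact Or.inr ⟨by omega, h.2⟩
      rw [hset]
      refine (IsForest.singleton hgood (by rwa [hblock])).union hΦ' ?_ ?_ ?_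
      · intro i hi hi'
        have := hle i hi
        have := hi'.1
        omega
      · intro K₁ hK₁ K₂ hK₂ a' b' c' d' hab' hbc' hcd' ha' hc' hb' hd'
        rw [Finset.mem_singleton] at hK₁
        subst hK₁
        have := hle c' hc'
        have := (hΦ'.mem_of_mem hK₂ hb').1
        omega
      · intro K₁ hK₁ K₂ hK₂ a' b' c' d' hab' hbc' hcd' ha' hc' hb' hd'
        rw [Finset.mem_singleton] at hK₁
        subst hK₁
        have := hle d' hd'
        have := (hΦ'.mem_of_mem hK₂ ha').1
        omega
    · have hmem₂ (K' : ℕ × Term) (hK' : K' ∈ Φ₂) (i : ℕ) (hi : i ∈ block K') : i ≤ a ∨ j ≤ i := by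
        rcases h2.mem_of_mem hK' hi with h | h
        · left
          rcases List.mem_append.1 h with h | h
          · exact (hpre' i h).le
          · exact (List.mem_singleton.1 h).le
        · exact Or.inr h.1
      have hset : {i | i ∈ pre ∨ a ≤ i ∧ i < b} = {i | a + 1 ≤ i ∧ i < j} ∪
          {i | i ∈ pre ++ [a] ∨ j ≤ i ∧ i < b} := by
        ext i
        simp only [Set.mem_ofPred_eq, Set.mem_union, List.mem_append, List.mem_singleton]
        constructor
        · rintro (h | h)
          · exact Or.inr (Or.inl (Or.inl h))
          · by_cases h4 : i = a
            · exact Or.inr (Or.inl (Or.inr h4))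
            · by_cases h5 : i < j
              · exact Or.inl ⟨by omega, h5⟩
              · exact Or.inr (Or.inr ⟨by omega, h.2⟩)
        · rintro (h | (h | h) | h)
          · exact Or.inr ⟨by omega, by omega⟩
          · exact Or.inl h
          · exact Or.inr ⟨by omega, by omega⟩
          · exact Or.inr ⟨by omega, h.2⟩
      refine ⟨?_, K, Finset.mem_union_right _ hK, [j] ++ rest, ?_⟩
      · rw [hset]
        refine h1.union h2 ?_ ?_ ?_
        · intro i hi hi'
          obtain ⟨K', hK', hi''⟩ := (h2.cover i).1 hi'
          have := hmem₂ K' hK' i hi''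
          have := hi.1
          have := hi.2
          omega
        · intro K₁ hK₁ K₂ hK₂ a' b' c' d' hab' hbc' hcd' ha' hc' hb' hd'
          have h3 := h1.mem_of_mem hK₁ ha'
          have h4 := h1.mem_of_mem hK₁ hc'
          have := hmem₂ K₂ hK₂ b' hb'
          have := h3.1
          have := h4.2
          omega
        · intro K₁ hK₁ K₂ hK₂ a' b' c' d' hab' hbc' hcd' ha' hc' hb' hd'
          have h3 := h1.mem_of_mem hK₁ hb'
          have h4 := h1.mem_of_mem hK₁ hd'
          have := hmem₂ K₂ hK₂ c' hc'
          have := h3.1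
          have := h4.2
          omega
      · rw [← hrest]
        simp

end MomAmp

namespace MomAmp

open Term

/-! ### The generating function of encoded forests -/

section ForestSum

open scoped Classical

/-- The weight of an encoded forest. -/
noncomputable def forestWeight (Φ : Finset (ℕ × Term)) : CoeffRing := ∏ K ∈ Φ, compWeight K

/-- The components with leaves less than `N`. -/
noncomputable def compsBelow (N : ℕ) : Finset (ℕ × Term) :=
  (Finset.range N).powerset.biUnion fun s => compsOf (s.sort (· ≤ ·))

theorem mem_compsBelow {N : ℕ} {K : ℕ × Term} (h1 : GoodComp K)
    (h2 : (block K).Pairwise (· < ·)) (h3 : ∀ i ∈ block K, i < N) : K ∈ compsBelow N := by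
  rw [compsBelow, Finset.mem_biUnion]
  refine ⟨(block K).toFinset, ?_, ?_⟩
  · rw [Finset.mem_powerset]
    intro i hi
    exact Finset.mem_range.2 (h3 i (List.mem_toFinset.1 hi))
  · rw [mem_compsOf]
    refine ⟨h1, ?_⟩
    rw [eq_comm, List.toFinset_sort _ (h2.imp fun h => h.ne)]
    exact h2.imp fun h => h.le

/-- The encoded forests with leaves less than `N` and a given property. -/
noncomputable def forestFinset (N : ℕ) (P : Finset (ℕ × Term) → Prop) :
    Finset (Finset (ℕ × Term)) :=
  {Φ ∈ (compsBelow N).powerset | P Φ}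

theorem mem_forestFinset {N : ℕ} {P : Finset (ℕ × Term) → Prop} {S : Set ℕ}
    (hS : ∀ i ∈ S, i < N) (hP : ∀ Φ, P Φ → IsForest S Φ) {Φ : Finset (ℕ × Term)} :
    Φ ∈ forestFinset N P ↔ P Φ := by
  rw [forestFinset, Finset.mem_filter, Finset.mem_powerset]
  refine ⟨fun h => h.2, fun h => ⟨fun K hK => ?_, h⟩⟩
  have h1 := hP Φ h
  exact mem_compsBelow (h1.good K hK) (h1.sorted K hK) fun i hi => hS i (h1.mem_of_mem hK hi)

/-- The smallest leaf of a component lies in exactly one of the two disjoint sets, so the union can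
be undone; weights multiply over the disjoint union. -/
theorem sum_image_union {F₁ F₂ : Finset (Finset (ℕ × Term))} {S₁ S₂ : Set ℕ}
    (h₁ : ∀ Φ ∈ F₁, IsForest S₁ Φ) (h₂ : ∀ Φ ∈ F₂, IsForest S₂ Φ) (hdisj : ∀ i ∈ S₁, i ∉ S₂) :
    ∑ Φ ∈ (F₁ ×ˢ F₂).image fun p => p.1 ∪ p.2, forestWeight Φ =
      (∑ Φ ∈ F₁, forestWeight Φ) * ∑ Φ ∈ F₂, forestWeight Φ := by
  have hrec (Φ₁ Φ₂ : Finset (ℕ × Term)) (h1 : Φ₁ ∈ F₁) (h2 : Φ₂ ∈ F₂) :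
      {K ∈ Φ₁ ∪ Φ₂ | K.1 ∈ S₁} = Φ₁ ∧ {K ∈ Φ₁ ∪ Φ₂ | K.1 ∉ S₁} = Φ₂ := by
    have h3 : ∀ K ∈ Φ₁, K.1 ∈ S₁ := fun K hK => (h₁ _ h1).fst_mem hK
    have h4 : ∀ K ∈ Φ₂, K.1 ∉ S₁ := fun K hK hK' => hdisj _ hK' ((h₂ _ h2).fst_mem hK)
    constructor
    · rw [Finset.filter_union, Finset.filter_true_of_mem h3, Finset.filter_false_of_mem h4,
        Finset.union_empty]
    · rw [Finset.filter_union, Finset.filter_true_of_mem h4,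
        Finset.filter_false_of_mem fun K hK => not_not.2 (h3 K hK), Finset.empty_union]
  rw [Finset.sum_image, Finset.sum_mul_sum, ← Finset.sum_product']
  · refine Finset.sum_congr rfl fun p hp => ?_
    rw [Finset.mem_product] at hp
    exact Finset.prod_union ((h₁ _ hp.1).disjoint_of_disjoint (h₂ _ hp.2) hdisj)
  · rintro ⟨Φ₁, Φ₂⟩ hp ⟨Φ₁', Φ₂'⟩ hp' (heq : Φ₁ ∪ Φ₂ = Φ₁' ∪ Φ₂')
    rw [Finset.mem_coe, Finset.mem_product] at hp hp'
    obtain ⟨h1, h2⟩ := hrec _ _ hp.1 hp.2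
    obtain ⟨h1', h2'⟩ := hrec _ _ hp'.1 hp'.2
    rw [heq] at h1 h2
    rw [Prod.mk.injEq]
    exact ⟨h1.symm.trans h1', h2.symm.trans h2'⟩

/-- The generating function of the forests on `[a, b)` together with the component of `a`, where
`s` further leaves are added to this component. -/
noncomputable def extGF (s : ℕ) : CoeffRing⟦X⟧ :=
  substHom forestArg constantCoeff_forestArg
    (PowerSeries.mk fun m => PowerSeries.coeff (s + m + 1) treeGF) * forestArg

/-- With t_k = [x^k] G_tree, the series is Σ_m t_(s+m+1) (xF)^(m+1). Splitting off m = 0 decides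
whether the component stops at the current leaf; x is that leaf and F is the forest in the gap after
it. -/
theorem extGF_eq (s : ℕ) :
    extGF s = x * (forestGF * (PowerSeries.C (PowerSeries.coeff (s + 1) treeGF) +
      extGF (s + 1))) := by
  have h : (PowerSeries.mk fun m => PowerSeries.coeff (s + m + 1) treeGF) =
      PowerSeries.C (PowerSeries.coeff (s + 1) treeGF) + PowerSeries.X *
        PowerSeries.mk fun m => PowerSeries.coeff (s + 1 + m + 1) treeGF := by
    ext1 m
    rcases m with _ | m
    · simp
    · rw [map_add, PowerSeries.coeff_succ_X_mul, PowerSeries.coeff_mk, PowerSeries.coeff_mk,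
        PowerSeries.coeff_C, if_neg m.succ_ne_zero, zero_add, show s + (m + 1) = s + 1 + m by ring]
  rw [extGF, h, map_add, map_mul, substHom_X, substHom_C, ← mul_assoc, x_mul_forestGF, extGF]
  ring

theorem forestGF_eq_one_add : forestGF = 1 + extGF 0 := by
  have h : treeGF = PowerSeries.X *
      PowerSeries.mk fun m => PowerSeries.coeff (0 + m + 1) treeGF := by
    ext1 m
    rcases m with _ | m
    · simpa using constantCoeff_treeGF
    · rw [PowerSeries.coeff_succ_X_mul, PowerSeries.coeff_mk, zero_add]
  rw [forestGF_eq, extGF]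
  conv_lhs => rw [h]
  rw [map_mul, substHom_X, mul_comm]

theorem constantCoeff_extGF (s : ℕ) : PowerSeries.constantCoeff (extGF s) = 0 := by
  rw [extGF_eq]
  simp [x]

/-- The weight sum over the forests on `[a, b)`. -/
noncomputable def sumForest (N a b : ℕ) : CoeffRing :=
  ∑ Φ ∈ forestFinset N (IsForest {i | a ≤ i ∧ i < b}), forestWeight Φ

/-- The weight sum over the extended forests on `[a, b)`. -/
noncomputable def sumExtForest (N : ℕ) (pre : List ℕ) (a b : ℕ) : CoeffRing :=
  ∑ Φ ∈ forestFinset N (IsExtForest pre a b), forestWeight Φ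

/-- The weighted form of `isExtForest_iff`. Its two alternatives, and the different values of j, are
mutually exclusive because the component of a is unique and its block determines what follows a. -/
theorem sumExtForest_eq {N : ℕ} {pre : List ℕ} {a b : ℕ} (hab : a < b) (hb : b ≤ N)
    (hpre : (pre ++ [a]).Pairwise (· < ·)) :
    sumExtForest N pre a b = PowerSeries.coeff (pre.length + 1) treeGF * sumForest N (a + 1) b +
      ∑ j ∈ Finset.Ioo a b, sumForest N (a + 1) j * sumExtForest N (pre ++ [a]) j b := by
  have hpre' : ∀ i ∈ pre, i < a := fun i hi => (List.pairwise_append.1 hpre).2.2 i hi a (by simp)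
  have hext {pre : List ℕ} {a : ℕ} (hab : a ≤ b) (hpre' : ∀ i ∈ pre, i < a)
      {Φ : Finset (ℕ × Term)} :
      Φ ∈ forestFinset N (IsExtForest pre a b) ↔ IsExtForest pre a b Φ := by
    refine mem_forestFinset (S := {i | i ∈ pre ∨ a ≤ i ∧ i < b}) ?_ fun Φ h => h.1
    rintro i (hi | hi)
    · have := hpre' i hi
      omega
    · exact lt_of_lt_of_le hi.2 hb
  have hfor {a b : ℕ} (hb : b ≤ N) {Φ : Finset (ℕ × Term)} :
      Φ ∈ forestFinset N (IsForest {i | a ≤ i ∧ i < b}) ↔ IsForest {i | a ≤ i ∧ i < b} Φ :=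
    mem_forestFinset (fun i hi => lt_of_lt_of_le hi.2 hb) fun Φ h => h
  have hpre'' (j : ℕ) (hj : a < j) : ∀ i ∈ pre ++ [a], i < j := by
    intro i hi
    rw [List.mem_append, List.mem_singleton] at hi
    rcases hi with hi | rfl
    · exact (hpre' i hi).trans hj
    · exact hj
  let F₀ := (compsOf (pre ++ [a])).image fun K => ({K} : Finset (ℕ × Term))
  have hset : forestFinset N (IsExtForest pre a b) =
      ((F₀ ×ˢ forestFinset N (IsForest {i | a + 1 ≤ i ∧ i < b})).image fun p => p.1 ∪ p.2) ∪
      (Finset.Ioo a b).biUnion fun j => (forestFinset N (IsForest {i | a + 1 ≤ i ∧ i < j}) ×ˢ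
        forestFinset N (IsExtForest (pre ++ [a]) j b)).image fun p => p.1 ∪ p.2 := by
    ext Φ
    rw [hext hab.le hpre', isExtForest_iff hab hpre]
    simp only [F₀, Finset.mem_union, Finset.mem_image, Finset.mem_product, Prod.exists,
      Finset.mem_biUnion, Finset.mem_Ioo, hfor hb]
    refine or_congr ?_ ?_
    · constructor
      · rintro ⟨r, t, Φ', hK, h1, rfl⟩
        exact ⟨{(r, t)}, Φ', ⟨⟨r, t, hK, rfl⟩, h1⟩, rfl⟩
      · rintro ⟨_, Φ', ⟨⟨r, t, hK, rfl⟩, h1⟩, rfl⟩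
        exact ⟨r, t, Φ', hK, h1, rfl⟩
    · refine exists_congr fun j => ?_
      constructor
      · rintro ⟨hj, Φ₁, Φ₂, h1, h2, rfl⟩
        exact ⟨hj, Φ₁, Φ₂, ⟨(hfor (hj.2.le.trans hb)).2 h1, (hext hj.2.le (hpre'' j hj.1)).2 h2⟩,
          rfl⟩
      · rintro ⟨hj, Φ₁, Φ₂, ⟨h1, h2⟩, rfl⟩
        exact ⟨hj, Φ₁, Φ₂, (hfor (hj.2.le.trans hb)).1 h1, (hext hj.2.le (hpre'' j hj.1)).1 h2,
          rfl⟩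
  have hblock {j : ℕ} (hj : a < j) (hjb : j < b) {Φ : Finset (ℕ × Term)}
      (h : Φ ∈ (forestFinset N (IsForest {i | a + 1 ≤ i ∧ i < j}) ×ˢ
        forestFinset N (IsExtForest (pre ++ [a]) j b)).image fun p => p.1 ∪ p.2) :
      ∃ K ∈ Φ, (pre ++ [a] ++ [j]) <+: block K := by
    simp only [Finset.mem_image, Finset.mem_product, Prod.exists] at h
    obtain ⟨Φ₁, Φ₂, ⟨-, h2⟩, rfl⟩ := h
    obtain ⟨-, K, hK, h3⟩ := (hext hjb.le (hpre'' j hj)).1 h2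
    exact ⟨K, Finset.mem_union_right _ hK, h3⟩
  have hunique {Φ : Finset (ℕ × Term)} (h : IsExtForest pre a b Φ) {K K' : ℕ × Term}
      (hK : K ∈ Φ) (hK' : K' ∈ Φ) (h1 : (pre ++ [a]) <+: block K)
      (h2 : (pre ++ [a]) <+: block K') : K = K' :=
    h.1.disjoint K hK K' hK' a (h1.subset (by simp)) (h2.subset (by simp))
  rw [sumExtForest, hset, Finset.sum_union, Finset.sum_biUnion]
  · congr 1
    · rw [sum_image_union (S₁ := {i | i ∈ pre ++ [a]}) (S₂ := {i | a + 1 ≤ i ∧ i < b}), sumForest]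
      · congr 1
        rw [Finset.sum_image fun _ _ _ _ h => Finset.singleton_injective h]
        have := sum_compWeight (pre ++ [a])
        rw [List.length_append, List.length_singleton] at this
        rw [← this]
        simp [forestWeight]
      · intro Φ hΦ
        obtain ⟨K, hK, rfl⟩ := Finset.mem_image.1 hΦ
        obtain ⟨h1, h2⟩ := mem_compsOf.1 hK
        rw [← h2]
        exact IsForest.singleton h1 (by rwa [h2])
      · exact fun Φ hΦ => (hfor hb).1 hΦ
      · intro i hi hi'
        have := hpre'' (a + 1) (Nat.lt_succ_self a) i hi
        have := hi'.1
        omega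
    · refine Finset.sum_congr rfl fun j hj => ?_
      rw [Finset.mem_Ioo] at hj
      rw [sum_image_union (S₁ := {i | a + 1 ≤ i ∧ i < j})
        (S₂ := {i | i ∈ pre ++ [a] ∨ j ≤ i ∧ i < b}), sumForest, sumExtForest]
      · exact fun Φ hΦ => (hfor (hj.2.le.trans hb)).1 hΦ
      · exact fun Φ hΦ => ((hext hj.2.le (hpre'' j hj.1)).1 hΦ).1
      · rintro i ⟨hi1, hi2⟩ (hi | hi)
        · have := hpre'' (a + 1) (Nat.lt_succ_self a) i hi
          omega
        · omega
  · intro j hj j' hj' hne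
    rw [Finset.mem_coe, Finset.mem_Ioo] at hj hj'
    rw [Function.onFun, Finset.disjoint_left]
    intro Φ h h'
    have hΦ : IsExtForest pre a b Φ := by
      rw [← hext hab.le hpre', hset]
      exact Finset.mem_union_right _ (Finset.mem_biUnion.2 ⟨j, Finset.mem_Ioo.2 hj, h⟩)
    obtain ⟨K, hK, h1⟩ := hblock hj.1 hj.2 h
    obtain ⟨K', hK', h2⟩ := hblock hj'.1 hj'.2 h'
    have heq := hunique hΦ hK hK' ((List.prefix_append _ _).trans h1)
      ((List.prefix_append _ _).trans h2)
    subst heq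
    have h3 := List.prefix_of_prefix_length_le h1 h2 (by simp)
    rw [List.prefix_append_right_inj] at h3
    simp at h3
    exact hne h3
  · rw [Finset.disjoint_left]
    intro Φ h h'
    obtain ⟨j, hj, h'⟩ := Finset.mem_biUnion.1 h'
    rw [Finset.mem_Ioo] at hj
    have hΦ : IsExtForest pre a b Φ := by
      rw [← hext hab.le hpre', hset]
      exact Finset.mem_union_left _ h
    obtain ⟨K, hK, h1⟩ := hblock hj.1 hj.2 h'
    simp only [F₀, Finset.mem_image, Finset.mem_product, Prod.exists] at h
    obtain ⟨_, Φ₂, ⟨⟨r, t, hK', rfl⟩, -⟩, rfl⟩ := h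
    have h2 := (mem_compsOf.1 hK').2
    have heq := hunique hΦ (K' := (r, t)) hK (by simp) ((List.prefix_append _ _).trans h1)
      (by rw [h2])
    subst heq
    have h3 := h1.length_le
    rw [h2] at h3
    simp at h3

theorem sumForest_self (N a : ℕ) : sumForest N a a = 1 := by
  have hset : {i | a ≤ i ∧ i < a} = (∅ : Set ℕ) := by
    ext i
    simp
  have h : forestFinset N (IsForest {i | a ≤ i ∧ i < a}) = {∅} := by
    ext Φ
    rw [mem_forestFinset (S := ∅) (by simp) (by simp [hset]), hset, Finset.mem_singleton]
    constructor
    · exact fun h => h.eq_empty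
    · rintro rfl
      exact IsForest.empty
  rw [sumForest, h, Finset.sum_singleton]
  simp [forestWeight]

theorem sumForest_eq_sumExtForest (N : ℕ) {a b : ℕ} (hab : a < b) :
    sumForest N a b = sumExtForest N [] a b := by
  rw [sumForest, sumExtForest]
  congr 2
  ext Φ
  exact isForest_Ico_iff hab Φ

/-- Both counts satisfy the recursion of `extGF_eq`, so one strong induction on the interval length
proves them together: the extended count uses shorter intervals, and the plain count is its case of
empty `pre`. -/
theorem sumForest_and_sumExtForest (N n : ℕ) : (∀ a, a + n ≤ N →
    sumForest N a (a + n) = PowerSeries.coeff n forestGF) ∧ (∀ a pre, a + n ≤ N → 0 < n →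
      (pre ++ [a]).Pairwise (· < ·) → sumExtForest N pre a (a + n) =
        PowerSeries.coeff n (extGF pre.length)) := by
  induction n using Nat.strong_induction_on with
  | _ n ih =>
    have hext : ∀ a pre, a + n ≤ N → 0 < n → (pre ++ [a]).Pairwise (· < ·) →
        sumExtForest N pre a (a + n) = PowerSeries.coeff n (extGF pre.length) := by
      intro a pre ha hn hpre
      obtain ⟨n, rfl⟩ := Nat.exists_eq_succ_of_ne_zero hn.ne'
      rw [sumExtForest_eq (by omega) ha hpre, extGF_eq, x, PowerSeries.coeff_succ_X_mul, mul_add,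
        map_add, mul_comm forestGF, PowerSeries.coeff_C_mul, PowerSeries.coeff_mul,
        Finset.Nat.sum_antidiagonal_eq_sum_range_succ_mk, Finset.sum_range_succ]
      have h1 : sumForest N (a + 1) (a + n.succ) = PowerSeries.coeff n forestGF := by
        rw [← (ih n n.lt_succ_self).1 (a + 1) (by omega)]
        congr 1
        omega
      rw [h1]
      congr 1
      -- The last term of the Cauchy product would correspond to j = b; it vanishes, in agreement
      -- with the strict range j < b.
      rw [Nat.sub_self, PowerSeries.coeff_zero_eq_constantCoeff_apply, constantCoeff_extGF,
        mul_zero, add_zero]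
      refine Finset.sum_bij' (fun j _ => j - (a + 1)) (fun i _ => a + 1 + i) ?_ ?_ ?_ ?_ ?_
      · intro j hj
        rw [Finset.mem_Ioo] at hj
        rw [Finset.mem_range]
        omega
      · intro i hi
        rw [Finset.mem_range] at hi
        rw [Finset.mem_Ioo]
        omega
      · intro j hj
        rw [Finset.mem_Ioo] at hj
        omega
      · intro i _
        omega
      · intro j hj
        rw [Finset.mem_Ioo] at hj
        obtain ⟨i, rfl⟩ : ∃ i, j = a + 1 + i := ⟨j - (a + 1), by omega⟩
        have h2 : a + n.succ = a + 1 + i + (n - i) := by omega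
        rw [show a + 1 + i - (a + 1) = i by omega, (ih i (by omega)).1 (a + 1) (by omega), h2,
          (ih (n - i) (by omega)).2 (a + 1 + i) (pre ++ [a]) (by omega) (by omega) ?_]
        · simp
        · rw [List.pairwise_append]
          refine ⟨hpre, by simp, ?_⟩
          intro k hk l hl
          rw [List.mem_singleton] at hl
          rw [List.mem_append, List.mem_singleton] at hk
          rcases hk with hk | hk
          · have := (List.pairwise_append.1 hpre).2.2 k hk a (by simp)
            omega
          · omega
    refine ⟨fun a ha => ?_, hext⟩
    rcases Nat.eq_zero_or_pos n with rfl | hn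
    · rw [add_zero, sumForest_self, forestGF_eq_one_add, map_add,
        PowerSeries.coeff_zero_eq_constantCoeff_apply, PowerSeries.coeff_zero_eq_constantCoeff_apply,
        constantCoeff_extGF]
      simp
    · rw [sumForest_eq_sumExtForest N (by omega), hext a [] ha hn (by simp), forestGF_eq_one_add,
        map_add, PowerSeries.coeff_one, if_neg hn.ne', zero_add, List.length_nil]

/-- The encoded forests on `n` leaves. -/
noncomputable def forestCodes (n : ℕ) : Finset (Finset (ℕ × Term)) :=
  forestFinset n (IsForest {i | i < n})

theorem mem_forestCodes {n : ℕ} {Φ : Finset (ℕ × Term)} :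
    Φ ∈ forestCodes n ↔ IsForest {i | i < n} Φ :=
  mem_forestFinset (S := {i | i < n}) (fun _ hi => hi) fun _ h => h

theorem sum_forestCodes (n : ℕ) :
    ∑ Φ ∈ forestCodes n, forestWeight Φ = PowerSeries.coeff n forestGF := by
  have h := (sumForest_and_sumExtForest n n).1 0 (by omega)
  rw [← h, sumForest, forestCodes]
  simp

end ForestSum

end MomAmp

namespace MomAmp

/-! ### Rooted acyclic graphs -/

section Orientation

variable {V : Type*} {G : SimpleGraph V} {Ch : V → V → Prop}

/-- An orientation of the edges of a graph such that every vertex has at most one outgoing edge,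
leading to its parent, and such that ranks increase from children to parents. -/
structure Orientation (G : SimpleGraph V) (Ch : V → V → Prop) : Prop where
  adj_iff : ∀ u v, G.Adj u v ↔ Ch u v ∨ Ch v u
  unique : ∀ u v w, Ch u v → Ch u w → v = w
  rank : ∃ ρ : V → ℕ, ∀ u v, Ch u v → ρ u < ρ v

/-- The descendants of a vertex, including the vertex. -/
def Below (Ch : V → V → Prop) (x u : V) : Prop := Relation.ReflTransGen Ch x u

theorem Below.le_rank {ρ : V → ℕ} (hρ : ∀ u v, Ch u v → ρ u < ρ v) {x u : V}
    (h : Below Ch x u) : x = u ∨ ρ x < ρ u := by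
  induction h with
  | refl => exact Or.inl rfl
  | tail _ h ih =>
    right
    rcases ih with rfl | ih
    · exact hρ _ _ h
    · exact ih.trans (hρ _ _ h)

/-- A descendant of `u` other than `u` is a descendant of a child of `u`. -/
theorem Below.exists_child {x u : V} (h : Below Ch x u) (hne : x ≠ u) :
    ∃ v, Ch v u ∧ Below Ch x v := by
  rcases Relation.ReflTransGen.cases_tail h with rfl | ⟨v, h1, h2⟩
  · exact absurd rfl hne
  · exact ⟨v, h2, h1⟩

namespace Orientation

variable (hG : Orientation G Ch)
include hG

theorem adj {u v : V} (h : Ch u v) : G.Adj u v := (hG.adj_iff u v).2 (Or.inl h)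

theorem exists_walk {x u : V} (h : Below Ch x u) :
    ∃ p : G.Walk x u, ∀ z ∈ p.support, Below Ch x z ∧ Below Ch z u := by
  induction h using Relation.ReflTransGen.head_induction_on with
  | refl => exact ⟨SimpleGraph.Walk.nil, by simp [Below, Relation.ReflTransGen.refl]⟩
  | head h1 h2 ih =>
    obtain ⟨p, hp⟩ := ih
    refine ⟨SimpleGraph.Walk.cons (hG.adj h1) p, fun z hz => ?_⟩
    rw [SimpleGraph.Walk.support_cons, List.mem_cons] at hz
    rcases hz with rfl | hz
    · exact ⟨Relation.ReflTransGen.refl, Relation.ReflTransGen.head h1 h2⟩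
    · exact ⟨Relation.ReflTransGen.head h1 (hp z hz).1, (hp z hz).2⟩

theorem reachable {x u : V} (h : Below Ch x u) : G.Reachable x u :=
  (hG.exists_walk h).choose.reachable

theorem total {x u v : V} (hu : Below Ch x u) (hv : Below Ch x v) :
    Below Ch u v ∨ Below Ch v u :=
  Relation.ReflTransGen.total_of_right_unique (fun a b c => hG.unique a b c) hu hv

/-- A walk leaving the descendants of `u` passes through `u` and its parent. -/
theorem exit {u x y : V} (p : G.Walk x y) (hx : Below Ch x u) (hy : ¬ Below Ch y u) :
    ∃ w, Ch u w ∧ u ∈ p.support ∧ w ∈ p.support := by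
  induction p with
  | nil => exact absurd hx hy
  | @cons x z y h p ih =>
    by_cases hz : Below Ch z u
    · obtain ⟨w, h1, h2, h3⟩ := ih hz hy
      exact ⟨w, h1, by simp [h2], by simp [h3]⟩
    · rcases (hG.adj_iff _ _).1 h with h | h
      · rcases Relation.ReflTransGen.cases_head hx with rfl | ⟨w, h1, h2⟩
        · exact ⟨z, h, by simp, by simp⟩
        · rw [hG.unique _ _ _ h1 h] at h2
          exact absurd h2 hz
      · exact absurd (Relation.ReflTransGen.head h hx) hz

theorem below_of_reachable {r x y : V} (hr : ∀ w, ¬ Ch r w) (h : G.Reachable x y)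
    (hx : Below Ch x r) : Below Ch y r := by
  by_contra hy
  obtain ⟨p⟩ := h
  obtain ⟨w, hw, -⟩ := hG.exit p hx hy
  exact hr w hw

/-- The minimal common ancestor of two vertices is on every walk between them. -/
theorem mem_support_of_minimal {ρ : V → ℕ} (hρ : ∀ u v, Ch u v → ρ u < ρ v) {u x y : V}
    (hx : Below Ch x u) (hy : Below Ch y u)
    (hmin : ∀ v, Below Ch x v → Below Ch y v → ρ u ≤ ρ v) (p : G.Walk x y) : u ∈ p.support := by
  by_cases hxu : x = u
  · subst hxu
    exact p.start_mem_support
  · obtain ⟨v, h1, h2⟩ := hx.exists_child hxu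
    have h3 : ¬ Below Ch y v := fun h3 => absurd (hmin v h2 h3) (not_le.2 (hρ _ _ h1))
    obtain ⟨w, h4, -, h5⟩ := hG.exit p h2 h3
    rwa [hG.unique _ _ _ h1 h4]

theorem exists_root [Finite V] (x : V) : ∃ r, (∀ w, ¬ Ch r w) ∧ Below Ch x r := by
  obtain ⟨ρ, hρ⟩ := hG.rank
  obtain ⟨r, hr, hmax⟩ := Set.Finite.exists_maximalFor ρ {r | Below Ch x r} (Set.toFinite _)
    ⟨x, Relation.ReflTransGen.refl⟩
  refine ⟨r, fun w hw => ?_, hr⟩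
  have h1 : Below Ch x w := Relation.ReflTransGen.tail hr hw
  have h2 := hρ _ _ hw
  exact absurd (hmax h1 h2.le) (not_le.2 h2)

/-- Every edge is a bridge. Deleting the edge from u to its parent leaves an orientation in which u
is a root, and a walk from u to its former parent would have to leave the descendants of u. -/
theorem isAcyclic : G.IsAcyclic := by
  obtain ⟨ρ, hρ⟩ := hG.rank
  have key : ∀ u v, Ch u v → G.IsBridge s(u, v) := by
    intro u v huv
    rw [SimpleGraph.isBridge_iff]
    intro hreach
    have hG' : Orientation (G \ SimpleGraph.fromEdgeSet {s(u, v)})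
        (fun x y => Ch x y ∧ ¬ (x = u ∧ y = v)) := by
      refine ⟨fun x y => ?_, fun x y z h1 h2 => hG.unique x y z h1.1 h2.1, ρ,
        fun x y h => hρ x y h.1⟩
      rw [SimpleGraph.sdiff_adj, hG.adj_iff, SimpleGraph.fromEdgeSet_adj, Set.mem_singleton_iff,
        Sym2.eq_iff]
      have h1 : Ch x y → Ch y x → False := fun h1 h2 => absurd (hρ _ _ h1) (not_lt.2 (hρ _ _ h2).le)
      have h2 : Ch x y → x ≠ y := by
        rintro h1 rfl
        exact absurd (hρ _ _ h1) (lt_irrefl _)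
      have h3 : Ch y x → x ≠ y := by
        rintro h1 rfl
        exact absurd (hρ _ _ h1) (lt_irrefl _)
      have h4 : x = v → y = u → Ch x y → False := by
        rintro rfl rfl h4
        exact h1 h4 huv
      have h5 : x = u → y = v → Ch y x → False := by
        rintro rfl rfl h4
        exact h1 huv h4
      tauto
    obtain ⟨p⟩ := hreach
    have hv : ¬ Below (fun x y => Ch x y ∧ ¬ (x = u ∧ y = v)) v u := by
      intro h
      have h1 := hρ _ _ huv
      rcases Below.le_rank (fun x y h => hρ x y h.1) h with h2 | h2
      · subst h2
        exact lt_irrefl _ h1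
      · omega
    obtain ⟨w, ⟨h1, h2⟩, -⟩ := hG'.exit p Relation.ReflTransGen.refl hv
    exact h2 ⟨rfl, hG.unique _ _ _ h1 huv⟩
  rw [SimpleGraph.isAcyclic_iff_forall_adj_isBridge]
  intro u v h
  rcases (hG.adj_iff u v).1 h with h | h
  · exact key u v h
  · rw [Sym2.eq_swap]
    exact key v u h

theorem wellFounded : WellFounded Ch := by
  obtain ⟨ρ, hρ⟩ := hG.rank
  exact Subrelation.wf (fun {u v} h => hρ u v h) (InvImage.wf ρ wellFounded_lt)

/-- An orientation is determined by its roots. -/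
theorem eq_of_roots [Finite V] {Ch' : V → V → Prop} (hG' : Orientation G Ch')
    (hroots : ∀ v, (∃ w, Ch' v w) → ∃ w, Ch v w) {u v : V} (h : Ch' u v) : Ch u v := by
  have hwf : WellFounded (fun u v : V => Ch v u) := by
    obtain ⟨ρ, hρ⟩ := hG.rank
    obtain ⟨M, hM⟩ : ∃ M, ∀ v, ρ v ≤ M := by
      obtain ⟨M, hM⟩ := (Set.finite_range ρ).bddAbove
      exact ⟨M, fun v => hM ⟨v, rfl⟩⟩
    refine Subrelation.wf (fun {u v} h => ?_) (InvImage.wf (fun v => M - ρ v) wellFounded_lt)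
    have h1 := hρ _ _ h
    have h2 := hM u
    change M - ρ u < M - ρ v
    omega
  -- A reversed edge at u propagates upwards: u is not a root for Ch', hence has a Ch-parent w, and
  -- as v is already its Ch'-parent, the edge to w is reversed as well. Ranks bound the ascent.
  have key : ∀ v u, Ch v u → Ch' u v → False := by
    intro v u
    induction u using hwf.induction generalizing v with
    | _ u ih =>
      intro h1 h2
      obtain ⟨w, hw⟩ := hroots u ⟨v, h2⟩
      rcases (hG'.adj_iff u w).1 (hG.adj hw) with h3 | h3
      · rw [← hG'.unique _ _ _ h2 h3] at hw
        exact hwf.asymmetric _ _ hw h1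
      · exact ih w hw u hw h3
  rcases (hG.adj_iff u v).1 (hG'.adj h) with h1 | h1
  · exact h1
  · exact (key v u h1 h).elim

end Orientation

/-- A choice of roots in the components of an acyclic graph gives an orientation. -/
theorem exists_orientation [Finite V] (hG : G.IsAcyclic) (rt : V → V)
    (hrt : ∀ v, G.Reachable (rt v) v) (hadj : ∀ u v, G.Adj u v → rt u = rt v) :
    ∃ Ch : V → V → Prop, Orientation G Ch ∧ ∀ v, (∃ w, Ch v w) ↔ rt v ≠ v := by
  -- The parent is the neighbour one step closer to the root. In an acyclic graph adjacent distances
  -- differ by exactly one, and the unique path from the root makes the parent unique.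
  have hor : Orientation G (fun u v => G.Adj u v ∧ G.dist (rt u) u = G.dist (rt v) v + 1) := by
    refine ⟨fun u v => ?_, fun u v w h1 h2 => ?_, ?_⟩
    · constructor
      · intro h
        have h1 := hG.dist_eq_dist_add_one_of_adj_of_reachable (rt u) h (hrt u)
        rw [hadj u v h] at h1 ⊢
        rcases h1 with h1 | h1
        · exact Or.inl ⟨h, h1⟩
        · exact Or.inr ⟨h.symm, h1⟩
      · rintro (h | h)
        · exact h.1
        · exact h.1.symm
    · have key : ∀ v, G.Adj u v → G.dist (rt u) u = G.dist (rt v) v + 1 →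
          ∃ p : G.Path (rt u) u, p.1.penultimate = v := by
        intro v h h1
        rw [← hadj u v h] at h1
        have hr : G.Reachable (rt u) v := hadj u v h ▸ hrt v
        obtain ⟨p, hp⟩ := hr.exists_walk_length_eq_dist
        refine ⟨⟨p.concat h.symm, ?_⟩, by simp⟩
        apply SimpleGraph.Walk.isPath_of_length_eq_dist
        rw [SimpleGraph.Walk.length_concat, hp, h1]
      obtain ⟨p, hp⟩ := key v h1.1 h1.2
      obtain ⟨p', hp'⟩ := key w h2.1 h2.2
      rw [← hp, ← hp', (hG.subsingleton_path (rt u) u).elim p p']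
    · obtain ⟨M, hM⟩ := (Set.finite_range fun v => G.dist (rt v) v).bddAbove
      refine ⟨fun v => M - G.dist (rt v) v, fun u v h => ?_⟩
      have h1 : G.dist (rt u) u ≤ M := hM ⟨u, rfl⟩
      have h2 := h.2
      change M - G.dist (rt u) u < M - G.dist (rt v) v
      omega
  refine ⟨_, hor, fun v => ⟨?_, fun h => ?_⟩⟩
  · rintro ⟨w, -, h⟩ h1
    rw [h1, SimpleGraph.dist_self] at h
    omega
  · by_contra! hv
    have h1 := hor.below_of_reachable (fun w h => hv w h.1 h.2) (hrt v).symm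
      Relation.ReflTransGen.refl
    rcases Relation.ReflTransGen.cases_head h1 with h2 | ⟨w, h2, -⟩
    · exact h h2
    · have h3 := h2.2
      have h4 : rt (rt v) = rt v := by
        obtain ⟨p⟩ := hrt v
        have h5 : ∀ {a b : V}, G.Walk a b → rt a = rt b := by
          intro a b p
          induction p with
          | nil => rfl
          | cons h _ ih => exact (hadj _ _ h).trans ih
        exact h5 p
      rw [h4, SimpleGraph.dist_self] at h3
      omega

end Orientation

end MomAmp

namespace MomAmp

open Term

/-! ### Subtrees -/

namespace Term

/-- `t` is attached to the root of `p`. -/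
def Child (t p : Term) : Prop := ∃ h cs, p = node h cs ∧ t ∈ cs

/-- `t` is a subtree of `s`. -/
def Sub (t s : Term) : Prop := Relation.ReflTransGen Child t s

theorem Sub.refl (t : Term) : Sub t t := Relation.ReflTransGen.refl

theorem child_node {t : Term} {h : ℕ} {cs : List Term} : Child t (node h cs) ↔ t ∈ cs := by
  constructor
  · rintro ⟨h', cs', h1, h2⟩
    cases h1
    exact h2
  · exact fun h1 => ⟨h, cs, rfl, h1⟩

theorem not_child_leaf {t : Term} {i : ℕ} : ¬ Child t (leaf i) := by
  rintro ⟨h, cs, h1, -⟩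
  cases h1

theorem sub_leaf {t : Term} {i : ℕ} : Sub t (leaf i) ↔ t = leaf i := by
  constructor
  · intro h
    rcases Relation.ReflTransGen.cases_tail h with h | ⟨u, -, h⟩
    · exact h.symm
    · exact (not_child_leaf h).elim
  · rintro rfl
    exact Sub.refl _

theorem sub_node {t : Term} {h : ℕ} {cs : List Term} :
    Sub t (node h cs) ↔ t = node h cs ∨ ∃ u ∈ cs, Sub t u := by
  constructor
  · intro h1
    rcases Relation.ReflTransGen.cases_tail h1 with h2 | ⟨u, h2, h3⟩
    · exact Or.inl h2.symm
    · exact Or.inr ⟨u, child_node.1 h3, h2⟩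
  · rintro (rfl | ⟨u, h1, h2⟩)
    · exact Sub.refl _
    · exact Relation.ReflTransGen.tail h2 (child_node.2 h1)

theorem mem_nodes {t s : Term} : t ∈ nodes s ↔ Sub t s ∧ ∃ h cs, t = node h cs := by
  induction s using Term.induction with
  | hleaf i =>
    simp only [nodes_leaf, List.not_mem_nil, false_iff, sub_leaf]
    rintro ⟨rfl, h, cs, h1⟩
    cases h1
  | hnode h cs ih =>
    rw [nodes_node, List.mem_cons, List.mem_flatten, sub_node]
    simp only [List.mem_map, exists_exists_and_eq_and]
    constructor
    · rintro (rfl | ⟨u, h1, h2⟩)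
      · exact ⟨Or.inl rfl, h, cs, rfl⟩
      · exact ⟨Or.inr ⟨u, h1, ((ih u h1).1 h2).1⟩, ((ih u h1).1 h2).2⟩
    · rintro ⟨rfl | ⟨u, h1, h2⟩, h3⟩
      · exact Or.inl rfl
      · exact Or.inr ⟨u, h1, (ih u h1).2 ⟨h2, h3⟩⟩

theorem mem_leaves {i : ℕ} {s : Term} : i ∈ leaves s ↔ Sub (leaf i) s := by
  induction s using Term.induction with
  | hleaf j => simp [sub_leaf]
  | hnode h cs ih =>
    rw [leaves_node, List.mem_flatten, sub_node]
    simp only [List.mem_map, exists_exists_and_eq_and, reduceCtorEq, false_or]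
    exact exists_congr fun u => and_congr_right (ih u)

theorem Child.leaves_infix {t p : Term} (h : Child t p) : leaves t <:+: leaves p := by
  obtain ⟨h, cs, rfl, ht⟩ := h
  obtain ⟨l1, l2, rfl⟩ := List.append_of_mem ht
  exact ⟨(l1.map leaves).flatten, (l2.map leaves).flatten, by simp [leaves_node]⟩

theorem Sub.leaves_infix {t s : Term} (h : Sub t s) : leaves t <:+: leaves s := by
  induction h with
  | refl => exact List.infix_rfl
  | tail _ h ih => exact ih.trans h.leaves_infix

theorem Child.good {t p : Term} (h : Child t p) (hp : Good p) : Good t := by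
  obtain ⟨h, cs, rfl, ht⟩ := h
  cases hp with
  | node _ _ _ _ _ hgood => exact hgood t ht

theorem Sub.good {t s : Term} (h : Sub t s) (hs : Good s) : Good t := by
  induction h using Relation.ReflTransGen.head_induction_on with
  | refl => exact hs
  | head h1 _ ih => exact h1.good ih

theorem Child.length_nodes_lt {t p : Term} (h : Child t p) :
    (nodes t).length < (nodes p).length := by
  obtain ⟨h, cs, rfl, ht⟩ := h
  obtain ⟨l1, l2, rfl⟩ := List.append_of_mem ht
  rw [nodes_node]
  simp
  omega

theorem Sub.length_nodes_le {t s : Term} (h : Sub t s) :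
    t = s ∨ (nodes t).length < (nodes s).length := by
  induction h with
  | refl => exact Or.inl rfl
  | tail _ h ih =>
    right
    rcases ih with rfl | ih
    · exact h.length_nodes_lt
    · exact ih.trans h.length_nodes_lt

/-- Distinct subtrees attached to the same vertex have no common leaf. -/
theorem eq_of_mem_leaves {h : ℕ} {cs : List Term} (hnd : (leaves (node h cs)).Nodup) {t u : Term}
    (ht : t ∈ cs) (hu : u ∈ cs) {i : ℕ} (hit : i ∈ leaves t) (hiu : i ∈ leaves u) : t = u := by
  by_contra hne
  rw [leaves_node, List.nodup_flatten] at hnd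
  have : Std.Symm fun a b => a ≠ b → (leaves a).Disjoint (leaves b) :=
    ⟨fun a b h h' => (h h'.symm).symm⟩
  have h1 : cs.Pairwise fun a b => a ≠ b → (leaves a).Disjoint (leaves b) :=
    (List.pairwise_map.1 hnd.2).imp fun {a b} h (_ : a ≠ b) => h
  exact h1.forall_of_forall (fun _ _ h => absurd rfl h) ht hu hne hit hiu

theorem nodup_children {h : ℕ} {cs : List Term} (hg : Good (node h cs))
    (hnd : (leaves (node h cs)).Nodup) : cs.Nodup := by
  rw [leaves_node, List.nodup_flatten] at hnd
  refine (List.pairwise_map.1 hnd.2).imp_of_mem fun {a b} ha _ hab => ?_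
  rintro rfl
  obtain ⟨i, hi⟩ := List.exists_mem_of_ne_nil _ (Child.good (child_node.2 ha) hg).leaves_ne_nil
  exact hab hi hi

theorem Sub.mem_leaves {t s : Term} (h : Sub t s) {i : ℕ} (hi : i ∈ leaves t) : i ∈ leaves s :=
  h.leaves_infix.subset hi

/-- Every subtree is attached to at most one vertex. -/
theorem eq_of_child {s t p p' : Term} (hs : Good s) (hnd : (leaves s).Nodup) (hp : Sub p s)
    (hp' : Sub p' s) (h : Child t p) (h' : Child t p') : p = p' := by
  induction s using Term.induction generalizing p p' with
  | hleaf i =>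
    rw [sub_leaf] at hp
    subst hp
    exact (not_child_leaf h).elim
  | hnode k cs ih =>
    -- A leaf of t locates the branch u that contains t, since distinct branches have no common
    -- leaf.
    have hmem : ∀ {u p : Term}, u ∈ cs → Sub p u → Child t p →
        ∃ i, i ∈ leaves t ∧ i ∈ leaves u := by
      intro u p hu hp h
      have h1 : Sub t u := Relation.ReflTransGen.head h hp
      obtain ⟨i, hi⟩ := List.exists_mem_of_ne_nil _
        (h1.good (Child.good (child_node.2 hu) hs)).leaves_ne_nil
      exact ⟨i, hi, h1.mem_leaves hi⟩
    have key : ∀ {u p : Term}, u ∈ cs → Sub p u → Child t p → t ∉ cs := by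
      intro u p hu hp h ht
      obtain ⟨i, h1, h2⟩ := hmem hu hp h
      have h3 := eq_of_mem_leaves hnd ht hu h1 h2
      subst h3
      have h4 := h.length_nodes_lt
      rcases hp.length_nodes_le with rfl | h5 <;> omega
    rw [sub_node] at hp hp'
    rcases hp with rfl | ⟨u, h1, h2⟩ <;> rcases hp' with rfl | ⟨u', h1', h2'⟩
    · rfl
    · exact (key h1' h2' h' (child_node.1 h)).elim
    · exact (key h1 h2 h (child_node.1 h')).elim
    · obtain ⟨i, h3, h4⟩ := hmem h1 h2 h
      have h5 := Sub.mem_leaves (Relation.ReflTransGen.head h' h2') h3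
      have h6 := eq_of_mem_leaves hnd h1 h1' h4 h5
      subst h6
      have h7 := child_node (h := k).2 h1
      exact ih u h1 (h7.good hs) (hnd.sublist h7.leaves_infix.sublist) h2 h2' h h'

theorem nodup_nodes {s : Term} (hs : Good s) (hnd : (leaves s).Nodup) : (nodes s).Nodup := by
  induction s using Term.induction with
  | hleaf i => simp
  | hnode k cs ih =>
    rw [nodes_node, List.nodup_cons, List.nodup_flatten, List.pairwise_map]
    refine ⟨fun h => ?_, fun l hl => ?_, ?_⟩
    · rw [List.mem_flatten] at h
      simp only [List.mem_map, exists_exists_and_eq_and] at h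
      obtain ⟨u, h1, h2⟩ := h
      have h3 := (mem_nodes.1 h2).1.length_nodes_le
      have h4 := (child_node (h := k).2 h1).length_nodes_lt
      rcases h3 with rfl | h3 <;> omega
    · obtain ⟨u, hu, rfl⟩ := List.mem_map.1 hl
      have h7 := child_node (h := k).2 hu
      exact ih u hu (h7.good hs) (hnd.sublist h7.leaves_infix.sublist)
    · refine (nodup_children hs hnd).imp_of_mem fun {a b} ha hb hab t h1 h2 => hab ?_
      have h3 := (mem_nodes.1 h1).1
      have h4 := (mem_nodes.1 h2).1
      obtain ⟨i, hi⟩ := List.exists_mem_of_ne_nil _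
        (h3.good (Child.good (child_node.2 ha) hs)).leaves_ne_nil
      exact eq_of_mem_leaves hnd ha hb (h3.mem_leaves hi) (h4.mem_leaves hi)

end Term

end MomAmp

namespace MomAmp

open Term

/-! ### The graph of an encoded forest -/

/-- The vertex at the root of the subtree `t` of the component with smallest leaf `r`. -/
def place (r : ℕ) : Term → ℕ ⊕ ℕ × Term
  | leaf i => Sum.inl i
  | node h cs => Sum.inr (r, node h cs)

/-- `y` is the parent of `x` in the forest encoded by `Φ`. -/
def IsParent (Φ : Finset (ℕ × Term)) (x y : ℕ ⊕ ℕ × Term) : Prop :=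
  ∃ r s t, (r, s) ∈ Φ ∧ Sub t s ∧ x = place r t ∧
    (t = s ∧ y = Sum.inl r ∨ ∃ p, Sub p s ∧ Child t p ∧ y = Sum.inr (r, p))

theorem place_eq_inl {r i : ℕ} {t : Term} : place r t = Sum.inl i ↔ t = leaf i := by
  cases t <;> simp [place]

theorem place_eq_inr {r r' : ℕ} {t p : Term} :
    place r t = Sum.inr (r', p) ↔ r = r' ∧ t = p ∧ ∃ h cs, t = node h cs := by
  cases t <;> simp [place]

theorem Term.Child.place_eq {t p : Term} (h : Child t p) (r : ℕ) : place r p = Sum.inr (r, p) := by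
  obtain ⟨h, cs, rfl, -⟩ := h
  rfl

namespace GoodComp

variable {K : ℕ × Term}

theorem eq_of_child (hK : GoodComp K) (hnd : (block K).Nodup) {t p p' : Term} (hp : Sub p K.2)
    (hp' : Sub p' K.2) (h : Child t p) (h' : Child t p') : p = p' := by
  rcases hK with hK | hK
  · have h1 : p = node 0 [] ∨ p = node 1 [] := by
      exact hK.imp (fun hK => by simpa [hK, sub_node] using hp)
        fun hK => by simpa [hK, sub_node] using hp
    rcases h1 with rfl | rfl <;> simp [child_node] at h
  · exact Term.eq_of_child hK (List.nodup_cons.1 hnd).2 hp hp' h h'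

theorem nodup_nodes (hK : GoodComp K) (hnd : (block K).Nodup) : (nodes K.2).Nodup := by
  rcases hK with (hK | hK) | hK
  · rw [hK, nodes_node]
    simp
  · rw [hK, nodes_node]
    simp
  · exact Term.nodup_nodes hK (List.nodup_cons.1 hnd).2

theorem nodup_children (hK : GoodComp K) (hnd : (block K).Nodup) {h : ℕ} {cs : List Term}
    (hs : Sub (node h cs) K.2) : cs.Nodup := by
  rcases hK with hK | hK
  · have h1 : node h cs = node 0 [] ∨ node h cs = node 1 [] := by
      exact hK.imp (fun hK => by simpa [hK, sub_node] using hs)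
        fun hK => by simpa [hK, sub_node] using hs
    rcases h1 with h1 | h1 <;> cases h1 <;> simp
  · exact Term.nodup_children (hs.good hK)
      ((List.nodup_cons.1 hnd).2.sublist hs.leaves_infix.sublist)

end GoodComp

namespace IsForest

variable {S : Set ℕ} {Φ : Finset (ℕ × Term)} (hΦ : IsForest S Φ)
include hΦ

theorem nodup_block {K : ℕ × Term} (hK : K ∈ Φ) : (block K).Nodup :=
  (hΦ.sorted K hK).imp fun h => h.ne

theorem eq_of_fst {r : ℕ} {s s' : Term} (h : (r, s) ∈ Φ) (h' : (r, s') ∈ Φ) : s = s' := by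
  have h1 := hΦ.disjoint _ h _ h' r (fst_mem_block _) (fst_mem_block _)
  exact (Prod.mk.inj h1).2

theorem notMem_leaves {r r' : ℕ} {s s' : Term} (h : (r, s) ∈ Φ) (h' : (r', s') ∈ Φ) :
    r ∉ leaves s' := by
  intro h1
  have h2 := hΦ.disjoint _ h _ h' r (fst_mem_block _) (List.mem_cons_of_mem _ h1)
  obtain ⟨rfl, rfl⟩ := Prod.mk.inj h2
  exact (List.nodup_cons.1 (hΦ.nodup_block h)).1 h1

/-- A leaf label lies in only one component, and an internal vertex carries the smallest leaf of its
component as a tag. -/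
theorem place_inj {r r' : ℕ} {s s' t t' : Term} (h : (r, s) ∈ Φ) (h' : (r', s') ∈ Φ)
    (ht : Sub t s) (ht' : Sub t' s') (heq : place r t = place r' t') :
    r = r' ∧ s = s' ∧ t = t' := by
  cases t with
  | leaf i =>
    have h1 : t' = leaf i := place_eq_inl.1 heq.symm
    subst h1
    have h2 := hΦ.disjoint _ h _ h' i (List.mem_cons_of_mem _ (mem_leaves.2 ht))
      (List.mem_cons_of_mem _ (mem_leaves.2 ht'))
    exact ⟨(Prod.mk.inj h2).1, (Prod.mk.inj h2).2, rfl⟩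
  | node k cs =>
    obtain ⟨rfl, rfl, -⟩ := place_eq_inr.1 heq.symm
    exact ⟨rfl, hΦ.eq_of_fst h h', rfl⟩

theorem isParent_unique {x y y' : ℕ ⊕ ℕ × Term} (h : IsParent Φ x y) (h' : IsParent Φ x y') :
    y = y' := by
  obtain ⟨r, s, t, h1, h2, rfl, h3⟩ := h
  obtain ⟨r', s', t', h1', h2', h4, h3'⟩ := h'
  obtain ⟨rfl, rfl, rfl⟩ := hΦ.place_inj h1 h1' h2 h2' h4
  have key : ∀ p, Sub p s → Child t p → t ≠ s := by
    rintro p h5 h6 rfl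
    have h7 := h6.length_nodes_lt
    rcases h5.length_nodes_le with rfl | h5 <;> omega
  rcases h3 with ⟨h3, rfl⟩ | ⟨p, h3, h5, rfl⟩ <;> rcases h3' with ⟨h3', rfl⟩ | ⟨p', h3', h5', rfl⟩
  · rfl
  · exact (key p' h3' h5' h3).elim
  · exact (key p h3 h5 h3').elim
  · rw [(hΦ.good _ h1).eq_of_child (hΦ.nodup_block h1) h3 h3' h5 h5']

theorem not_isParent_inl {r : ℕ} {s : Term} (h : (r, s) ∈ Φ) (y : ℕ ⊕ ℕ × Term) :
    ¬ IsParent Φ (Sum.inl r) y := by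
  rintro ⟨r', s', t, h1, h2, h3, -⟩
  obtain rfl := place_eq_inl.1 h3.symm
  exact hΦ.notMem_leaves h h1 (mem_leaves.2 h2)

end IsForest

theorem isParent_place {Φ : Finset (ℕ × Term)} {r : ℕ} {s t : Term} (hs : (r, s) ∈ Φ)
    (ht : Sub t s) : ∃ y, IsParent Φ (place r t) y := by
  rcases Relation.ReflTransGen.cases_head ht with rfl | ⟨p, h1, h2⟩
  · exact ⟨_, r, t, t, hs, ht, rfl, Or.inl ⟨rfl, rfl⟩⟩
  · exact ⟨_, r, s, t, hs, ht, rfl, Or.inr ⟨p, h2, h1, rfl⟩⟩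

/-- The encoding of a vertex, determined by the encoding of the internal vertices. -/
def vertexCode {n m : ℕ} (c : Fin m → ℕ × Term) : Fin n ⊕ Fin m → ℕ ⊕ ℕ × Term :=
  Sum.map Fin.val c

/-- The graph `G` is the graph of the forest encoded by `Φ`. -/
structure IsGraphCoding {n m : ℕ} (G : SimpleGraph (Fin n ⊕ Fin m)) (Φ : Finset (ℕ × Term))
    (c : Fin m → ℕ × Term) : Prop where
  inj : Function.Injective c
  range : ∀ r t, (∃ w, c w = (r, t)) ↔ ∃ s, (r, s) ∈ Φ ∧ t ∈ nodes s
  adj : ∀ u v, G.Adj u v ↔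
    IsParent Φ (vertexCode c u) (vertexCode c v) ∨ IsParent Φ (vertexCode c v) (vertexCode c u)

namespace IsGraphCoding

variable {n m : ℕ} {G : SimpleGraph (Fin n ⊕ Fin m)} {Φ : Finset (ℕ × Term)}
  {c : Fin m → ℕ × Term} (hΦ : IsForest {i | i < n} Φ) (hc : IsGraphCoding G Φ c)

include hc in
theorem vertexCode_injective : Function.Injective (vertexCode (n := n) c) :=
  Function.Injective.sumMap Fin.val_injective hc.inj

include hΦ in
theorem lt_of_mem_leaves {r i : ℕ} {s : Term} (hs : (r, s) ∈ Φ) (hi : i ∈ leaves s) : i < n :=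
  hΦ.mem_of_mem hs (List.mem_cons_of_mem _ hi)

include hΦ hc in
theorem exists_place {r : ℕ} {s t : Term} (hs : (r, s) ∈ Φ) (ht : Sub t s) :
    ∃ v : Fin n ⊕ Fin m, vertexCode c v = place r t := by
  cases t with
  | leaf i => exact ⟨Sum.inl ⟨i, lt_of_mem_leaves hΦ hs (mem_leaves.2 ht)⟩, rfl⟩
  | node h cs =>
    obtain ⟨w, hw⟩ := (hc.range r (node h cs)).2 ⟨s, hs, mem_nodes.2 ⟨ht, h, cs, rfl⟩⟩
    exact ⟨Sum.inr w, by simp [vertexCode, place, hw]⟩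

include hΦ in
theorem exists_root {r : ℕ} {s : Term} (hs : (r, s) ∈ Φ) :
    ∃ v : Fin n ⊕ Fin m, vertexCode c v = Sum.inl r := ⟨Sum.inl ⟨r, hΦ.fst_mem hs⟩, rfl⟩

include hc in
theorem exists_eq_node (w : Fin m) : ∃ r s h cs, (r, s) ∈ Φ ∧ Sub (node h cs) s ∧
    c w = (r, node h cs) := by
  obtain ⟨s, h1, h2⟩ := (hc.range (c w).1 (c w).2).1 ⟨w, rfl⟩
  obtain ⟨h2, h, cs, h3⟩ := mem_nodes.1 h2
  exact ⟨(c w).1, s, h, cs, h1, h3 ▸ h2, by rw [← h3]⟩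

include hΦ hc in
theorem eq_root_or_place (v : Fin n ⊕ Fin m) : ∃ r s, (r, s) ∈ Φ ∧
    (vertexCode c v = Sum.inl r ∨ ∃ t, Sub t s ∧ vertexCode c v = place r t) := by
  rcases v with i | w
  · obtain ⟨K, hK, hi⟩ := (hΦ.cover i).1 i.2
    refine ⟨K.1, K.2, hK, ?_⟩
    rcases List.mem_cons.1 hi with hi | hi
    · exact Or.inl (congrArg Sum.inl hi)
    · exact Or.inr ⟨leaf i, mem_leaves.1 hi, rfl⟩
  · obtain ⟨r, s, h, cs, h1, h2, h3⟩ := hc.exists_eq_node w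
    exact ⟨r, s, h1, Or.inr ⟨_, h2, by simp [vertexCode, place, h3]⟩⟩

include hΦ hc in
theorem orientation : Orientation G fun u v => IsParent Φ (vertexCode c u) (vertexCode c v) where
  adj_iff := hc.adj
  unique u v w h h' := hc.vertexCode_injective (hΦ.isParent_unique h h')
  rank := by
    classical
    -- The rank counts the internal vertices of the subtree: non-root boundary vertices get 0, and
    -- roots a value above all others.
    refine ⟨fun v => match vertexCode c v with
      | Sum.inl i => if ∃ s, (i, s) ∈ Φ then Φ.sup (fun K => (nodes K.2).length) + 1 else 0
      | Sum.inr K => (nodes K.2).length, ?_⟩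
    rintro u v ⟨r, s, t, h1, h2, h3, h4⟩
    have h5 : (match vertexCode c u with
      | Sum.inl i => if ∃ s, (i, s) ∈ Φ then Φ.sup (fun K => (nodes K.2).length) + 1 else 0
      | Sum.inr K => (nodes K.2).length) = (nodes t).length := by
      rw [h3]
      cases t with
      | leaf i =>
        simp only [place, nodes_leaf, List.length_nil]
        rw [if_neg]
        rintro ⟨s', h5⟩
        exact hΦ.notMem_leaves h5 h1 (mem_leaves.2 h2)
      | node h cs => rfl
    beta_reduce
    rw [h5]
    rcases h4 with ⟨rfl, h4⟩ | ⟨p, h4, h6, h7⟩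
    · rw [h4]
      dsimp only
      rw [if_pos ⟨t, h1⟩]
      exact Nat.lt_succ_of_le (Finset.le_sup (f := fun K : ℕ × Term => (nodes K.2).length) h1)
    · rw [h7]
      exact h6.length_nodes_lt

include hΦ hc in
theorem exists_parent_iff (v : Fin n ⊕ Fin m) :
    (∃ w : Fin n ⊕ Fin m, IsParent Φ (vertexCode c v) (vertexCode c w)) ↔
      ¬ ∃ r s, (r, s) ∈ Φ ∧ vertexCode c v = Sum.inl r := by
  constructor
  · rintro ⟨w, h⟩ ⟨r, s, h1, h2⟩
    rw [h2] at h
    exact hΦ.not_isParent_inl h1 _ h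
  · intro h
    obtain ⟨r, s, h1, h2 | ⟨t, h2, h3⟩⟩ := eq_root_or_place hΦ hc v
    · exact (h ⟨r, s, h1, h2⟩).elim
    · rw [h3]
      rcases Relation.ReflTransGen.cases_head h2 with rfl | ⟨p, h4, h5⟩
      · obtain ⟨w, hw⟩ := exists_root (m := m) (c := c) hΦ h1
        exact ⟨w, r, t, t, h1, h2, rfl, Or.inl ⟨rfl, hw⟩⟩
      · obtain ⟨w, hw⟩ := exists_place hΦ hc h1 h5
        exact ⟨w, r, s, t, h1, h2, rfl, Or.inr ⟨p, h5, h4, by rw [hw, h4.place_eq]⟩⟩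

include hΦ hc in
/-- The descendants of the root of a subtree. -/
theorem below_place_iff {r : ℕ} {s t : Term} (hs : (r, s) ∈ Φ) (ht : Sub t s)
    {u v : Fin n ⊕ Fin m} (hv : vertexCode c v = place r t) :
    Below (fun u v => IsParent Φ (vertexCode c u) (vertexCode c v)) u v ↔
      ∃ t', Sub t' t ∧ vertexCode c u = place r t' := by
  constructor
  · intro h
    induction h using Relation.ReflTransGen.head_induction_on with
    | refl => exact ⟨t, Sub.refl t, hv⟩
    | @head a b h1 _ ih =>
      obtain ⟨t', h3, h4⟩ := ih
      obtain ⟨r1, s1, t1, h5, h6, h7, h8⟩ := h1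
      rcases h8 with ⟨rfl, h8⟩ | ⟨p, h8, h9, h10⟩
      · rw [h4, place_eq_inl] at h8
        subst h8
        exact (hΦ.notMem_leaves h5 hs (mem_leaves.2 (h3.trans ht))).elim
      · rw [h4, place_eq_inr] at h10
        obtain ⟨rfl, rfl, -⟩ := h10
        exact ⟨t1, Relation.ReflTransGen.head h9 h3, h7⟩
  · rintro ⟨t', h1, h2⟩
    induction h1 using Relation.ReflTransGen.head_induction_on generalizing u with
    | refl =>
      rw [← hv] at h2
      rw [hc.vertexCode_injective h2]
      exact Relation.ReflTransGen.refl
    | @head a b h3 h4 ih =>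
      obtain ⟨w, hw⟩ := exists_place hΦ hc hs (Relation.ReflTransGen.trans h4 ht)
      refine Relation.ReflTransGen.head ?_ (ih hw)
      exact ⟨r, s, a, hs, Relation.ReflTransGen.head h3 (Relation.ReflTransGen.trans h4 ht), h2,
        Or.inr ⟨b, Relation.ReflTransGen.trans h4 ht, h3, by rw [hw, h3.place_eq]⟩⟩

include hΦ hc in
/-- The vertices of a component. -/
theorem below_root_iff {r : ℕ} {s : Term} (hs : (r, s) ∈ Φ)
    {u v : Fin n ⊕ Fin m} (hv : vertexCode c v = Sum.inl r) :
    Below (fun u v => IsParent Φ (vertexCode c u) (vertexCode c v)) u v ↔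
      vertexCode c u = Sum.inl r ∨ ∃ t, Sub t s ∧ vertexCode c u = place r t := by
  obtain ⟨v', hv'⟩ := exists_place hΦ hc hs (Sub.refl s)
  rw [← below_place_iff hΦ hc hs (Sub.refl s) hv']
  constructor
  · intro h
    rcases Relation.ReflTransGen.cases_tail h with rfl | ⟨w, h1, h2⟩
    · exact Or.inl hv
    · right
      obtain ⟨r1, s1, t1, h3, h4, h5, ⟨rfl, h6⟩ | ⟨p, h6, h7, h8⟩⟩ := h2
      · rw [hv] at h6
        cases h6
        obtain rfl := hΦ.eq_of_fst hs h3
        rw [← hv'] at h5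
        rwa [hc.vertexCode_injective h5] at h1
      · rw [hv] at h8
        cases h8
  · rintro (h | h)
    · rw [← hv] at h
      rw [hc.vertexCode_injective h]
      exact Relation.ReflTransGen.refl
    · exact Relation.ReflTransGen.tail h ⟨r, s, s, hs, Sub.refl s, hv', Or.inl ⟨rfl, hv⟩⟩

end IsGraphCoding

end MomAmp

namespace MomAmp

namespace Orientation

/-! ### Planarity of rooted forests -/

variable {V : Type*} [Finite V] {G : SimpleGraph V} {Ch : V → V → Prop} (hG : Orientation G Ch)
include hG

omit [Finite V] in
theorem not_symm {u v : V} (h : Ch u v) : ¬ Ch v u := by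
  obtain ⟨ρ, hρ⟩ := hG.rank
  intro h'
  exact absurd (hρ _ _ h) (not_lt.2 (hρ _ _ h').le)

theorem ncard_neighborSet {v w : V} (h : Ch v w) :
    (G.neighborSet v).ncard = {u | Ch u v}.ncard + 1 := by
  have h1 : G.neighborSet v = insert w {u | Ch u v} := by
    ext u
    rw [SimpleGraph.mem_neighborSet, hG.adj_iff, Set.mem_insert_iff, Set.mem_ofPred_eq]
    refine or_congr ⟨fun h' => hG.unique _ _ _ h' h, ?_⟩ Iff.rfl
    rintro rfl
    exact h
  rw [h1, Set.ncard_insert_of_notMem (s := {u | Ch u v}) (hG.not_symm h)]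

omit [Finite V] in
theorem neighborSet_root {v : V} (h : ∀ w, ¬ Ch v w) : G.neighborSet v = {u | Ch u v} := by
  ext u
  rw [SimpleGraph.mem_neighborSet, hG.adj_iff, Set.mem_ofPred_eq]
  exact or_iff_right (h u)

theorem exists_minimal_ancestor {ρ : V → ℕ} {x y : V} (h : G.Reachable x y) :
    ∃ u, Below Ch x u ∧ Below Ch y u ∧ ∀ v, Below Ch x v → Below Ch y v → ρ u ≤ ρ v := by
  obtain ⟨r, hr, hx⟩ := hG.exists_root x
  have hy := hG.below_of_reachable hr h hx
  obtain ⟨u, hu, hmin⟩ := Set.Finite.exists_minimalFor ρ {u | Below Ch x u ∧ Below Ch y u}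
    (Set.toFinite _) ⟨r, hx, hy⟩
  exact ⟨u, hu.1, hu.2, fun v h1 h2 => (le_total (ρ u) (ρ v)).elim id (hmin ⟨h1, h2⟩)⟩

variable {I : Type*} [LinearOrder I] (f : I → V)

/-- Let u and w be the lowest common ancestors of the ends of the two walks; each lies on its own
walk. If d is not below u, the second walk leaves the descendants of u through u. If a is not below
w, the first walk passes through w. Otherwise u and w are common ancestors of both pairs and
coincide. -/
theorem planar_of_convex
    (hconv : ∀ u a b c, a < b → b < c → Below Ch (f a) u → Below Ch (f c) u →
      G.Reachable (f a) (f b) → Below Ch (f b) u)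
    (hcross : ∀ a b c d, a < b → b < c → c < d → G.Reachable (f a) (f c) →
      G.Reachable (f b) (f d) → G.Reachable (f a) (f b))
    {a b c d : I} (hab : a < b) (hbc : b < c) (hcd : c < d) (p : G.Walk (f a) (f c))
    (p' : G.Walk (f b) (f d)) : ∃ u, u ∈ p.support ∧ u ∈ p'.support := by
  obtain ⟨ρ, hρ⟩ := hG.rank
  have hr := hcross a b c d hab hbc hcd ⟨p⟩ ⟨p'⟩
  obtain ⟨u, ha, hc, hu⟩ := hG.exists_minimal_ancestor (ρ := ρ) ⟨p⟩
  obtain ⟨w, hb, hd, hw⟩ := hG.exists_minimal_ancestor (ρ := ρ) ⟨p'⟩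
  have hup := hG.mem_support_of_minimal hρ ha hc hu p
  have hwp := hG.mem_support_of_minimal hρ hb hd hw p'
  by_cases hdu : Below Ch (f d) u
  · by_cases haw : Below Ch (f a) w
    · refine ⟨u, hup, ?_⟩
      have hcw := hconv w a c d (hab.trans hbc) hcd haw hd ⟨p⟩
      have hbu := hconv u a b c hab hbc ha hc hr
      have h1 := hu w haw hcw
      have h2 := hw u hbu hdu
      rcases hG.total ha haw with h3 | h3
      · rcases h3.le_rank hρ with rfl | h4
        · exact hwp
        · omega
      · rcases h3.le_rank hρ with rfl | h4
        · exact hwp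
        · omega
    · have hcw := hconv w b c d hbc hcd hb hd (hr.symm.trans ⟨p⟩)
      obtain ⟨z, -, h1, -⟩ := hG.exit p.reverse hcw haw
      exact ⟨w, by simpa using h1, hwp⟩
  · have hbu := hconv u a b c hab hbc ha hc hr
    obtain ⟨z, -, h1, -⟩ := hG.exit p' hbu hdu
    exact ⟨u, hup, h1⟩

-- If b were not below u, the walk from the smallest leaf r to b would, by planarity with r < a < b
-- < c, meet the walk from a up to u and down to c. The meeting point is above b and below u, a
-- contradiction.
omit [Finite V] in
theorem convex_of_planar
    (hplanar : ∀ a b c d, a < b → b < c → c < d → ∀ (p : G.Walk (f a) (f c))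
      (p' : G.Walk (f b) (f d)), ∃ u, u ∈ p.support ∧ u ∈ p'.support)
    {r : I} (hr : ∀ w, ¬ Ch (f r) w) (hmin : ∀ a, G.Reachable (f r) (f a) → r ≤ a)
    {u : V} {a b c : I} (hab : a < b) (hbc : b < c) (ha : Below Ch (f a) u)
    (hc : Below Ch (f c) u) (hra : G.Reachable (f r) (f a)) (hrb : G.Reachable (f r) (f b)) :
    Below Ch (f b) u := by
  have hrefl : Below Ch (f r) (f r) := Relation.ReflTransGen.refl
  have hbr := hG.below_of_reachable hr hrb hrefl
  by_contra hbu
  have hlt : r < a := by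
    refine lt_of_le_of_ne (hmin a hra) ?_
    rintro rfl
    rcases Relation.ReflTransGen.cases_head ha with h1 | ⟨w, h1, -⟩
    · exact hbu (h1 ▸ hbr)
    · exact hr w h1
  obtain ⟨p, hp⟩ := hG.exists_walk hbr
  obtain ⟨p1, hp1⟩ := hG.exists_walk ha
  obtain ⟨p2, hp2⟩ := hG.exists_walk hc
  obtain ⟨z, h1, h2⟩ := hplanar r a b c hlt hab hbc p.reverse (p1.append p2.reverse)
  rw [SimpleGraph.Walk.support_reverse, List.mem_reverse] at h1
  rw [SimpleGraph.Walk.mem_support_append_iff, SimpleGraph.Walk.support_reverse,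
    List.mem_reverse] at h2
  refine hbu (Relation.ReflTransGen.trans (hp z h1).1 ?_)
  exact h2.elim (fun h => (hp1 z h).2) fun h => (hp2 z h).2

end Orientation

end MomAmp

/-! ### Degrees, components and planarity of the encoded graph; realization of codes. -/

namespace MomAmp

open Term

/-- The helicity of the root. -/
def Term.rootHelicity : Term → ℕ
  | leaf _ => 0
  | node h _ => h

/-- The number of subtrees attached to the root. -/
def Term.arity : Term → ℕ
  | leaf _ => 0
  | node _ cs => cs.length

/-- The vertices of a component satisfy the conditions on degrees and helicities. -/
theorem GoodComp.sub_node {K : ℕ × Term} (hK : GoodComp K) {h : ℕ} {cs : List Term}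
    (hs : Sub (node h cs) K.2) : (cs = [] ∧ K.2 = node h cs ∧ (h = 0 ∨ h = 1)) ∨
      (2 ≤ cs.length ∧ 1 ≤ h ∧ h ≤ cs.length ∧ Good K.2) := by
  rcases hK with (hK | hK) | hK
  · left
    obtain ⟨rfl, rfl⟩ : h = 0 ∧ cs = [] := by simpa [hK, Term.sub_node] using hs
    exact ⟨rfl, hK, Or.inl rfl⟩
  · left
    obtain ⟨rfl, rfl⟩ : h = 1 ∧ cs = [] := by simpa [hK, Term.sub_node] using hs
    exact ⟨rfl, hK, Or.inr rfl⟩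
  · right
    cases hs.good hK with
    | node _ _ hc h1 h2 => exact ⟨hc, h1, h2, hK⟩

theorem isParent_inr_iff {Φ : Finset (ℕ × Term)} {r : ℕ} {s p : Term} (hs : (r, s) ∈ Φ) (hp : Sub p s)
    {x : ℕ ⊕ ℕ × Term} : IsParent Φ x (Sum.inr (r, p)) ↔ ∃ t, Child t p ∧ x = place r t := by
  constructor
  · rintro ⟨r', s', t, h1, h2, rfl, ⟨rfl, h3⟩ | ⟨p', h3, h4, h5⟩⟩
    · cases h3
    · cases h5
      exact ⟨t, h4, rfl⟩
  · rintro ⟨t, h1, rfl⟩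
    exact ⟨r, s, t, hs, Relation.ReflTransGen.head h1 hp, rfl, Or.inr ⟨p, hp, h1, rfl⟩⟩

theorem isParent_inl_iff {Φ : Finset (ℕ × Term)} {r : ℕ} {x : ℕ ⊕ ℕ × Term} :
    IsParent Φ x (Sum.inl r) ↔ ∃ s, (r, s) ∈ Φ ∧ x = place r s := by
  constructor
  · rintro ⟨r', s', t, h1, h2, rfl, ⟨rfl, h3⟩ | ⟨p', h3, h4, h5⟩⟩
    · cases h3
      exact ⟨t, h1, rfl⟩
    · cases h5
  · rintro ⟨s, h1, rfl⟩
    exact ⟨r, s, s, h1, Sub.refl s, rfl, Or.inl ⟨rfl, rfl⟩⟩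

namespace IsGraphCoding

variable {n m : ℕ} {G : SimpleGraph (Fin n ⊕ Fin m)} {Φ : Finset (ℕ × Term)}
  {c : Fin m → ℕ × Term} (hΦ : IsForest {i | i < n} Φ) (hc : IsGraphCoding G Φ c)
include hΦ hc

theorem image_children {r : ℕ} {s p : Term} (hs : (r, s) ∈ Φ) (hp : Sub p s) :
    vertexCode (n := n) c '' {u | IsParent Φ (vertexCode c u) (Sum.inr (r, p))} =
      place r '' {t | Child t p} := by
  ext x
  constructor
  · rintro ⟨u, hu, rfl⟩
    obtain ⟨t, h1, h2⟩ := (isParent_inr_iff hs hp).1 hu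
    exact ⟨t, h1, h2.symm⟩
  · rintro ⟨t, h1, rfl⟩
    obtain ⟨u, hu⟩ := exists_place hΦ hc hs (Relation.ReflTransGen.head h1 hp)
    exact ⟨u, (isParent_inr_iff hs hp).2 ⟨t, h1, hu⟩, hu⟩

theorem ncard_children {r h : ℕ} {cs : List Term} {s : Term} (hs : (r, s) ∈ Φ)
    (hp : Sub (node h cs) s) :
    {u : Fin n ⊕ Fin m | IsParent Φ (vertexCode c u) (Sum.inr (r, node h cs))}.ncard =
      cs.length := by
  rw [← Set.ncard_image_of_injective _ hc.vertexCode_injective, image_children hΦ hc hs hp,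
    Set.InjOn.ncard_image]
  · have h1 : {t | Child t (node h cs)} = (cs.toFinset : Set Term) := by
      ext t
      simp [child_node]
    rw [h1, Set.ncard_coe_finset,
      List.toFinset_card_of_nodup ((hΦ.good _ hs).nodup_children (hΦ.nodup_block hs) hp)]
  · intro t ht t' ht' heq
    exact (hΦ.place_inj hs hs (Relation.ReflTransGen.head ht hp)
      (Relation.ReflTransGen.head ht' hp) heq).2.2

/-- The degree of an internal vertex. -/
theorem ncard_neighborSet_inr {w : Fin m} {r h : ℕ} {cs : List Term} (hw : c w = (r, node h cs)) :
    (G.neighborSet (Sum.inr w)).ncard = cs.length + 1 := by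
  obtain ⟨s, hs, hp⟩ := (hc.range _ _).1 ⟨w, hw⟩
  have h1 : vertexCode (n := n) c (Sum.inr w) = Sum.inr (r, node h cs) := congrArg Sum.inr hw
  obtain ⟨v, hv⟩ := (exists_parent_iff hΦ hc (Sum.inr w)).2 (by rw [h1]; simp)
  rw [(orientation hΦ hc).ncard_neighborSet hv, h1, ncard_children hΦ hc hs (mem_nodes.1 hp).1]

theorem ncard_neighborSet_inl (i : Fin n) : (G.neighborSet (Sum.inl i)).ncard = 1 := by
  obtain ⟨r, s, hs, h1 | ⟨t, ht, h1⟩⟩ := eq_root_or_place hΦ hc (Sum.inl i)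
  · rw [(orientation hΦ hc).neighborSet_root fun w hw => hΦ.not_isParent_inl hs _ (h1 ▸ hw),
      Set.ncard_eq_one]
    obtain ⟨v, hv⟩ := exists_place hΦ hc hs (Sub.refl s)
    refine ⟨v, ?_⟩
    ext u
    rw [Set.mem_ofPred_eq, h1, isParent_inl_iff, Set.mem_singleton_iff]
    constructor
    · rintro ⟨s', h2, h3⟩
      rw [← hΦ.eq_of_fst hs h2, ← hv] at h3
      exact hc.vertexCode_injective h3
    · rintro rfl
      exact ⟨s, hs, hv⟩
  · have h2 : t = leaf i := place_eq_inl.1 h1.symm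
    subst h2
    obtain ⟨y, hy⟩ := isParent_place hs ht
    rw [← h1] at hy
    obtain ⟨v, hv⟩ := (exists_parent_iff hΦ hc (Sum.inl i)).2 (by
      rintro ⟨r', s', h3, h4⟩
      rw [h4] at hy
      exact hΦ.not_isParent_inl h3 _ hy)
    have h3 : {u : Fin n ⊕ Fin m | IsParent Φ (vertexCode c u) (vertexCode c (Sum.inl i))} = ∅ := by
      rw [Set.eq_empty_iff_forall_notMem]
      intro u hu
      obtain ⟨s', h3, -⟩ := isParent_inl_iff.1 hu
      exact hΦ.notMem_leaves h3 hs (mem_leaves.2 ht)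
    rw [(orientation hΦ hc).ncard_neighborSet hv, h3, Set.ncard_empty]

omit hc in
theorem isRoot {r : ℕ} {s : Term} (hs : (r, s) ∈ Φ) (w : Fin n ⊕ Fin m) :
    ¬ IsParent Φ (vertexCode (n := n) c (Sum.inl ⟨r, hΦ.fst_mem hs⟩)) (vertexCode c w) :=
  hΦ.not_isParent_inl hs _

/-- The components of the graph. -/
theorem reachable_root_iff {v : Fin n ⊕ Fin m} {r : ℕ} {s : Term} (hs : (r, s) ∈ Φ) :
    G.Reachable (Sum.inl ⟨r, hΦ.fst_mem hs⟩) v ↔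
      (vertexCode c v = Sum.inl r ∨ ∃ t, Sub t s ∧ vertexCode c v = place r t) := by
  rw [← below_root_iff hΦ hc hs (v := Sum.inl ⟨r, hΦ.fst_mem hs⟩) rfl]
  exact ⟨fun h => (orientation hΦ hc).below_of_reachable (isRoot hΦ hs) h
    Relation.ReflTransGen.refl, fun h => ((orientation hΦ hc).reachable h).symm⟩

theorem reachable_root_inl_iff {i : Fin n} {K : ℕ × Term} (hs : K ∈ Φ) :
    G.Reachable (Sum.inl ⟨K.1, hΦ.fst_mem hs⟩) (Sum.inl i) ↔ (i : ℕ) ∈ block K := by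
  rw [reachable_root_iff hΦ hc (s := K.2) hs, block, List.mem_cons]
  refine or_congr (by simp [vertexCode]) ⟨?_, fun h => ⟨leaf i, mem_leaves.1 h, rfl⟩⟩
  rintro ⟨t, h1, h2⟩
  rw [place_eq_inl.1 h2.symm] at h1
  exact mem_leaves.2 h1

theorem exists_reachable_root (v : Fin n ⊕ Fin m) : ∃ K, ∃ hK : K ∈ Φ,
    G.Reachable (Sum.inl ⟨K.1, hΦ.fst_mem hK⟩) v := by
  obtain ⟨r, s, hs, h⟩ := eq_root_or_place hΦ hc v
  exact ⟨(r, s), hs, (reachable_root_iff hΦ hc hs).2 h⟩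

-- The leaves of a subtree form a contiguous segment of an increasing list. This supplies the
-- convexity from which planarity follows.
omit hc in
theorem mem_leaves_of_infix {r : ℕ} {s t : Term} (hs : (r, s) ∈ Φ) (ht : Sub t s) {a b d : ℕ}
    (hab : a < b) (hbd : b < d) (ha : a ∈ leaves t) (hd : d ∈ leaves t) (hb : b ∈ leaves s) :
    b ∈ leaves t := by
  have h1 := (List.pairwise_cons.1 (hΦ.sorted _ hs)).2
  obtain ⟨l1, l2, h2⟩ := ht.leaves_infix
  simp only at h1
  rw [← h2] at h1 hb
  rw [List.pairwise_append, List.pairwise_append] at h1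
  rw [List.mem_append, List.mem_append] at hb
  rcases hb with (hb | hb) | hb
  · exact absurd (h1.1.2.2 b hb a ha) (by omega)
  · exact hb
  · exact absurd (h1.2.2 d (List.mem_append_right _ hd) b hb) (by omega)

theorem planar {a b d e : Fin n} (hab : a < b) (hbd : b < d) (hde : d < e)
    (p : G.Walk (Sum.inl a) (Sum.inl d)) (p' : G.Walk (Sum.inl b) (Sum.inl e)) :
    ∃ u, u ∈ p.support ∧ u ∈ p'.support := by
  have hcomp : ∀ {x y : Fin n} {K : ℕ × Term}, K ∈ Φ →
      G.Reachable (Sum.inl x) (Sum.inl y) → (x : ℕ) ∈ block K → (y : ℕ) ∈ block K := by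
    intro x y K hK h hx
    rw [← reachable_root_inl_iff hΦ hc hK] at hx ⊢
    exact hx.trans h
  refine (orientation hΦ hc).planar_of_convex Sum.inl ?_ ?_ hab hbd hde p p'
  · intro u x y z hxy hyz hx hz hr
    obtain ⟨r, s, hs, h1 | ⟨t, ht, h1⟩⟩ := eq_root_or_place hΦ hc u
    · rw [below_root_iff hΦ hc hs h1] at hx ⊢
      rw [← reachable_root_iff hΦ hc hs] at hx ⊢
      exact hx.trans hr
    · rw [below_place_iff hΦ hc hs ht h1] at hx hz ⊢
      have key : ∀ {j : Fin n}, (∃ t', Sub t' t ∧ vertexCode c (Sum.inl j) = place r t') ↔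
          (j : ℕ) ∈ leaves t := by
        intro j
        rw [mem_leaves]
        constructor
        · rintro ⟨t', h2, h3⟩
          rwa [place_eq_inl.1 h3.symm] at h2
        · exact fun h2 => ⟨_, h2, rfl⟩
      rw [key] at hx hz ⊢
      have hy := hcomp hs hr (List.mem_cons_of_mem _ (ht.mem_leaves hx))
      refine mem_leaves_of_infix hΦ hs ht hxy hyz hx hz ?_
      rcases List.mem_cons.1 hy with h2 | h2
      · have h3 := hΦ.fst_le hs (List.mem_cons_of_mem _ (ht.mem_leaves hx))
        have h4 : (x : ℕ) < y := hxy
        rw [h2] at h4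
        exact absurd h3 (not_le.2 h4)
      · exact h2
  · intro x y z w hxy hyz hzw hr hr'
    obtain ⟨K, hK, hx⟩ := (hΦ.cover x).1 x.2
    obtain ⟨K', hK', hy⟩ := (hΦ.cover y).1 y.2
    have h1 := hΦ.noncrossing K hK K' hK' x y z w hxy hyz hzw hx (hcomp hK hr hx) hy
      (hcomp hK' hr' hy)
    subst h1
    exact ((reachable_root_inl_iff hΦ hc hK).2 hx).symm.trans
      ((reachable_root_inl_iff hΦ hc hK).2 hy)

end IsGraphCoding

/-- The forest `F` is encoded by `Φ`. -/
structure IsCoding {n : ℕ} (F : GrassmannianForest n) (Φ : Finset (ℕ × Term))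
    (c : Fin F.numInternal → ℕ × Term) : Prop where
  graphCoding : IsGraphCoding F.graph Φ c
  helicity : ∀ w, F.helicity w = (c w).2.rootHelicity

/-- Every encoded forest is the code of a Grassmannian forest. -/
theorem exists_isCoding {n : ℕ} {Φ : Finset (ℕ × Term)} (hΦ : IsForest {i | i < n} Φ) :
    ∃ (F : GrassmannianForest n) (c : _), IsCoding F Φ c := by
  obtain ⟨m, c, hcinj, hcrange⟩ : ∃ (m : ℕ) (c : Fin m → ℕ × Term), Function.Injective c ∧
      ∀ K', (∃ w, c w = K') ↔ K' ∈ Φ.biUnion fun K => (nodes K.2).toFinset.image (Prod.mk K.1) := by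
    -- One element per internal vertex. The tag `K.1` is indispensable for boundary leaves, whose
    -- trees contain no labels.
    set N := Φ.biUnion fun K => (nodes K.2).toFinset.image (Prod.mk K.1)
    refine ⟨N.card, fun w => (N.equivFin.symm w : ℕ × Term),
      Subtype.val_injective.comp N.equivFin.symm.injective, fun K' => ⟨?_, fun h => ?_⟩⟩
    · rintro ⟨w, rfl⟩
      exact Subtype.prop _
    · exact ⟨N.equivFin ⟨K', h⟩, by simp⟩
  have hsymm : ∀ u v : Fin n ⊕ Fin m, IsParent Φ (vertexCode c u) (vertexCode c v) →
      vertexCode c u ≠ vertexCode c v := by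
    intro u v h heq
    rw [heq] at h
    obtain ⟨r, s, t, h1, h2, h3, ⟨rfl, h4⟩ | ⟨p, h4, h5, h6⟩⟩ := h
    · rw [h4] at h3
      exact hΦ.not_isParent_inl h1 _ ⟨r, t, t, h1, h2, h3, Or.inl ⟨rfl, rfl⟩⟩
    · rw [h6] at h3
      obtain ⟨-, rfl, -⟩ := place_eq_inr.1 h3.symm
      exact lt_irrefl _ h5.length_nodes_lt
  let G : SimpleGraph (Fin n ⊕ Fin m) :=
    { Adj := fun u v => IsParent Φ (vertexCode c u) (vertexCode c v) ∨
        IsParent Φ (vertexCode c v) (vertexCode c u)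
      symm := ⟨fun u v h => Or.symm h⟩
      loopless := ⟨fun u h => h.elim (fun h => hsymm u u h rfl) fun h => hsymm u u h rfl⟩ }
  have hc : IsGraphCoding G Φ c := by
    refine ⟨hcinj, fun r t => ?_, fun u v => Iff.rfl⟩
    rw [hcrange, Finset.mem_biUnion]
    constructor
    · rintro ⟨K, hK, h⟩
      obtain ⟨t', h1, h2⟩ := Finset.mem_image.1 h
      cases h2
      exact ⟨K.2, hK, List.mem_toFinset.1 h1⟩
    · rintro ⟨s, hs, h⟩
      exact ⟨(r, s), hs, Finset.mem_image.2 ⟨t, List.mem_toFinset.2 h, rfl⟩⟩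
  refine ⟨{
    numInternal := m
    graph := G
    acyclic := (IsGraphCoding.orientation hΦ hc).isAcyclic
    boundary_degree := IsGraphCoding.ncard_neighborSet_inl hΦ hc
    connected_to_boundary := fun v => ?_
    series_reduced := fun v => ?_
    planar := fun a b c d h1 h2 h3 p p' => IsGraphCoding.planar hΦ hc h1 h2 h3 p p'
    helicity := fun w => (c w).2.rootHelicity
    helicity_boundaryLeaf := fun v => ?_
    helicity_of_not_boundaryLeaf := fun v => ?_ }, c, hc, fun w => rfl⟩
  · obtain ⟨K, hK, h⟩ := IsGraphCoding.exists_reachable_root hΦ hc (Sum.inr v)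
    exact ⟨_, h.symm⟩
  · obtain ⟨r, s, h, cs, h1, h2, h3⟩ := hc.exists_eq_node v
    rw [IsGraphCoding.ncard_neighborSet_inr hΦ hc h3]
    rcases (hΦ.good _ h1).sub_node h2 with ⟨rfl, -⟩ | h4
    · simp
    · omega
  · obtain ⟨r, s, h, cs, h1, h2, h3⟩ := hc.exists_eq_node v
    rw [IsGraphCoding.ncard_neighborSet_inr hΦ hc h3, h3]
    rintro ⟨h4, -⟩
    rcases (hΦ.good _ h1).sub_node h2 with ⟨rfl, -, h5⟩ | h5
    · exact h5
    · omega
  · obtain ⟨r, s, h, cs, h1, h2, h3⟩ := hc.exists_eq_node v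
    rw [IsGraphCoding.ncard_neighborSet_inr hΦ hc h3, h3]
    intro h4
    rcases (hΦ.good _ h1).sub_node h2 with ⟨rfl, h5, -⟩ | h5
    · refine (h4 ⟨rfl, ⟨r, hΦ.fst_mem h1⟩, ?_⟩).elim
      refine (hc.adj _ _).2 (Or.inl ?_)
      have h6 : vertexCode (n := n) c (Sum.inr v) = place r s := by
        simp only at h5
        rw [h5]
        exact congrArg Sum.inr h3
      rw [h6]
      exact isParent_inl_iff.2 ⟨s, h1, rfl⟩
    · change 1 ≤ h ∧ h + 1 ≤ cs.length + 1
      omega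

end MomAmp

/-! ### Codes and equivalence: invariance and uniqueness. -/

namespace MomAmp

open Term

namespace IsCoding

variable {n : ℕ} {F F' : GrassmannianForest n} {Φ : Finset (ℕ × Term)}
  {c : Fin F.numInternal → ℕ × Term} {c' : Fin F'.numInternal → ℕ × Term}

/-- Forests with the same code are equivalent. -/
theorem equivalent (hc : IsCoding F Φ c) (hc' : IsCoding F' Φ c') : F.Equivalent F' := by
  have hrange : Set.range c = Set.range c' := by
    ext ⟨r, t⟩
    rw [Set.mem_range, Set.mem_range, hc.graphCoding.range, hc'.graphCoding.range]
  let e : Fin F.numInternal ≃ Fin F'.numInternal :=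
    (Equiv.ofInjective c hc.graphCoding.inj).trans ((Equiv.setCongr hrange).trans
      (Equiv.ofInjective c' hc'.graphCoding.inj).symm)
  have he : ∀ w, c' (e w) = c w := by
    intro w
    have h := Equiv.apply_ofInjective_symm hc'.graphCoding.inj
      (Equiv.setCongr hrange (Equiv.ofInjective c hc.graphCoding.inj w))
    exact h
  have he' : ∀ v : Fin n ⊕ Fin F.numInternal,
      vertexCode c' (Sum.map id e v) = vertexCode c v := by
    rintro (i | w)
    · rfl
    · exact congrArg Sum.inr (he w)
  refine ⟨e, fun a b => ?_, fun v => ?_⟩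
  · rw [hc'.graphCoding.adj, hc.graphCoding.adj, he', he']
  · rw [hc'.helicity, hc.helicity, he]

/-- Equivalent forests have the same codes. -/
theorem of_equivalent (hc : IsCoding F Φ c) (h : F.Equivalent F') :
    ∃ c' : Fin F'.numInternal → ℕ × Term, IsCoding F' Φ c' := by
  obtain ⟨e, h1, h2⟩ := h
  have he : ∀ v : Fin n ⊕ Fin F.numInternal,
      vertexCode (c ∘ e.symm) (Sum.map id e v) = vertexCode c v := by
    rintro (i | w)
    · rfl
    · simp [vertexCode]
  have hsurj : ∀ v' : Fin n ⊕ Fin F'.numInternal, ∃ v, Sum.map id e v = v' := by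
    rintro (i | w)
    · exact ⟨Sum.inl i, rfl⟩
    · exact ⟨Sum.inr (e.symm w), by simp⟩
  refine ⟨c ∘ e.symm, ⟨hc.graphCoding.inj.comp e.symm.injective, fun r t => ?_, fun u v => ?_⟩,
    fun w => ?_⟩
  · rw [← hc.graphCoding.range]
    constructor
    · rintro ⟨w, hw⟩
      exact ⟨_, hw⟩
    · rintro ⟨w, hw⟩
      exact ⟨e w, by simp [hw]⟩
  · obtain ⟨u, rfl⟩ := hsurj u
    obtain ⟨v, rfl⟩ := hsurj v
    rw [h1, he, he, hc.graphCoding.adj]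
  · rw [← e.apply_symm_apply w, h2, hc.helicity]
    simp

end IsCoding

/-- A list of plane trees is determined by its members if the leaves are increasing. -/
theorem Term.eq_of_mem_iff {cs cs' : List Term} (hcs : (cs.map leaves).flatten.Pairwise (· < ·))
    (hcs' : (cs'.map leaves).flatten.Pairwise (· < ·)) (hne : ∀ t ∈ cs, leaves t ≠ [])
    (h : ∀ t, t ∈ cs ↔ t ∈ cs') : cs = cs' := by
  have key : ∀ l : List Term, (l.map leaves).flatten.Pairwise (· < ·) →
      l.Pairwise fun t u => ∀ i ∈ leaves t, ∀ j ∈ leaves u, i < j := by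
    intro l hl
    rw [List.pairwise_flatten] at hl
    exact List.pairwise_map.1 hl.2
  have hnd : ∀ l : List Term, (l.map leaves).flatten.Pairwise (· < ·) →
      (∀ t ∈ l, leaves t ≠ []) → l.Nodup := by
    intro l hl hl'
    refine (key l hl).imp_of_mem fun {a b} ha _ hab => ?_
    rintro rfl
    obtain ⟨i, hi⟩ := List.exists_mem_of_ne_nil _ (hl' a ha)
    exact lt_irrefl _ (hab i hi i hi)
  have hperm : cs.Perm cs' := (List.perm_ext_iff_of_nodup (hnd cs hcs hne)
    (hnd cs' hcs' fun t ht => hne t ((h t).2 ht))).2 h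
  refine hperm.eq_of_pairwise (fun a b ha _ hab hba => ?_) (key cs hcs) (key cs' hcs')
  obtain ⟨i, hi⟩ := List.exists_mem_of_ne_nil _ (hne a ha)
  obtain ⟨j, hj⟩ := List.exists_mem_of_ne_nil _ (hne b ((h b).2 ‹_›))
  exact absurd (hab i hi j hj) (not_lt.2 (hba j hj i hi).le)

namespace IsGraphCoding

variable {n m : ℕ} {G : SimpleGraph (Fin n ⊕ Fin m)} {Φ Φ' : Finset (ℕ × Term)}
  {c c' : Fin m → ℕ × Term}

/-- The right-hand side mentions only the graph, so any two codings of one graph have the same roots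
and hence, by `Orientation.eq_of_roots`, the same parents. -/
theorem isRoot_iff (hΦ : IsForest {i | i < n} Φ) (hc : IsGraphCoding G Φ c)
    (v : Fin n ⊕ Fin m) : (∃ r s, (r, s) ∈ Φ ∧ vertexCode c v = Sum.inl r) ↔
      ∃ i, v = Sum.inl i ∧ ∀ j, G.Reachable (Sum.inl i) (Sum.inl j) → i ≤ j := by
  constructor
  · rintro ⟨r, s, hs, h⟩
    obtain ⟨i, rfl, rfl⟩ : ∃ i : Fin n, v = Sum.inl i ∧ (i : ℕ) = r := by
      rcases v with i | w
      · exact ⟨i, rfl, Sum.inl_injective h⟩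
      · cases h
    exact ⟨i, rfl, fun j hj => hΦ.fst_le hs ((reachable_root_inl_iff hΦ hc hs).1 hj)⟩
  · rintro ⟨i, rfl, h⟩
    obtain ⟨K, hK, hi⟩ := (hΦ.cover i).1 i.2
    have h1 := h _ ((reachable_root_inl_iff hΦ hc hK).2 hi).symm
    exact ⟨K.1, K.2, hK, congrArg Sum.inl (le_antisymm h1 (hΦ.fst_le hK hi))⟩

section Unique

variable (hΦ : IsForest {i | i < n} Φ) (hΦ' : IsForest {i | i < n} Φ')
  (hc : IsGraphCoding G Φ c) (hc' : IsGraphCoding G Φ' c')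
include hΦ hΦ' hc hc'

theorem isParent_of_isParent {u v : Fin n ⊕ Fin m}
    (h : IsParent Φ (vertexCode c u) (vertexCode c v)) :
    IsParent Φ' (vertexCode c' u) (vertexCode c' v) := by
  refine (orientation hΦ' hc').eq_of_roots (orientation hΦ hc) (fun w hw => ?_) h
  rwa [exists_parent_iff hΦ' hc', isRoot_iff hΦ' hc', ← isRoot_iff hΦ hc,
    ← exists_parent_iff hΦ hc]

/-- Both codings give a vertex the same children, whose trees agree by induction; their order is
forced because the leaves increase from left to right. -/
theorem term_eq (hhel : ∀ w, (c w).2.rootHelicity = (c' w).2.rootHelicity) {r r' : ℕ}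
    {s s' t t' : Term} (hs : (r, s) ∈ Φ) (hs' : (r', s') ∈ Φ') (ht : Sub t s) (ht' : Sub t' s')
    {v : Fin n ⊕ Fin m} (hv : vertexCode c v = place r t) (hv' : vertexCode c' v = place r' t') :
    t = t' := by
  induction t using Term.induction generalizing t' v with
  | hleaf i =>
    rcases v with j | w
    · rw [place, vertexCode, Sum.map_inl, Sum.inl.injEq] at hv
      rw [vertexCode, Sum.map_inl, hv] at hv'
      exact (place_eq_inl.1 hv'.symm).symm
    · cases hv
  | hnode h cs ih =>
    rcases v with j | w
    · cases hv
    · have hw : c w = (r, node h cs) := Sum.inr_injective hv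
      obtain ⟨rfl, h2, h', cs', h3⟩ := place_eq_inr.1 (hv'.symm.trans
        (by rw [vertexCode, Sum.map_inr] : vertexCode (n := n) c' (Sum.inr w) =
          Sum.inr ((c' w).1, (c' w).2)))
      subst h3
      have hh : h = h' := by
        have h4 := hhel w
        rw [hw, ← h2] at h4
        exact h4
      subst hh
      have hsorted : ∀ {Ψ : Finset (ℕ × Term)} {ρ : ℕ} {σ : Term} {ds : List Term},
          IsForest {i | i < n} Ψ → (ρ, σ) ∈ Ψ → Sub (node h ds) σ →
          (ds.map leaves).flatten.Pairwise (· < ·) := by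
        intro Ψ ρ σ ds hΨ hρ hds
        rw [← leaves_node h]
        exact (List.pairwise_cons.1 (hΨ.sorted _ hρ)).2.sublist hds.leaves_infix.sublist
      have hcw : vertexCode (n := n) c (Sum.inr w) = Sum.inr (r, node h cs) := hv
      have hcw' : vertexCode (n := n) c' (Sum.inr w) = Sum.inr ((c' w).1, node h cs') := hv'
      have hcs : cs = cs' := by
        refine Term.eq_of_mem_iff (hsorted hΦ hs ht) (hsorted hΦ' hs' ht') (fun t h5 => ?_)
          fun t => ⟨fun h5 => ?_, fun h5 => ?_⟩
        · rcases (hΦ.good _ hs).sub_node ht with ⟨rfl, -⟩ | ⟨-, -, -, h6⟩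
          · simp at h5
          · exact (Sub.good (Relation.ReflTransGen.head (child_node.2 h5) ht) h6).leaves_ne_nil
        · have h6 : Sub t s := Relation.ReflTransGen.head (child_node.2 h5) ht
          obtain ⟨u, hu⟩ := exists_place hΦ hc hs h6
          have h7 : IsParent Φ (vertexCode c u) (vertexCode (n := n) c (Sum.inr w)) := by
            rw [hcw, isParent_inr_iff hs ht]
            exact ⟨t, child_node.2 h5, hu⟩
          have h8 := isParent_of_isParent hΦ hΦ' hc hc' h7
          rw [hcw', isParent_inr_iff hs' ht'] at h8
          obtain ⟨t', h9, h10⟩ := h8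
          rw [ih t h5 h6 (Relation.ReflTransGen.head h9 ht') hu h10]
          exact child_node.1 h9
        · have h6 : Sub t s' := Relation.ReflTransGen.head (child_node.2 h5) ht'
          obtain ⟨u, hu⟩ := exists_place hΦ' hc' hs' h6
          have h7 : IsParent Φ' (vertexCode c' u) (vertexCode (n := n) c' (Sum.inr w)) := by
            rw [hcw', isParent_inr_iff hs' ht']
            exact ⟨t, child_node.2 h5, hu⟩
          have h8 := isParent_of_isParent hΦ' hΦ hc' hc h7
          rw [hcw, isParent_inr_iff hs ht] at h8
          obtain ⟨t', h9, h10⟩ := h8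
          rw [← ih t' (child_node.1 h9) (Relation.ReflTransGen.head h9 ht) h6 h10 hu]
          exact child_node.1 h9
      rw [hcs]

theorem subset (hhel : ∀ w, (c w).2.rootHelicity = (c' w).2.rootHelicity) : Φ ⊆ Φ' := by
  rintro ⟨r, s⟩ hs
  obtain ⟨v, hv⟩ := exists_place hΦ hc hs (Sub.refl s)
  have h1 : IsParent Φ (vertexCode c v)
      (vertexCode (n := n) c (Sum.inl ⟨r, hΦ.fst_mem hs⟩)) := isParent_inl_iff.2 ⟨s, hs, hv⟩
  obtain ⟨s', hs', h2⟩ := isParent_inl_iff.1 (isParent_of_isParent hΦ hΦ' hc hc' h1)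
  rwa [term_eq hΦ hΦ' hc hc' hhel hs hs' (Sub.refl s) (Sub.refl s') hv h2]

end Unique

end IsGraphCoding

/-- The code of a forest is unique. -/
theorem IsCoding.unique {n : ℕ} {F : GrassmannianForest n} {Φ Φ' : Finset (ℕ × Term)}
    {c c' : Fin F.numInternal → ℕ × Term} (hΦ : IsForest {i | i < n} Φ)
    (hΦ' : IsForest {i | i < n} Φ') (hc : IsCoding F Φ c) (hc' : IsCoding F Φ' c') : Φ = Φ' := by
  have h : ∀ w, (c w).2.rootHelicity = (c' w).2.rootHelicity := fun w => by
    rw [← hc.helicity, ← hc'.helicity]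
  exact (IsGraphCoding.subset hΦ hΦ' hc.graphCoding hc'.graphCoding h).antisymm
    (IsGraphCoding.subset hΦ' hΦ hc'.graphCoding hc.graphCoding fun w => (h w).symm)

end MomAmp

namespace MomAmp

open Term

/-! ### The code of a contracted forest -/

/-- Every component is rooted at its smallest boundary vertex. -/
structure IsRooting {n : ℕ} (F : GrassmannianForest n)
    (ri : Fin n ⊕ Fin F.numInternal → Fin n)
    (Ch : Fin n ⊕ Fin F.numInternal → Fin n ⊕ Fin F.numInternal → Prop) : Prop where
  orientation : Orientation F.graph Ch
  reachable : ∀ v, F.graph.Reachable (Sum.inl (ri v)) v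
  le : ∀ v j, F.graph.Reachable (Sum.inl j) v → ri v ≤ j
  parent_iff : ∀ v, (∃ w, Ch v w) ↔ Sum.inl (ri v) ≠ v

theorem exists_isRooting {n : ℕ} (F : GrassmannianForest n) : ∃ ri Ch, IsRooting F ri Ch := by
  have h1 : ∀ v : Fin n ⊕ Fin F.numInternal, ∃ i : Fin n, F.graph.Reachable (Sum.inl i) v ∧
      ∀ j, F.graph.Reachable (Sum.inl j) v → i ≤ j := by
    intro v
    obtain ⟨i, hi⟩ : ∃ i : Fin n, F.graph.Reachable (Sum.inl i) v := by
      rcases v with i | w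
      · exact ⟨i, SimpleGraph.Reachable.refl _⟩
      · obtain ⟨i, hi⟩ := F.connected_to_boundary w
        exact ⟨i, hi.symm⟩
    obtain ⟨j, hj, hmin⟩ := Set.Finite.exists_minimal
      (s := {i : Fin n | F.graph.Reachable (Sum.inl i) v}) (Set.toFinite _) ⟨i, hi⟩
    exact ⟨j, hj, fun k hk => (le_total j k).elim id (hmin hk)⟩
  choose ri h2 h3 using h1
  obtain ⟨Ch, h4, h5⟩ := exists_orientation F.acyclic (fun v => Sum.inl (ri v)) h2 fun u v huv =>
    congrArg Sum.inl (le_antisymm (h3 u _ ((h2 v).trans huv.symm.reachable))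
      (h3 v _ ((h2 u).trans huv.reachable)))
  exact ⟨ri, Ch, h4, h2, h3, h5⟩

namespace IsRooting

variable {n : ℕ} {F : GrassmannianForest n} {ri : Fin n ⊕ Fin F.numInternal → Fin n}
  {Ch : Fin n ⊕ Fin F.numInternal → Fin n ⊕ Fin F.numInternal → Prop} (hR : IsRooting F ri Ch)
include hR

theorem ri_eq {u v : Fin n ⊕ Fin F.numInternal} (h : F.graph.Reachable u v) : ri u = ri v :=
  le_antisymm (hR.le u _ ((hR.reachable v).trans h.symm)) (hR.le v _ ((hR.reachable u).trans h))

theorem ri_eq_of_child {u v : Fin n ⊕ Fin F.numInternal} (h : Ch u v) : ri u = ri v :=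
  hR.ri_eq (hR.orientation.adj h).reachable

theorem ri_eq_of_below {u v : Fin n ⊕ Fin F.numInternal} (h : Below Ch u v) : ri u = ri v :=
  hR.ri_eq (hR.orientation.reachable h)

theorem root (v : Fin n ⊕ Fin F.numInternal) (w) : ¬ Ch (Sum.inl (ri v)) w := by
  intro h
  refine (hR.parent_iff _).1 ⟨w, h⟩ ?_
  rw [hR.ri_eq (hR.reachable v)]

theorem below_root (v : Fin n ⊕ Fin F.numInternal) : Below Ch v (Sum.inl (ri v)) :=
  hR.orientation.below_of_reachable (hR.root v) (hR.reachable v) Relation.ReflTransGen.refl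

theorem exists_parent_inr (w : Fin F.numInternal) : ∃ v, Ch (Sum.inr w) v := by
  rw [hR.parent_iff]
  simp

theorem deg_eq (w : Fin F.numInternal) : (F.graph.neighborSet (Sum.inr w)).ncard =
    {u | Ch u (Sum.inr w)}.ncard + 1 := by
  obtain ⟨v, hv⟩ := hR.exists_parent_inr w
  exact hR.orientation.ncard_neighborSet hv

/-- Boundary vertices that have children are roots. -/
theorem eq_root_of_child {u : Fin n ⊕ Fin F.numInternal} {i : Fin n} (h : Ch u (Sum.inl i)) :
    i = ri u := by
  rw [hR.ri_eq_of_child h]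
  by_contra hne
  obtain ⟨w, hw⟩ := (hR.parent_iff (Sum.inl i)).2 fun h => hne (Sum.inl_injective h).symm
  have h1 := hR.orientation.ncard_neighborSet hw
  rw [F.boundary_degree] at h1
  have h2 : {u | Ch u (Sum.inl i)}.ncard = 0 := by omega
  rw [Set.ncard_eq_zero] at h2
  exact Set.eq_empty_iff_forall_notMem.1 h2 u h

/-- Roots have only one child. -/
theorem eq_of_child {u u' : Fin n ⊕ Fin F.numInternal} {i : Fin n} (h : Ch u (Sum.inl i))
    (h' : Ch u' (Sum.inl i)) : u = u' := by
  have h1 := hR.eq_root_of_child h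
  have h2 := F.boundary_degree i
  rw [hR.orientation.neighborSet_root (h1 ▸ hR.root u), Set.ncard_eq_one] at h2
  obtain ⟨v, hv⟩ := h2
  have h3 : u ∈ {u | Ch u (Sum.inl i)} := h
  have h4 : u' ∈ {u | Ch u (Sum.inl i)} := h'
  rw [hv] at h3 h4
  rw [h3, h4]

theorem exists_child_root (v : Fin n ⊕ Fin F.numInternal) : ∃ u, Ch u (Sum.inl (ri v)) := by
  have h2 := F.boundary_degree (ri v)
  rw [hR.orientation.neighborSet_root (hR.root v)] at h2
  exact Set.nonempty_of_ncard_ne_zero (s := {u | Ch u (Sum.inl (ri v))}) (by omega)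

/-- Vertices without children are boundary leaves. -/
theorem exists_child_or {w : Fin F.numInternal} {v : Fin n ⊕ Fin F.numInternal}
    (h : Ch (Sum.inr w) v) : (∃ u, Ch u (Sum.inr w)) ∨ ∃ i, v = Sum.inl i := by
  by_contra! hcon
  have h1 : {u | Ch u (Sum.inr w)} = ∅ := Set.eq_empty_iff_forall_notMem.2 hcon.1
  have h2 := hR.orientation.ncard_neighborSet h
  rw [h1, Set.ncard_empty] at h2
  -- A vertex of degree one that is not a boundary leaf would need 1 ≤ h and h + 1 ≤ 1.
  have h3 := F.helicity_of_not_boundaryLeaf w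
  rw [h2] at h3
  have h4 := h3 (by
    rintro ⟨-, i, hi⟩
    rcases (hR.orientation.adj_iff _ _).1 hi with h5 | h5
    · exact hcon.2 i (hR.orientation.unique _ _ _ h h5)
    · exact hcon.1 _ h5)
  omega

/-- Descend from child to child. By `exists_child_or` the descent below an internal vertex cannot
stop at an internal vertex, since the childless ones hang directly from a boundary vertex. -/
theorem exists_leaf {v : Fin n ⊕ Fin F.numInternal} (h : ∀ w, v = Sum.inr w → ∃ u, Ch u v) :
    ∃ i, Below Ch (Sum.inl i) v := by
  induction v using hR.orientation.wellFounded.induction with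
  | _ v ih =>
    rcases v with i | w
    · exact ⟨i, Relation.ReflTransGen.refl⟩
    · obtain ⟨u, hu⟩ := h w rfl
      obtain ⟨i, hi⟩ := ih u hu (by
        rintro w' rfl
        rcases hR.exists_child_or hu with h1 | ⟨i, h1⟩
        · exact h1
        · cases h1)
      exact ⟨i, Relation.ReflTransGen.tail hi hu⟩

theorem exists_leaf_of_child {u : Fin n ⊕ Fin F.numInternal} {w : Fin F.numInternal}
    (h : Ch u (Sum.inr w)) : ∃ i, Below Ch (Sum.inl i) u := by
  refine hR.exists_leaf ?_
  rintro w' rfl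
  rcases hR.exists_child_or h with h1 | ⟨i, h1⟩
  · exact h1
  · cases h1

/-- Siblings have no common descendants. -/
theorem eq_of_siblings {u u' v x : Fin n ⊕ Fin F.numInternal} (h : Ch u v) (h' : Ch u' v)
    (hx : Below Ch x u) (hx' : Below Ch x u') : u = u' := by
  obtain ⟨ρ, hρ⟩ := hR.orientation.rank
  have key : ∀ {u u'}, Ch u v → Ch u' v → Below Ch u u' → u = u' := by
    intro u u' h h' h1
    rcases Relation.ReflTransGen.cases_head h1 with rfl | ⟨w, h2, h3⟩
    · rfl
    · rw [← hR.orientation.unique _ _ _ h h2] at h3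
      have h4 := hρ _ _ h'
      rcases Below.le_rank hρ h3 with rfl | h5 <;> omega
  rcases hR.orientation.total hx hx' with h1 | h1
  · exact key h h' h1
  · exact (key h' h h1).symm

theorem convex {u v : Fin n ⊕ Fin F.numInternal} {a b c : Fin n} (hab : a < b) (hbc : b < c)
    (ha : Below Ch (Sum.inl a) u) (hc : Below Ch (Sum.inl c) u) (hb : Below Ch (Sum.inl b) v)
    (huv : F.graph.Reachable u v) : Below Ch (Sum.inl b) u := by
  refine hR.orientation.convex_of_planar Sum.inl F.planar (r := ri u) (hR.root u)
    (fun a h => hR.le u a (h.symm.trans (hR.reachable u))) hab hbc ha hc ?_ ?_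
  · exact (hR.reachable u).trans (hR.orientation.reachable ha).symm
  · exact (hR.reachable u).trans (huv.trans (hR.orientation.reachable hb).symm)

/-- The children of an internal vertex from left to right. -/
theorem exists_sorted_children (w : Fin F.numInternal) :
    ∃ l : List (Fin n ⊕ Fin F.numInternal), l.Nodup ∧ (∀ u, u ∈ l ↔ Ch u (Sum.inr w)) ∧
      l.Pairwise fun u u' => ∀ i j, Below Ch (Sum.inl i) u → Below Ch (Sum.inl j) u' → i < j := by
  classical
  -- The sorting key is the smallest leaf below a child; 0 is a dummy key for vertices that are not
  -- children of w.
  have h1 : ∀ u, ∃ j : ℕ, Ch u (Sum.inr w) → ∃ i : Fin n, (i : ℕ) = j ∧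
      Below Ch (Sum.inl i) u ∧ ∀ k, Below Ch (Sum.inl k) u → i ≤ k := by
    intro u
    by_cases hu : Ch u (Sum.inr w)
    · obtain ⟨i, hi⟩ := hR.exists_leaf_of_child hu
      obtain ⟨j, hj, hmin⟩ := Set.Finite.exists_minimal
        (s := {i : Fin n | Below Ch (Sum.inl i) u}) (Set.toFinite _) ⟨i, hi⟩
      exact ⟨j, fun _ => ⟨j, rfl, hj, fun k hk => (le_total j k).elim id (hmin hk)⟩⟩
    · exact ⟨0, fun h => absurd h hu⟩
  choose μ hμ using h1
  let r : Fin n ⊕ Fin F.numInternal → Fin n ⊕ Fin F.numInternal → Prop := fun u u' => μ u ≤ μ u'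
  have : Std.Total r := ⟨fun a b => le_total (μ a) (μ b)⟩
  have : IsTrans _ r := ⟨fun a b c => le_trans⟩
  let l₀ := (Finset.univ.filter fun u => Ch u (Sum.inr w)).toList
  have hperm := List.perm_insertionSort r l₀
  have hmem : ∀ u, u ∈ l₀.insertionSort r ↔ Ch u (Sum.inr w) := fun u => by
    rw [hperm.mem_iff]
    simp [l₀]
  have hnd : (l₀.insertionSort r).Nodup := hperm.nodup_iff.2 (Finset.nodup_toList _)
  refine ⟨l₀.insertionSort r, hnd, hmem, ?_⟩
  refine ((List.pairwise_insertionSort r l₀).and hnd).imp_of_mem ?_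
  rintro u u' hu hu' ⟨h1, h2⟩ i j hi hj
  rw [hmem] at hu hu'
  obtain ⟨m, hm, hmu, -⟩ := hμ u hu
  obtain ⟨m', hm', hmu', hmin⟩ := hμ u' hu'
  have h3 : ∀ k, Below Ch (Sum.inl k) u → Below Ch (Sum.inl k) u' → False := fun k h h' =>
    h2 (hR.eq_of_siblings hu hu' h h')
  -- Otherwise m < m' ≤ j < i with m and i below u, so convexity puts j below u as well as below u',
  -- but siblings share no descendants.
  by_contra! h4
  have h5 : j < i := lt_of_le_of_ne h4 fun h => h3 i hi (h ▸ hj)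
  have h6 : m ≤ m' := by
    rw [Fin.le_def, hm, hm']
    exact h1
  have h7 : m < m' := lt_of_le_of_ne h6 fun h => h3 m hmu (h ▸ hmu')
  refine h3 j (hR.convex (h7.trans_le (hmin j hj)) h5 hmu hi hj ?_) hj
  exact (hR.orientation.adj hu).reachable.trans (hR.orientation.adj hu').symm.reachable

end IsRooting

/-- The plane trees formed by the descendants of the vertices. -/
structure IsTermCode {n : ℕ} (F : GrassmannianForest n)
    (Ch : Fin n ⊕ Fin F.numInternal → Fin n ⊕ Fin F.numInternal → Prop)
    (code : Fin n ⊕ Fin F.numInternal → Term) : Prop where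
  inl : ∀ i, code (Sum.inl i) = leaf i
  inr : ∀ w, ∃ l : List (Fin n ⊕ Fin F.numInternal),
    code (Sum.inr w) = node (F.helicity w) (l.map code) ∧ l.Nodup ∧
      (∀ u, u ∈ l ↔ Ch u (Sum.inr w)) ∧
      l.Pairwise fun u u' => ∀ i j, Below Ch (Sum.inl i) u → Below Ch (Sum.inl j) u' → i < j

theorem IsRooting.exists_isTermCode {n : ℕ} {F : GrassmannianForest n}
    {ri : Fin n ⊕ Fin F.numInternal → Fin n}
    {Ch : Fin n ⊕ Fin F.numInternal → Fin n ⊕ Fin F.numInternal → Prop}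
    (hR : IsRooting F ri Ch) : ∃ code, IsTermCode F Ch code := by
  choose l h1 h2 h3 using hR.exists_sorted_children
  let step : ∀ v, (∀ u, Ch u v → Term) → Term := fun v =>
    match v with
    | Sum.inl i => fun _ => leaf i
    | Sum.inr w => fun rec =>
      node (F.helicity w) ((l w).attach.map fun u => rec u.1 ((h2 w u.1).1 u.2))
  refine ⟨hR.orientation.wellFounded.fix step, fun i => ?_, fun w => ⟨l w, ?_, h1 w, h2 w, h3 w⟩⟩
  · rw [WellFounded.fix_eq]
  · rw [WellFounded.fix_eq]
    exact congrArg (node _) List.attach_map_val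

end MomAmp

/-! ### The plane trees of a contracted forest form a code. -/

namespace MomAmp

open Term

theorem Below.exists_parent {V : Type*} {Ch : V → V → Prop} {u v b : V} (h : Below Ch u v)
    (h' : Ch v b) : ∃ d, Ch u d := by
  rcases Relation.ReflTransGen.cases_head h with rfl | ⟨w, h1, -⟩
  · exact ⟨b, h'⟩
  · exact ⟨w, h1⟩

namespace IsRooting

variable {n : ℕ} {F : GrassmannianForest n} {ri : Fin n ⊕ Fin F.numInternal → Fin n}
  {Ch : Fin n ⊕ Fin F.numInternal → Fin n ⊕ Fin F.numInternal → Prop} (hR : IsRooting F ri Ch)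
include hR

theorem eq_inr_of_child {u v b : Fin n ⊕ Fin F.numInternal} (h : Ch u v) (h' : Ch v b) :
    ∃ w, v = Sum.inr w := by
  rcases v with i | w
  · have h1 := hR.eq_root_of_child h
    subst h1
    exact (hR.root u b h').elim
  · exact ⟨w, rfl⟩

theorem deg_eq_length_add_one {w : Fin F.numInternal} {l : List (Fin n ⊕ Fin F.numInternal)}
    (hl : l.Nodup) (hmem : ∀ u, u ∈ l ↔ Ch u (Sum.inr w)) : F.deg w = l.length + 1 := by
  classical
  have h1 : {u | Ch u (Sum.inr w)} = (l.toFinset : Set (Fin n ⊕ Fin F.numInternal)) := by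
    ext u
    simp [hmem]
  rw [GrassmannianForest.deg, hR.deg_eq, h1, Set.ncard_coe_finset,
    List.toFinset_card_of_nodup hl]

end IsRooting

namespace IsTermCode

variable {n : ℕ} {F : GrassmannianForest n} {ri : Fin n ⊕ Fin F.numInternal → Fin n}
  {Ch : Fin n ⊕ Fin F.numInternal → Fin n ⊕ Fin F.numInternal → Prop} (hR : IsRooting F ri Ch)
  {code : Fin n ⊕ Fin F.numInternal → Term} (hC : IsTermCode F Ch code)

include hC

theorem child_inr {w : Fin F.numInternal} {t : Term} :
    Child t (code (Sum.inr w)) ↔ ∃ u, Ch u (Sum.inr w) ∧ t = code u := by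
  obtain ⟨l, h1, -, h2, -⟩ := hC.inr w
  rw [h1, child_node, List.mem_map]
  constructor
  · rintro ⟨u, h3, rfl⟩
    exact ⟨u, (h2 u).1 h3, rfl⟩
  · rintro ⟨u, h3, rfl⟩
    exact ⟨u, (h2 u).2 h3, rfl⟩

theorem place_inr (r : ℕ) (w : Fin F.numInternal) :
    place r (code (Sum.inr w)) = Sum.inr (r, code (Sum.inr w)) := by
  obtain ⟨l, h1, -⟩ := hC.inr w
  rw [h1]
  rfl

include hR in
/-- The subtrees of the code of a vertex are the codes of its descendants. -/
theorem sub_code {v b : Fin n ⊕ Fin F.numInternal} (hv : Ch v b) {t : Term} :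
    Sub t (code v) ↔ ∃ u, Below Ch u v ∧ t = code u := by
  constructor
  · intro h
    induction h using Relation.ReflTransGen.head_induction_on with
    | refl => exact ⟨v, Relation.ReflTransGen.refl, rfl⟩
    | head h1 _ ih =>
      obtain ⟨u, h2, rfl⟩ := ih
      rcases u with i | w
      · rw [hC.inl] at h1
        exact (not_child_leaf h1).elim
      · obtain ⟨u', h3, rfl⟩ := hC.child_inr.1 h1
        exact ⟨u', Relation.ReflTransGen.head h3 h2, rfl⟩
  · rintro ⟨u, h, rfl⟩
    induction h using Relation.ReflTransGen.head_induction_on with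
    | refl => exact Sub.refl _
    | head h1 h2 ih =>
      obtain ⟨d, hd⟩ := Below.exists_parent h2 hv
      obtain ⟨w, rfl⟩ := hR.eq_inr_of_child h1 hd
      exact Relation.ReflTransGen.head (hC.child_inr.2 ⟨_, h1, rfl⟩) ih

include hR in
theorem mem_leaves {v b : Fin n ⊕ Fin F.numInternal} (hv : Ch v b) {j : ℕ} :
    j ∈ leaves (code v) ↔ ∃ i : Fin n, (i : ℕ) = j ∧ Below Ch (Sum.inl i) v := by
  rw [Term.mem_leaves, sub_code hR hC hv]
  constructor
  · rintro ⟨u, h1, h2⟩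
    rcases u with i | w
    · rw [hC.inl] at h2
      cases h2
      exact ⟨i, rfl, h1⟩
    · obtain ⟨l, h3, -⟩ := hC.inr w
      rw [h3] at h2
      cases h2
  · rintro ⟨i, rfl, h⟩
    exact ⟨_, h, (hC.inl i).symm⟩

include hR in
theorem pairwise_leaves {v b : Fin n ⊕ Fin F.numInternal} (hv : Ch v b) :
    (leaves (code v)).Pairwise (· < ·) := by
  induction v using hR.orientation.wellFounded.induction generalizing b with
  | _ v ih =>
    rcases v with i | w
    · rw [hC.inl]
      simp
    · obtain ⟨l, h1, -, h2, h3⟩ := hC.inr w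
      rw [h1, leaves_node, List.pairwise_flatten]
      constructor
      · intro l' hl'
        rw [List.map_map, List.mem_map] at hl'
        obtain ⟨u, hu, rfl⟩ := hl'
        exact ih u ((h2 u).1 hu) ((h2 u).1 hu)
      · rw [List.map_map, List.pairwise_map]
        refine h3.imp_of_mem fun {u u'} hu hu' h i hi j hj => ?_
        obtain ⟨i, rfl, hi'⟩ := (hC.mem_leaves hR ((h2 u).1 hu)).1 hi
        obtain ⟨j, rfl, hj'⟩ := (hC.mem_leaves hR ((h2 u').1 hu')).1 hj
        exact h i j hi' hj'

-- The degree is one more than the number of children, so series reduction turns one child into at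
-- least two, and black means helicity equal to the number of children. Contractedness then gives
-- the attachment conditions.
include hR in
theorem good (hF : F.IsContracted) {v b : Fin n ⊕ Fin F.numInternal} (hv : Ch v b)
    (h : ∀ w, v = Sum.inr w → ∃ u, Ch u v) : Good (code v) := by
  induction v using hR.orientation.wellFounded.induction generalizing b with
  | _ v ih =>
    rcases v with i | w
    · rw [hC.inl]
      exact Good.leaf i
    · obtain ⟨l, h1, h2, h3, -⟩ := hC.inr w
      have hdeg := hR.deg_eq_length_add_one h2 h3
      obtain ⟨u₀, hu₀⟩ := h w rfl
      have hpos := List.length_pos_of_mem ((h3 u₀).2 hu₀)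
      have hser : F.deg w ≠ 2 := F.series_reduced w
      have hhel : 1 ≤ F.helicity w ∧ F.helicity w + 1 ≤ F.deg w :=
        F.helicity_of_not_boundaryLeaf w (by
          rintro ⟨h4, -⟩
          have h5 : F.deg w = 1 := h4
          omega)
      rw [h1]
      refine Good.node _ _ (by rw [List.length_map]; omega) hhel.1
        (by rw [List.length_map]; omega) (fun t ht => ?_) fun t ht => ?_
      · obtain ⟨u, hu, rfl⟩ := List.mem_map.1 ht
        refine ih u ((h3 u).1 hu) ((h3 u).1 hu) ?_
        rintro w' rfl
        rcases hR.exists_child_or ((h3 _).1 hu) with h4 | ⟨i, h4⟩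
        · exact h4
        · cases h4
      · obtain ⟨u, hu, rfl⟩ := List.mem_map.1 ht
        rcases u with i | w'
        · rw [hC.inl]
          exact ⟨fun _ h => h, fun _ h => h⟩
        · obtain ⟨l', h1', h2', h3', -⟩ := hC.inr w'
          have hdeg' := hR.deg_eq_length_add_one h2' h3'
          have h4 := hF w w' (hR.orientation.adj ((h3 _).1 hu)).symm
          rw [h1']
          refine ⟨fun h5 h6 => h4.1 ⟨h5, h6⟩, fun h5 h6 => h4.2 ⟨?_, ?_⟩⟩
          · rw [List.length_map] at h5
            rw [GrassmannianForest.IsBlack, h5, hdeg]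
          · have h6 : F.helicity w' = (l'.map code).length := h6
            rw [List.length_map] at h6
            rw [GrassmannianForest.IsBlack, h6, hdeg']

open Classical in
omit hC in
/-- The code of a forest. -/
noncomputable def _root_.MomAmp.forestCode {n : ℕ} {F : GrassmannianForest n}
    (Ch : Fin n ⊕ Fin F.numInternal → Fin n ⊕ Fin F.numInternal → Prop)
    (code : Fin n ⊕ Fin F.numInternal → Term) : Finset (ℕ × Term) :=
  ((Finset.univ : Finset (Fin n × (Fin n ⊕ Fin F.numInternal))).filter
    fun p => Ch p.2 (Sum.inl p.1)).image fun p => ((p.1 : ℕ), code p.2)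

omit hC in
theorem mem_forestCode {K : ℕ × Term} : K ∈ forestCode Ch code ↔
    ∃ u, ∃ i : Fin n, Ch u (Sum.inl i) ∧ K = ((i : ℕ), code u) := by
  simp only [forestCode, Finset.mem_image, Finset.mem_filter, Finset.mem_univ, true_and]
  constructor
  · rintro ⟨p, h1, rfl⟩
    exact ⟨p.2, p.1, h1, rfl⟩
  · rintro ⟨u, i, h1, rfl⟩
    exact ⟨(i, u), h1, rfl⟩

include hR in
theorem mem_block {u : Fin n ⊕ Fin F.numInternal} {i : Fin n} (hu : Ch u (Sum.inl i)) {j : ℕ} :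
    j ∈ block ((i : ℕ), code u) ↔ ∃ k : Fin n, (k : ℕ) = j ∧ ri (Sum.inl k) = i := by
  have h1 := hR.eq_root_of_child hu
  rw [block, List.mem_cons, hC.mem_leaves hR hu]
  constructor
  · rintro (rfl | ⟨k, rfl, hk⟩)
    · refine ⟨i, rfl, ?_⟩
      rw [h1, hR.ri_eq (hR.reachable u)]
    · exact ⟨k, rfl, by rw [hR.ri_eq_of_below hk, h1]⟩
  · rintro ⟨k, rfl, hk⟩
    have h2 := hR.below_root (Sum.inl k)
    rw [hk] at h2
    by_cases hki : k = i
    · exact Or.inl (congrArg Fin.val hki)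
    · right
      obtain ⟨v, h3, h4⟩ := h2.exists_child fun h => hki (Sum.inl_injective h)
      rw [hR.eq_of_child h3 hu] at h4
      exact ⟨k, rfl, h4⟩

include hR in
theorem isForest (hF : F.IsContracted) : IsForest {i | i < n} (forestCode Ch code) where
  good K hK := by
    obtain ⟨u, i, hu, rfl⟩ := mem_forestCode.1 hK
    by_cases h : ∀ w, u = Sum.inr w → ∃ v, Ch v u
    · exact Or.inr (hC.good hR hF hu h)
    · push Not at h
      obtain ⟨w, rfl, h⟩ := h
      left
      obtain ⟨l, h1, h2, h3, -⟩ := hC.inr w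
      have h4 : l = [] := List.eq_nil_iff_forall_not_mem.2 fun v hv => h v ((h3 v).1 hv)
      have hdeg := hR.deg_eq_length_add_one h2 h3
      subst h4
      rcases F.helicity_boundaryLeaf w ⟨hdeg, i, hR.orientation.adj hu⟩ with h5 | h5
      · left
        rw [h1, h5, List.map_nil]
      · right
        rw [h1, h5, List.map_nil]
  sorted K hK := by
    obtain ⟨u, i, hu, rfl⟩ := mem_forestCode.1 hK
    rw [block, List.pairwise_cons]
    refine ⟨fun j hj => ?_, hC.pairwise_leaves hR hu⟩
    obtain ⟨k, rfl, hk⟩ := (hC.mem_leaves hR hu).1 hj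
    have h1 := hR.eq_root_of_child hu
    refine lt_of_le_of_ne ?_ ?_
    · rw [h1]
      exact hR.le u k (hR.orientation.reachable hk)
    · intro h2
      obtain ⟨d, hd⟩ := hk.exists_parent hu
      rw [← Fin.ext h2, h1] at hd
      exact hR.root u d hd
  cover j := by
    constructor
    · intro hj
      obtain ⟨u, hu⟩ := hR.exists_child_root (Sum.inl ⟨j, hj⟩)
      exact ⟨_, mem_forestCode.2 ⟨u, _, hu, rfl⟩, (hC.mem_block hR hu).2 ⟨⟨j, hj⟩, rfl, rfl⟩⟩
    · rintro ⟨K, hK, hj⟩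
      obtain ⟨u, i, hu, rfl⟩ := mem_forestCode.1 hK
      obtain ⟨k, rfl, -⟩ := (hC.mem_block hR hu).1 hj
      exact k.2
  disjoint K hK K' hK' j hj hj' := by
    obtain ⟨u, i, hu, rfl⟩ := mem_forestCode.1 hK
    obtain ⟨u', i', hu', rfl⟩ := mem_forestCode.1 hK'
    obtain ⟨k, rfl, hk⟩ := (hC.mem_block hR hu).1 hj
    obtain ⟨k', h1, hk'⟩ := (hC.mem_block hR hu').1 hj'
    rw [Fin.ext h1, hk] at hk'
    subst hk'
    rw [hR.eq_of_child hu hu']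
  noncrossing K hK K' hK' a b c d hab hbc hcd ha hc hb hd := by
    obtain ⟨u, i, hu, rfl⟩ := mem_forestCode.1 hK
    obtain ⟨u', i', hu', rfl⟩ := mem_forestCode.1 hK'
    obtain ⟨a, rfl, ha'⟩ := (hC.mem_block hR hu).1 ha
    obtain ⟨c, rfl, hc'⟩ := (hC.mem_block hR hu).1 hc
    obtain ⟨b, rfl, hb'⟩ := (hC.mem_block hR hu').1 hb
    obtain ⟨d, rfl, hd'⟩ := (hC.mem_block hR hu').1 hd
    have key : ∀ {a c : Fin n}, ri (Sum.inl a) = ri (Sum.inl c) →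
        F.graph.Reachable (Sum.inl a) (Sum.inl c) := by
      intro a c h
      have h1 := hR.reachable (Sum.inl a)
      rw [h] at h1
      exact h1.symm.trans (hR.reachable (Sum.inl c))
    obtain ⟨p⟩ := key (ha'.trans hc'.symm)
    obtain ⟨p'⟩ := key (hb'.trans hd'.symm)
    -- The common vertex of the two interlaced walks puts both pairs into one component.
    obtain ⟨z, hz, hz'⟩ := F.planar a b c d hab hbc hcd p p'
    have h1 : ri (Sum.inl a) = ri (Sum.inl b) :=
      hR.ri_eq ((p.takeUntil z hz).reachable.trans (p'.takeUntil z hz').reachable.symm)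
    rw [ha', hb'] at h1
    subst h1
    rw [hR.eq_of_child hu hu']

include hR in
theorem exists_mem_forestCode {v b : Fin n ⊕ Fin F.numInternal} (hv : Ch v b) :
    ∃ s, ((ri v : ℕ), s) ∈ forestCode Ch code ∧ Sub (code v) s := by
  obtain ⟨u, h1, h2⟩ := (hR.below_root v).exists_child (by
    rintro h
    rw [h] at hv
    exact hR.root v b hv)
  exact ⟨_, mem_forestCode.2 ⟨u, _, h1, rfl⟩, (hC.sub_code hR h1).2 ⟨v, h2, rfl⟩⟩

/-- The encoding of the internal vertices of a forest. -/
def _root_.MomAmp.internalCode {n : ℕ} {F : GrassmannianForest n}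
    (ri : Fin n ⊕ Fin F.numInternal → Fin n)
    (code : Fin n ⊕ Fin F.numInternal → Term) (w : Fin F.numInternal) : ℕ × Term :=
  (ri (Sum.inr w), code (Sum.inr w))

theorem vertexCode_eq {i : ℕ} {v : Fin n ⊕ Fin F.numInternal} (h : (ri v : ℕ) = i) :
    vertexCode (internalCode ri code) v = place i (code v) := by
  subst h
  rcases v with j | w
  · rw [hC.inl]
    rfl
  · rw [hC.place_inr]
    rfl

include hR in
theorem eq_of_below {u v b : Fin n ⊕ Fin F.numInternal} (hv : Ch v b) (h : Below Ch u v)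
    (heq : code u = code v) : u = v := by
  by_contra hne
  obtain ⟨w, h1, h2⟩ := h.exists_child hne
  obtain ⟨w', rfl⟩ := hR.eq_inr_of_child h1 hv
  have h3 := (hC.child_inr.2 ⟨_, h1, rfl⟩).length_nodes_lt
  have h4 := ((hC.sub_code hR h1).2 ⟨u, h2, rfl⟩).length_nodes_le
  rw [← heq] at h3
  rcases h4 with h4 | h4
  · rw [h4] at h3
    exact lt_irrefl _ h3
  · omega

-- Vertices with equal codes have the same leaves below them. If there is one, both are its
-- ancestors, hence comparable, and a proper ancestor has a strictly larger tree. If there is none,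
-- both hang directly from their common root, which has only one child.
include hR in
theorem internalCode_injective : Function.Injective (internalCode ri code) := by
  intro w w' h
  rw [internalCode, internalCode, Prod.mk.injEq, Fin.val_inj] at h
  obtain ⟨h1, h2⟩ := h
  obtain ⟨b, hb⟩ := hR.exists_parent_inr w
  obtain ⟨b', hb'⟩ := hR.exists_parent_inr w'
  have h3 : ∀ i, Below Ch (Sum.inl i) (Sum.inr w) ↔ Below Ch (Sum.inl i) (Sum.inr w') := by
    intro i
    have h4 := hC.mem_leaves hR hb (j := i)
    rw [h2, hC.mem_leaves hR hb'] at h4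
    constructor
    · intro h5
      obtain ⟨k, h6, h7⟩ := h4.2 ⟨i, rfl, h5⟩
      rwa [← Fin.ext h6]
    · intro h5
      obtain ⟨k, h6, h7⟩ := h4.1 ⟨i, rfl, h5⟩
      rwa [← Fin.ext h6]
  by_cases h4 : ∃ i, Below Ch (Sum.inl i) (Sum.inr w)
  · obtain ⟨i, hi⟩ := h4
    rcases hR.orientation.total hi ((h3 i).1 hi) with h5 | h5
    · exact Sum.inr_injective (hC.eq_of_below hR hb' h5 h2)
    · exact (Sum.inr_injective (hC.eq_of_below hR hb h5 h2.symm)).symm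
  · have h5 : ∀ w b, Ch (Sum.inr w) b → (¬ ∃ i, Below Ch (Sum.inl i) (Sum.inr w)) →
        b = Sum.inl (ri (Sum.inr w)) := by
      intro w b hb h
      rcases hR.exists_child_or hb with h6 | ⟨i, rfl⟩
      · exact (h (hR.exists_leaf fun _ _ => h6)).elim
      · rw [hR.eq_root_of_child hb]
    have h6 := h5 w b hb h4
    have h7 := h5 w' b' hb' (by simpa only [h3] using h4)
    subst h6
    subst h7
    rw [← h1] at hb'
    exact Sum.inr_injective (hR.eq_of_child hb hb')

include hR in
theorem isCoding : IsCoding F (forestCode Ch code) (internalCode ri code) where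
  graphCoding := by
    have hinj : Function.Injective (vertexCode (n := n) (internalCode ri code)) :=
      Function.Injective.sumMap Fin.val_injective (hC.internalCode_injective hR)
    have hch : ∀ a b, Ch a b ↔ IsParent (forestCode Ch code)
        (vertexCode (internalCode ri code) a) (vertexCode (internalCode ri code) b) := by
      intro a b
      rcases b with i | w
      · change _ ↔ IsParent _ _ (Sum.inl (i : ℕ))
        rw [isParent_inl_iff]
        constructor
        · intro h
          refine ⟨code a, mem_forestCode.2 ⟨a, i, h, rfl⟩, hC.vertexCode_eq ?_⟩
          rw [← hR.eq_root_of_child h]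
        · rintro ⟨s, h1, h2⟩
          obtain ⟨u, i', h3, h4⟩ := mem_forestCode.1 h1
          rw [Prod.mk.injEq, Fin.val_inj] at h4
          obtain ⟨rfl, rfl⟩ := h4
          have h5 : vertexCode (internalCode ri code) u = place i (code u) :=
            hC.vertexCode_eq (by rw [← hR.eq_root_of_child h3])
          rw [← h5] at h2
          rwa [hinj h2]
      · obtain ⟨b, hb⟩ := hR.exists_parent_inr w
        obtain ⟨s, hs, hsub⟩ := hC.exists_mem_forestCode hR hb
        change _ ↔ IsParent _ _ (Sum.inr ((ri (Sum.inr w) : ℕ), code (Sum.inr w)))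
        rw [isParent_inr_iff hs hsub]
        constructor
        · intro h
          refine ⟨code a, hC.child_inr.2 ⟨a, h, rfl⟩, hC.vertexCode_eq ?_⟩
          rw [hR.ri_eq_of_child h]
        · rintro ⟨t, h1, h2⟩
          obtain ⟨u, h3, rfl⟩ := hC.child_inr.1 h1
          have h5 : vertexCode (internalCode ri code) u = place (ri (Sum.inr w)) (code u) :=
            hC.vertexCode_eq (by rw [hR.ri_eq_of_child h3])
          rw [← h5] at h2
          rwa [hinj h2]
    refine ⟨hC.internalCode_injective hR, fun r t => ⟨?_, ?_⟩, fun u v => ?_⟩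
    · rintro ⟨w, hw⟩
      rw [internalCode, Prod.mk.injEq] at hw
      obtain ⟨rfl, rfl⟩ := hw
      obtain ⟨b, hb⟩ := hR.exists_parent_inr w
      obtain ⟨s, hs, hsub⟩ := hC.exists_mem_forestCode hR hb
      obtain ⟨l, h1, -⟩ := hC.inr w
      exact ⟨s, hs, mem_nodes.2 ⟨hsub, _, _, h1⟩⟩
    · rintro ⟨s, hs, ht⟩
      obtain ⟨hsub, h, cs, rfl⟩ := mem_nodes.1 ht
      obtain ⟨u, i, hu, h1⟩ := mem_forestCode.1 hs
      rw [Prod.mk.injEq] at h1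
      obtain ⟨rfl, rfl⟩ := h1
      obtain ⟨v, hv, h2⟩ := (hC.sub_code hR hu).1 hsub
      rcases v with j | w
      · rw [hC.inl] at h2
        cases h2
      · refine ⟨w, ?_⟩
        rw [internalCode, ← h2, hR.ri_eq_of_below hv, ← hR.eq_root_of_child hu]
    · rw [hR.orientation.adj_iff, hch, hch]
  helicity w := by
    obtain ⟨l, h1, -⟩ := hC.inr w
    rw [internalCode, h1]
    rfl

end IsTermCode

/-- Every contracted forest has a code. -/
theorem exists_code {n : ℕ} (F : GrassmannianForest n) (hF : F.IsContracted) :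
    ∃ (Φ : Finset (ℕ × Term)) (c : _), IsForest {i | i < n} Φ ∧ IsCoding F Φ c := by
  obtain ⟨ri, Ch, hR⟩ := exists_isRooting F
  obtain ⟨code, hC⟩ := hR.exists_isTermCode
  exact ⟨_, _, hC.isForest hR hF, hC.isCoding hR⟩

end MomAmp

namespace MomAmp

open Term

/-! ### Type and dimension of an encoded forest -/

/-- The total helicity of a component. -/
def compHelicity (K : ℕ × Term) : ℕ :=
  match K.2 with
  | node h [] => h
  | t => 1 + (t.nodes.map fun t => t.rootHelicity - 1).sum

/-- The dimension of a component. -/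
def compDim (K : ℕ × Term) : ℕ :=
  match K.2 with
  | node _ [] => 0
  | t => 1 + (t.nodes.map fun t => qExp t.rootHelicity t.arity).sum

theorem Term.rootWeight_eq (t : Term) : t.rootWeight =
    Polynomial.C Polynomial.X ^ (t.rootHelicity - 1) *
      Polynomial.X ^ qExp t.rootHelicity t.arity := by
  cases t with
  | leaf i => simp [rootWeight, rootHelicity, arity, qExp]
  | node h cs => rfl

theorem Term.weight_eq (t : Term) : t.weight =
    Polynomial.C Polynomial.X ^ (t.nodes.map fun t => t.rootHelicity - 1).sum *
      Polynomial.X ^ (t.nodes.map fun t => qExp t.rootHelicity t.arity).sum := by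
  rw [weight]
  induction t.nodes with
  | nil => simp
  | cons s l ih =>
    rw [List.map_cons, List.prod_cons, ih, rootWeight_eq, List.map_cons, List.map_cons,
      List.sum_cons, List.sum_cons, pow_add, pow_add]
    ring

theorem compWeight_eq (K : ℕ × Term) : compWeight K =
    Polynomial.C Polynomial.X ^ compHelicity K * Polynomial.X ^ compDim K := by
  obtain ⟨r, t⟩ := K
  have key : Polynomial.C Polynomial.X * Polynomial.X * t.weight =
      (Polynomial.C Polynomial.X ^ (1 + (t.nodes.map fun t => t.rootHelicity - 1).sum) *
      Polynomial.X ^ (1 + (t.nodes.map fun t => qExp t.rootHelicity t.arity).sum) : CoeffRing) := by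
    rw [weight_eq, pow_add, pow_add]
    ring
  rcases t with i | ⟨h, _ | ⟨s, cs⟩⟩
  · exact key
  · simp [compWeight, compHelicity, compDim]
  · exact key

theorem forestWeight_eq (Φ : Finset (ℕ × Term)) : forestWeight Φ =
    Polynomial.C Polynomial.X ^ (∑ K ∈ Φ, compHelicity K) *
      Polynomial.X ^ (∑ K ∈ Φ, compDim K) := by
  rw [forestWeight, ← Finset.prod_pow_eq_pow_sum, ← Finset.prod_pow_eq_pow_sum,
    ← Finset.prod_mul_distrib]
  exact Finset.prod_congr rfl fun K _ => compWeight_eq K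

theorem coeff_coeff_monomial (a b k r : ℕ) :
    (((Polynomial.C Polynomial.X ^ a * Polynomial.X ^ b : CoeffRing).coeff r).coeff k : ℚ) =
      if a = k ∧ b = r then 1 else 0 := by
  rw [← Polynomial.C_pow, Polynomial.coeff_C_mul_X_pow]
  by_cases h : r = b
  · rw [if_pos h, Polynomial.coeff_X_pow]
    exact if_congr (by simp [h, eq_comm]) rfl rfl
  · rw [if_neg h, if_neg fun h' => h h'.2.symm, Polynomial.coeff_zero]

theorem coeffXYQ_forestGF (n k r : ℕ) : coeffXYQ forestGF n k r =
    {Φ ∈ forestCodes n | ∑ K ∈ Φ, compHelicity K = k ∧ ∑ K ∈ Φ, compDim K = r}.card := by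
  rw [coeffXYQ, ← sum_forestCodes, Polynomial.finsetSum_coeff, Polynomial.finsetSum_coeff,
    Finset.card_filter, Nat.cast_sum]
  refine Finset.sum_congr rfl fun Φ _ => ?_
  rw [forestWeight_eq, coeff_coeff_monomial, Nat.cast_ite, Nat.cast_one, Nat.cast_zero]

theorem coeffXYQ_treeGF (n k r : ℕ) : coeffXYQ treeGF n k r =
    {K ∈ compsOf (List.range n) | compHelicity K = k ∧ compDim K = r}.card := by
  have h := sum_compWeight (List.range n)
  rw [List.length_range] at h
  rw [coeffXYQ, ← h, Polynomial.finsetSum_coeff, Polynomial.finsetSum_coeff,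
    Finset.card_filter, Nat.cast_sum]
  refine Finset.sum_congr rfl fun K _ => ?_
  rw [compWeight_eq, coeff_coeff_monomial, Nat.cast_ite, Nat.cast_one, Nat.cast_zero]

/-- Every vertex of the tree except its top is a child exactly once, so the arities add up to the
number of nodes plus the number of leaves minus one. -/
theorem Term.sum_arity_sub_one (t : Term) :
    (t.nodes.map fun s => (s.arity : ℚ) - 1).sum = t.leaves.length - 1 := by
  induction t using Term.induction with
  | hleaf i => simp
  | hnode h cs ih =>
    have key : ∀ l : List Term, (∀ t ∈ l, (t.nodes.map fun s => (s.arity : ℚ) - 1).sum =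
        t.leaves.length - 1) → (((l.map nodes).flatten.map fun s => (s.arity : ℚ) - 1).sum =
          (l.map leaves).flatten.length - l.length) := by
      intro l hl
      induction l with
      | nil => simp
      | cons t l ih =>
        rw [List.map_cons, List.flatten_cons, List.map_append, List.sum_append,
          hl t List.mem_cons_self, ih fun t ht => hl t (List.mem_cons_of_mem _ ht), List.map_cons,
          List.flatten_cons, List.length_append, List.length_cons]
        push_cast
        ring
    rw [nodes_node, List.map_cons, List.sum_cons, key cs ih, leaves_node, arity]
    ring

theorem one_le_of_mem_nodes {s t : Term} (hs : Good s) (ht : t ∈ nodes s) :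
    1 ≤ t.rootHelicity ∧ 2 ≤ t.arity := by
  obtain ⟨h1, h, cs, rfl⟩ := mem_nodes.1 ht
  cases h1.good hs with
  | node _ _ hc h1 h2 => exact ⟨h1, hc⟩

/-- For a good tree with L leaves, Σ(c - 1) = L - 1 and the block has L + 1 leaves, so the
half-integers cancel and leave 1 + Σ(h - 1). For a boundary leaf the sum is h - 1/2 + 1/2. -/
theorem GoodComp.helicity_eq {K : ℕ × Term} (hK : GoodComp K) :
    (K.2.nodes.map fun t => (t.rootHelicity : ℚ) - ((t.arity : ℚ) + 1) / 2).sum +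
      ((block K).length : ℚ) / 2 = compHelicity K := by
  obtain ⟨r, s⟩ := K
  rcases hK with (hK | hK) | hK
  · simp only at hK
    subst hK
    simp [compHelicity, block, nodes_node, leaves_node, rootHelicity, arity]
  · simp only at hK
    subst hK
    simp [compHelicity, block, nodes_node, leaves_node, rootHelicity, arity]
  · simp only at hK
    have h1 : compHelicity (r, s) = 1 + (s.nodes.map fun t => t.rootHelicity - 1).sum := by
      cases hK with
      | leaf i => rfl
      | node h cs hc =>
        rcases cs with _ | ⟨t, cs⟩
        · simp at hc
        · rfl
    have h2 : ∀ l : List Term, (∀ t ∈ l, 1 ≤ t.rootHelicity) →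
        (l.map fun t => (t.rootHelicity : ℚ) - ((t.arity : ℚ) + 1) / 2).sum =
          ((l.map fun t => t.rootHelicity - 1).sum : ℕ) -
            (l.map fun s => (s.arity : ℚ) - 1).sum / 2 := by
      intro l hl
      induction l with
      | nil => simp
      | cons t l ih =>
        simp only [List.map_cons, List.sum_cons]
        rw [ih fun t ht => hl t (List.mem_cons_of_mem _ ht), Nat.cast_add,
          Nat.cast_sub (hl t List.mem_cons_self)]
        push_cast
        ring
    rw [h1, h2 _ fun t ht => (one_le_of_mem_nodes hK ht).1, Term.sum_arity_sub_one, block,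
      List.length_cons]
    push_cast
    ring

end MomAmp

/-! ### Contractedness, type and M-dimension read off from the code. -/

namespace MomAmp

open Term

theorem IsForest.sum_length_block {n : ℕ} {Φ : Finset (ℕ × Term)} (hΦ : IsForest {i | i < n} Φ) :
    ∑ K ∈ Φ, (block K).length = n := by
  have h1 : Finset.range n = Φ.biUnion fun K => (block K).toFinset := by
    ext i
    rw [Finset.mem_range, Finset.mem_biUnion]
    simpa using hΦ.cover i
  rw [← Finset.card_range n, h1, Finset.card_biUnion]
  · exact Finset.sum_congr rfl fun K hK =>
      (List.toFinset_card_of_nodup (hΦ.nodup_block hK)).symm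
  · intro K hK K' hK' hne
    rw [Function.onFun, Finset.disjoint_left]
    intro i hi hi'
    exact hne (hΦ.disjoint K hK K' hK' i (List.mem_toFinset.1 hi) (List.mem_toFinset.1 hi'))

namespace IsGraphCoding

variable {n m : ℕ} {G : SimpleGraph (Fin n ⊕ Fin m)} {Φ : Finset (ℕ × Term)}
  {c : Fin m → ℕ × Term} (hΦ : IsForest {i | i < n} Φ) (hc : IsGraphCoding G Φ c)
include hΦ hc

theorem sum_eq {M : Type*} [AddCommMonoid M] (f : ℕ × Term → M) :
    ∑ w, f (c w) = ∑ K ∈ Φ, (K.2.nodes.map fun t => f (K.1, t)).sum := by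
  have h1 : Finset.univ.image c =
      Φ.biUnion fun K => (nodes K.2).toFinset.image (Prod.mk K.1) := by
    ext ⟨r, t⟩
    simp only [Finset.mem_image, Finset.mem_univ, true_and, Finset.mem_biUnion,
      List.mem_toFinset]
    rw [hc.range]
    constructor
    · rintro ⟨s, h1, h2⟩
      exact ⟨(r, s), h1, t, h2, rfl⟩
    · rintro ⟨⟨r', s⟩, h1, t', h2, h3⟩
      cases h3
      exact ⟨s, h1, h2⟩
  rw [← Finset.sum_image (f := f) (fun w _ w' _ h => hc.inj h), h1, Finset.sum_biUnion]
  · refine Finset.sum_congr rfl fun K hK => ?_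
    rw [Finset.sum_image fun t _ t' _ h => (Prod.mk.inj h).2,
      List.sum_toFinset _ ((hΦ.good K hK).nodup_nodes (hΦ.nodup_block hK))]
  · intro K hK K' hK' hne
    rw [Function.onFun, Finset.disjoint_left]
    intro p hp hp'
    obtain ⟨t, -, rfl⟩ := Finset.mem_image.1 hp
    obtain ⟨t', -, h⟩ := Finset.mem_image.1 hp'
    obtain ⟨r, s⟩ := K
    obtain ⟨r', s'⟩ := K'
    obtain rfl : r' = r := (Prod.mk.inj h).1
    exact hne (by rw [hΦ.eq_of_fst hK hK'])

/-- The vertices of the component of `K`. -/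
theorem sum_component {M : Type*} [AddCommMonoid M] (f : ℕ × Term → M) {K : ℕ × Term}
    (hK : K ∈ Φ) : (∑ w, if (c w).1 = K.1 then f (c w) else 0) =
      (K.2.nodes.map fun t => f (K.1, t)).sum := by
  rw [sum_eq hΦ hc fun p => if p.1 = K.1 then f p else 0, Finset.sum_eq_single K]
  · simp
  · rintro ⟨r, s⟩ hs hne
    obtain ⟨r', s'⟩ := K
    have h : r ≠ r' := by
      rintro rfl
      exact hne (by rw [hΦ.eq_of_fst hs hK])
    simp [h]
  · exact fun h => absurd hK h

theorem reachable_root_inr_iff {K : ℕ × Term} (hK : K ∈ Φ) (w : Fin m) :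
    G.Reachable (Sum.inl ⟨K.1, hΦ.fst_mem hK⟩) (Sum.inr w) ↔ (c w).1 = K.1 := by
  rw [reachable_root_iff hΦ hc (s := K.2) hK]
  constructor
  · rintro (h | ⟨t, -, h⟩)
    · cases h
    · have h1 := place_eq_inr.1 h.symm
      exact h1.1.symm
  · intro h
    obtain ⟨r, s, k, cs, h1, h2, h3⟩ := hc.exists_eq_node w
    obtain ⟨r', s'⟩ := K
    rw [h3] at h
    simp only at h
    subst h
    rw [hΦ.eq_of_fst hK h1]
    exact Or.inr ⟨_, h2, congrArg Sum.inr h3⟩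

/-- The components of the graph correspond to the elements of `Φ`. -/
theorem bijective_component : Function.Bijective fun K : {K // K ∈ Φ} =>
    G.connectedComponentMk (Sum.inl ⟨K.1.1, hΦ.fst_mem K.2⟩) := by
  constructor
  · rintro ⟨K, hK⟩ ⟨K', hK'⟩ h
    have h1 := (reachable_root_inl_iff hΦ hc hK).1 (SimpleGraph.ConnectedComponent.exact h)
    exact Subtype.ext (hΦ.disjoint K hK K' hK' _ h1 (fst_mem_block K'))
  · intro T
    induction T using SimpleGraph.ConnectedComponent.ind with
    | _ v =>
      obtain ⟨K, hK, h⟩ := exists_reachable_root hΦ hc v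
      exact ⟨⟨K, hK⟩, SimpleGraph.ConnectedComponent.sound h⟩

theorem connected_iff (hn : 0 < n) : G.Connected ↔ ∃ K, Φ = {K} := by
  constructor
  · intro h
    obtain ⟨K, hK, -⟩ := (hΦ.cover 0).1 hn
    refine ⟨K, Finset.eq_singleton_iff_unique_mem.2 ⟨hK, fun K' hK' => ?_⟩⟩
    have h1 := (reachable_root_inl_iff hΦ hc hK).1 (h.preconnected _
      (Sum.inl ⟨K'.1, hΦ.fst_mem hK'⟩))
    exact hΦ.disjoint K' hK' K hK _ (fst_mem_block K') h1
  · rintro ⟨K, hK⟩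
    have hr : ∀ v, G.Reachable (Sum.inl ⟨K.1, hΦ.fst_mem (by simp [hK])⟩) v := by
      intro v
      obtain ⟨K', hK', h⟩ := exists_reachable_root hΦ hc v
      obtain rfl : K' = K := by simpa [hK] using hK'
      exact h
    have : Nonempty (Fin n ⊕ Fin m) := ⟨Sum.inl ⟨0, hn⟩⟩
    exact ⟨fun u v => (hr u).symm.trans (hr v)⟩

end IsGraphCoding

namespace IsCoding

variable {n : ℕ} {F : GrassmannianForest n} {Φ : Finset (ℕ × Term)}
  {c : Fin F.numInternal → ℕ × Term} (hΦ : IsForest {i | i < n} Φ) (hc : IsCoding F Φ c)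
include hΦ hc

theorem deg_eq (w : Fin F.numInternal) : F.deg w = (c w).2.arity + 1 := by
  obtain ⟨r, s, h, cs, h1, h2, h3⟩ := hc.graphCoding.exists_eq_node w
  rw [GrassmannianForest.deg, IsGraphCoding.ncard_neighborSet_inr hΦ hc.graphCoding h3, h3]
  rfl

theorem isContracted : F.IsContracted := by
  have key : ∀ v w, IsParent Φ (Sum.inr (c v)) (Sum.inr (c w)) →
      ¬ (F.IsWhite v ∧ F.IsWhite w) ∧ ¬ (F.IsBlack v ∧ F.IsBlack w) := by
    intro v w hvw
    obtain ⟨r, s, h, cs, hs, hsub, hw⟩ := hc.graphCoding.exists_eq_node w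
    rw [hw, isParent_inr_iff hs hsub] at hvw
    obtain ⟨t, ht, hv⟩ := hvw
    obtain ⟨-, rfl, h', cs', ht'⟩ := place_eq_inr.1 hv.symm
    rw [child_node] at ht
    have hgood : Good (node h cs) := by
      rcases (hΦ.good _ hs).sub_node hsub with ⟨rfl, -⟩ | h1
      · simp at ht
      · exact hsub.good h1.2.2.2
    cases hgood with
    | node _ _ _ _ _ _ hatt =>
      have h1 := hatt _ ht
      rw [GrassmannianForest.IsWhite, GrassmannianForest.IsWhite, GrassmannianForest.IsBlack,
        GrassmannianForest.IsBlack, hc.deg_eq hΦ, hc.deg_eq hΦ, hc.helicity, hc.helicity, hw]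
      rw [ht'] at h1 ⊢
      exact ⟨fun h2 => h1.1 h2.2 h2.1, fun h2 => h1.2 (Nat.succ_injective h2.2)
        (Nat.succ_injective h2.1)⟩
  intro v w h
  rcases (hc.graphCoding.adj _ _).1 h with h | h
  · exact key v w h
  · have h1 := key w v h
    rwa [and_comm (a := F.IsWhite w), and_comm (a := F.IsBlack w)] at h1

theorem totalHelicity_eq : F.totalHelicity = (∑ K ∈ Φ, compHelicity K : ℕ) := by
  rw [GrassmannianForest.totalHelicity]
  simp only [hc.deg_eq hΦ, hc.helicity]
  rw [IsGraphCoding.sum_eq hΦ hc.graphCoding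
    fun p => (p.2.rootHelicity : ℚ) - ((p.2.arity + 1 : ℕ) : ℚ) / 2]
  conv_lhs => rw [← hΦ.sum_length_block]
  rw [Nat.cast_sum, Nat.cast_sum, Finset.sum_div, ← Finset.sum_add_distrib]
  refine Finset.sum_congr rfl fun K hK => ?_
  rw [← (hΦ.good K hK).helicity_eq]
  push_cast
  rfl

theorem numLeaves_eq {K : ℕ × Term} (hK : K ∈ Φ) :
    F.numLeaves (F.graph.connectedComponentMk (Sum.inl ⟨K.1, hΦ.fst_mem hK⟩)) =
      (block K).length := by
  rw [GrassmannianForest.numLeaves, ← Set.ncard_image_of_injective _ Fin.val_injective,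
    ← List.toFinset_card_of_nodup (hΦ.nodup_block hK), ← Set.ncard_coe_finset]
  congr 1
  ext i
  rw [Finset.mem_coe, List.mem_toFinset, Set.mem_image]
  constructor
  · rintro ⟨j, hj, rfl⟩
    exact (IsGraphCoding.reachable_root_inl_iff hΦ hc.graphCoding hK).1
      (SimpleGraph.ConnectedComponent.exact hj).symm
  · intro hi
    exact ⟨⟨i, hΦ.mem_of_mem hK hi⟩, SimpleGraph.ConnectedComponent.sound
      ((IsGraphCoding.reachable_root_inl_iff hΦ hc.graphCoding hK).2 hi).symm, rfl⟩

/-- With degree c + 1 one gets deg - 2 = c - 1 and 2 deg - 5 = 2c - 3. The bound c ≥ 2 makes the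
truncated subtractions in `qExp` exact. -/
theorem vertexStat_eq {w : Fin F.numInternal} (hw : 2 ≤ (c w).2.arity) :
    F.vertexStat w - 1 = qExp (c w).2.rootHelicity (c w).2.arity := by
  rw [GrassmannianForest.vertexStat, GrassmannianForest.IsGeneric, GrassmannianForest.IsWhite,
    GrassmannianForest.IsBlack, hc.deg_eq hΦ, hc.helicity, Nat.succ_inj, ← not_or, qExp]
  by_cases h : (c w).2.rootHelicity = 1 ∨ (c w).2.rootHelicity = (c w).2.arity
  · rw [if_neg (not_not.2 h), if_pos h]
    omega
  · rw [if_pos h, if_neg h]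
    omega

/-- At most two leaves occur only for a boundary leaf (dimension 0) and for a single edge (dimension
1), because a good node has at least two leaves besides the root. -/
theorem treeDim_eq {K : ℕ × Term} (hK : K ∈ Φ) :
    F.treeDim (F.graph.connectedComponentMk (Sum.inl ⟨K.1, hΦ.fst_mem hK⟩)) = compDim K := by
  classical
  rw [GrassmannianForest.treeDim, hc.numLeaves_eq hΦ hK]
  rcases hΦ.good K hK with hb | hg
  · have h1 : (block K).length = 1 ∧ compDim K = 0 := by
      obtain ⟨r, s⟩ := K
      rcases hb with hb | hb <;> simp only at hb <;> subst hb <;>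
        simp [block, leaves_node, compDim]
    rw [h1.1, h1.2]
    simp
  · have hdim : compDim K = 1 + (K.2.nodes.map fun t => qExp t.rootHelicity t.arity).sum := by
      obtain ⟨r, s⟩ := K
      cases hg with
      | leaf i => rfl
      | node h cs hc =>
        rcases cs with _ | ⟨t, cs⟩
        · simp at hc
        · rfl
    split_ifs with hlen
    · obtain ⟨r, s⟩ := K
      cases hg with
      | leaf i => simp [block, compDim]
      | node h cs hlen' h1 h2 hgood =>
        have h3 := length_le_length_leaves hgood h
        rw [block, List.length_cons] at hlen
        simp only at hlen
        omega
    · rw [hdim, Nat.cast_add, Nat.cast_one, add_right_inj, Finset.sum_filter]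
      have h1 := IsGraphCoding.sum_component hΦ hc.graphCoding
        (fun p => qExp p.2.rootHelicity p.2.arity) hK
      rw [← h1, Nat.cast_sum]
      refine Finset.sum_congr rfl fun w _ => ?_
      rw [Nat.cast_ite, Nat.cast_zero]
      have h2 : F.graph.connectedComponentMk (Sum.inr w) =
          F.graph.connectedComponentMk (Sum.inl ⟨K.1, hΦ.fst_mem hK⟩) ↔ (c w).1 = K.1 := by
        rw [← IsGraphCoding.reachable_root_inr_iff hΦ hc.graphCoding hK,
          SimpleGraph.ConnectedComponent.eq, SimpleGraph.reachable_comm]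
      by_cases h3 : (c w).1 = K.1
      · rw [if_pos (h2.2 h3), if_pos h3, hc.vertexStat_eq hΦ]
        obtain ⟨s, hs, ht⟩ := (hc.graphCoding.range (c w).1 (c w).2).1 ⟨w, rfl⟩
        rw [h3] at hs
        rw [← hΦ.eq_of_fst hK hs] at ht
        exact (one_le_of_mem_nodes hg ht).2
      · rw [if_neg (h2.not.2 h3), if_neg h3]

theorem momDim_eq : F.momDim = (∑ K ∈ Φ, compDim K : ℕ) := by
  rw [GrassmannianForest.momDim, ← finsum_comp_equiv
    (Equiv.ofBijective _ (IsGraphCoding.bijective_component hΦ hc.graphCoding)),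
    finsum_eq_sum_of_fintype, Nat.cast_sum, ← Finset.sum_coe_sort Φ]
  exact Finset.sum_congr rfl fun K _ => hc.treeDim_eq hΦ K.2

end IsCoding

end MomAmp

namespace MomAmp

open Term

/-! ### Counting -/

/-- Classes of contracted forests are counted by their codes. -/
theorem finite_and_ncard_eq {n : ℕ} (P : GrassmannianForest n → Prop)
    (A : Finset (Finset (ℕ × Term))) (hA : ∀ Φ ∈ A, IsForest {i | i < n} Φ)
    (hP : ∀ F, P F → F.IsContracted) (hPA : ∀ (F : GrassmannianForest n) (Φ : _) (c : _),
      IsForest {i | i < n} Φ → IsCoding F Φ c → (P F ↔ Φ ∈ A)) :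
    {C : Quotient (GrassmannianForest.setoid n) | ∃ F, Quotient.mk _ F = C ∧ P F}.Finite ∧
      {C : Quotient (GrassmannianForest.setoid n) | ∃ F, Quotient.mk _ F = C ∧ P F}.ncard =
        A.card := by
  -- The map from A sending a code to the class of a realization hits every class satisfying P,
  -- because such a forest has a code and equal codes give equivalent forests; it is injective
  -- because codes pass to equivalent forests and are unique.
  choose real c hc using fun Φ : A => exists_isCoding (hA Φ.1 Φ.2)
  have hrange : {C : Quotient (GrassmannianForest.setoid n) | ∃ F, Quotient.mk _ F = C ∧ P F} =
      Set.range fun Φ : A => Quotient.mk (GrassmannianForest.setoid n) (real Φ) := by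
    ext C
    constructor
    · rintro ⟨F, rfl, hF⟩
      obtain ⟨Φ, c', hΦ, hc'⟩ := exists_code F (hP F hF)
      exact ⟨⟨Φ, (hPA F Φ c' hΦ hc').1 hF⟩, Quotient.sound ((hc _).equivalent hc')⟩
    · rintro ⟨Φ, rfl⟩
      exact ⟨real Φ, rfl, (hPA _ _ _ (hA Φ.1 Φ.2) (hc Φ)).2 Φ.2⟩
  have hinj : Function.Injective
      fun Φ : A => Quotient.mk (GrassmannianForest.setoid n) (real Φ) := by
    intro Φ Φ' h
    obtain ⟨c', hc'⟩ := (hc Φ).of_equivalent (Quotient.exact h)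
    exact Subtype.ext (hc'.unique (hA _ Φ.2) (hA _ Φ'.2) (hc Φ'))
  rw [hrange]
  refine ⟨Set.finite_range _, ?_⟩
  rw [← Set.image_univ, Set.ncard_image_of_injective _ hinj, Set.ncard_univ]
  simp

theorem contractedForests_finite_and_ncard (n k r : ℕ) : (contractedForests k n r).Finite ∧
    ((contractedForests k n r).ncard : ℚ) = coeffXYQ forestGF n k r := by
  have h := finite_and_ncard_eq (n := n)
    (fun F => F.IsContracted ∧ F.HasType k ∧ F.momDim = r)
    {Φ ∈ forestCodes n | ∑ K ∈ Φ, compHelicity K = k ∧ ∑ K ∈ Φ, compDim K = r}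
    (fun Φ hΦ => mem_forestCodes.1 (Finset.mem_filter.1 hΦ).1) (fun F hF => hF.1)
    (fun F Φ c hΦ hc => by
      rw [Finset.mem_filter, mem_forestCodes, GrassmannianForest.HasType, hc.totalHelicity_eq hΦ,
        hc.momDim_eq hΦ, Nat.cast_inj, Nat.cast_inj]
      exact ⟨fun h => ⟨hΦ, h.2⟩, fun h => ⟨hc.isContracted hΦ, h.2⟩⟩)
  refine ⟨h.1, ?_⟩
  rw [coeffXYQ_forestGF, ← h.2]
  rfl

theorem isForest_singleton_iff {n : ℕ} {K : ℕ × Term} :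
    IsForest {i | i < n} {K} ↔ K ∈ compsOf (List.range n) := by
  rw [mem_compsOf]
  constructor
  · intro h
    refine ⟨h.good K (by simp), ?_⟩
    have h1 := h.sorted K (by simp)
    have h2 : ∀ i, i ∈ block K ↔ i ∈ List.range n := by
      intro i
      rw [List.mem_range]
      have h3 := h.cover i
      simpa using h3.symm
    have h3 : (block K).Perm (List.range n) := (List.perm_ext_iff_of_nodup
      (h.nodup_block (by simp)) List.nodup_range).2 h2
    exact h3.eq_of_pairwise (fun a b _ _ hab hba => absurd hab (not_lt.2 hba.le)) h1
      List.pairwise_lt_range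
  · rintro ⟨h1, h2⟩
    have h3 := IsForest.singleton h1 (by rw [h2]; exact List.pairwise_lt_range)
    rw [h2] at h3
    simpa using h3

theorem contractedTrees_finite_and_ncard (n k r : ℕ) : (contractedTrees k n r).Finite ∧
    ((contractedTrees k n r).ncard : ℚ) = coeffXYQ treeGF n k r := by
  have h := finite_and_ncard_eq (n := n)
    (fun F => F.IsTree ∧ F.IsContracted ∧ F.HasType k ∧ F.momDim = r)
    ({K ∈ compsOf (List.range n) | compHelicity K = k ∧ compDim K = r}.image fun K => {K})
    (fun Φ hΦ => by
      obtain ⟨K, hK, rfl⟩ := Finset.mem_image.1 hΦ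
      exact isForest_singleton_iff.2 (Finset.mem_filter.1 hK).1) (fun F hF => hF.2.1)
    (fun F Φ c hΦ hc => by
      -- For n = 0 both sides are false: the graph has no vertices and is therefore not connected,
      -- while a component of the code would need a leaf.
      have htree : F.IsTree ↔ ∃ K, Φ = {K} := by
        rcases Nat.eq_zero_or_pos n with rfl | hn
        · constructor
          · rintro ⟨-⟩
            obtain ⟨i | w⟩ := ‹Nonempty (Fin 0 ⊕ Fin F.numInternal)›
            · exact i.elim0
            · exact (F.connected_to_boundary w).choose.elim0
          · rintro ⟨K, rfl⟩
            exact (Nat.not_lt_zero _ (hΦ.fst_mem (Finset.mem_singleton_self K))).elim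
        · exact IsGraphCoding.connected_iff hΦ hc.graphCoding hn
      rw [htree, GrassmannianForest.HasType, hc.totalHelicity_eq hΦ,
        hc.momDim_eq hΦ, Nat.cast_inj, Nat.cast_inj, Finset.mem_image]
      constructor
      · rintro ⟨⟨K, rfl⟩, -, h1, h2⟩
        rw [Finset.sum_singleton] at h1 h2
        exact ⟨K, Finset.mem_filter.2 ⟨isForest_singleton_iff.1 hΦ, h1, h2⟩, rfl⟩
      · rintro ⟨K, hK, rfl⟩
        rw [Finset.sum_singleton, Finset.sum_singleton]
        exact ⟨⟨K, rfl⟩, hc.isContracted hΦ, (Finset.mem_filter.1 hK).2⟩)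
  refine ⟨h.1, ?_⟩
  rw [coeffXYQ_treeGF, ← Finset.card_image_of_injective _ Finset.singleton_injective]
  exact_mod_cast h.2

theorem ncard_contractedForests_zero (n k : ℕ) :
    (contractedForests k n 0).ncard = n.choose k := by
  have h := (contractedForests_finite_and_ncard n k 0).2
  rw [coeffXYQ_forestGF_zero] at h
  exact_mod_cast h

/-- By the count, the cardinalities are the coefficients in q of the y^k part of the polynomial
[x^n] G_forest, so the sum is finite and equals the value of that part at q = -1. -/
theorem finsum_ncard_contractedForests {n k : ℕ} (hk : k ≤ n) :
    ∑ᶠ r : ℕ, (-1 : ℤ) ^ r * ((contractedForests k n r).ncard : ℤ) = 1 := by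
  set p := PowerSeries.coeff n forestGF with hp
  have h1 : ∀ r, ((contractedForests k n r).ncard : ℚ) = (p.coeff r).coeff k := fun r =>
    (contractedForests_finite_and_ncard n k r).2
  have h2 : (Function.support fun r : ℕ => (-1 : ℤ) ^ r * ((contractedForests k n r).ncard : ℤ)) ⊆
      Finset.range (p.natDegree + 1) := by
    intro r hr
    rw [Finset.coe_range, Set.mem_Iio]
    by_contra! h
    apply hr
    have h3 := h1 r
    rw [Polynomial.coeff_eq_zero_of_natDegree_lt (p := p) (by omega), Polynomial.coeff_zero,
      Nat.cast_eq_zero] at h3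
    beta_reduce
    rw [h3, Nat.cast_zero, mul_zero]
  rw [finsum_eq_sum_of_support_subset _ h2]
  have h3 := coeff_eval_neg_one_coeff_forestGF hk
  rw [← hp, Polynomial.eval_eq_sum_range, Polynomial.finsetSum_coeff] at h3
  have h4 : ((∑ r ∈ Finset.range (p.natDegree + 1),
      (-1 : ℤ) ^ r * ((contractedForests k n r).ncard : ℤ) : ℤ) : ℚ) = 1 := by
    rw [← h3, Int.cast_sum]
    refine Finset.sum_congr rfl fun r _ => ?_
    push_cast
    rw [h1 r]
    have h5 : (-1 : Polynomial ℚ) ^ r = Polynomial.C ((-1) ^ r) := by simp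
    rw [h5, Polynomial.coeff_mul_C, mul_comm]
  exact_mod_cast h4

end MomAmp

/-! ### The theorem. -/

theorem mainTheorem3 :
    -- the number of contracted Grassmannian trees is given by the coefficients of `G_tree`
    (∀ n k r : ℕ, (MomAmp.contractedTrees k n r).Finite ∧
      ((MomAmp.contractedTrees k n r).ncard : ℚ) = MomAmp.coeffXYQ MomAmp.treeGF n k r) ∧
    -- `x G_forest` is the compositional inverse of `x / (1 + G_tree)`
    MomAmp.x * MomAmp.forestGF =
      MomAmp.xDivOneAddTreeGF.substInvOfIsUnit MomAmp.isUnit_coeff_one_xDivOneAddTreeGF ∧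
    (∀ n : ℕ, PowerSeries.coeff n MomAmp.forestGF =
      (1 / ((n : ℚ) + 1)) • PowerSeries.coeff n ((1 + MomAmp.treeGF) ^ (n + 1))) ∧
    -- the number of contracted Grassmannian forests is given by the coefficients of `G_forest`
    (∀ n k r : ℕ, (MomAmp.contractedForests k n r).Finite ∧
      ((MomAmp.contractedForests k n r).ncard : ℚ) = MomAmp.coeffXYQ MomAmp.forestGF n k r) ∧
    -- algebraicity
    MomAmp.IsAlgebraicOfDegree MomAmp.treeGF 5 ∧
    MomAmp.treeRelation MomAmp.x MomAmp.y MomAmp.q MomAmp.treeGF = 0 ∧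
    MomAmp.IsAlgebraicOfDegree MomAmp.forestGF 6 ∧
    MomAmp.forestRelation MomAmp.x MomAmp.y MomAmp.q MomAmp.forestGF = 0 ∧
    -- forests of dimension zero
    (∀ n k : ℕ, (MomAmp.contractedForests k n 0).ncard = n.choose k ∧
      MomAmp.coeffXYQ MomAmp.forestGF n k 0 = n.choose k) ∧
    -- the alternating sum: the coefficient of `xⁿ yᵏ` in `G_forest(x, y, -1)` is one
    (∀ n k : ℕ, k ≤ n →
      ((PowerSeries.coeff n MomAmp.forestGF).eval (-1)).coeff k = 1 ∧
      ∑ᶠ r : ℕ, (-1 : ℤ) ^ r * ((MomAmp.contractedForests k n r).ncard : ℤ) = 1) ∧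
    -- the Euler characteristic of a CW complex whose cells are labelled by contracted forests
    (∀ n k : ℕ, k ≤ n → ∀ (Y : Type*) [TopologicalSpace Y] (M : Set Y) [Topology.CWComplex M],
      (∀ r : ℕ, Nonempty (Topology.RelCWComplex.cell M r ≃ MomAmp.contractedForests k n r)) →
      ∑ᶠ r : ℕ, (-1 : ℤ) ^ r * (Nat.card (Topology.RelCWComplex.cell M r) : ℤ) = 1) := by
  refine ⟨MomAmp.contractedTrees_finite_and_ncard, MomAmp.x_mul_forestGF, MomAmp.coeff_forestGF,
    MomAmp.contractedForests_finite_and_ncard, MomAmp.isAlgebraicOfDegree_treeGF,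
    MomAmp.treeRelation_treeGF, MomAmp.isAlgebraicOfDegree_forestGF,
    MomAmp.forestRelation_forestGF,
    fun n k => ⟨MomAmp.ncard_contractedForests_zero n k, MomAmp.coeffXYQ_forestGF_zero n k⟩,
    fun n k hk => ⟨MomAmp.coeff_eval_neg_one_coeff_forestGF hk,
      MomAmp.finsum_ncard_contractedForests hk⟩, fun n k hk Y _ M _ hM => ?_⟩
  refine Eq.trans (finsum_congr fun r => ?_) (MomAmp.finsum_ncard_contractedForests hk)
  obtain ⟨e⟩ := hM r
  rw [Nat.card_congr e, Nat.card_coe_set_eq]
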